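/- **Notation.** Write $D=\frac{\partial^2}{\partial z\partial z'}$ for independent complex variables $z,z'$. For a linear operator $A$ on functions, $\exp(A)f=\sum_{k\ge 0}\frac1{k!}A^kf$ pointwise; "converges" means absolute convergence at every point. For $c\neq0$ and a differential operator $E$, $c^{E}=\exp(\gamma E)$, where $\gamma$ is any number with $e^\gamma=c$. For $\alpha,\beta\ge0$ let $\mathcal E_{\alpha,\beta}$ be the set of entire functions $f$ on $\mathbb C^2$ with $|f(z,z')|\le C\exp\left(\tfrac12(\alpha|z|^2+\beta|z'|^2)\right)$ for some $C$, and for $a\ge 0$ let $\mathcal E_a$ be the set of entire functions $f$ on $\mathbb C$ with $|f(x)|\le C\exp(a|x|^2)$ for some $C$. $*$ is convolution with respect to Lebesgue measure, on $\mathbb C\cong\mathbb R^2$ or on $\mathbb R$. For $s>0$ put $G_s(z)=\frac1{\pi s}e^{-zz^*/s}$ $(z\in\mathbb C$, $z^*$ the complex conjugate$)$ and $g_s(x)=\frac1{\sqrt{\pi s}}e^{-x^2/s}$ $(x\in\mathbb R)$. For $r\ne0$, $r+s\neq0$ and $z_0,z_0'\in\mathbb C$ put $$R_s f(z,z')=\frac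 r{r+s}\,e^{-\frac{(z-z_0)(z'-z_0')}{r+s}}\exp\left(\tfrac{s(r+s)}{r}D\right)f\left(\tfrac{rz+sz_0}{r+s},\tfrac{rz'+sz_0'}{r+s}\right).$$ **Two variables.** (1) Let $r,s\in\mathbb C$, $r\neq0$, $\alpha,\beta\ge 0$ and $|s|\left(\sqrt{\alpha\beta}+\frac1{|r|}\right)<1$. Then $r+s\ne0$, and for all $f\in\mathcal E_{\alpha,\beta}$ the exponential series below converge and $$\exp(sD)\,e^{-\frac{zz'}r}f(z,z')=\frac r{r+s}\,e^{-\frac{zz'}{r+s}}\exp\left(\tfrac{s(r+s)}{r}D\right)f\left(\tfrac{rz}{r+s},\tfrac{rz'}{r+s}\right),$$ and, with arbitrary displacements $z_0,z_0'\in\mathbb C$, $$\exp(sD)\,e^{-\frac{(z-z_0)(z'-z_0')}r}f(z,z')=R_sf(z,z').$$ Moreover, $\left(\frac r{r+s}\right)^{(z-z_0)\frac{\partial}{\partial z}+(z'-z_0')\frac{\partial}{\partial z'}}f(z,z')=f\left(\tfrac{rz+sz_0}{r+s},\tfrac{rz'+sz_0'}{r+s}\right)$ with a convergent exponential series, and as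 operators on $\mathcal E_{\alpha,\beta}$ $$\exp(sD)\,e^{-\frac{(z-z_0)(z'-z_0')}r}=\frac r{r+s}\,e^{-\frac{(z-z_0)(z'-z_0')}{r+s}}\exp\left(\tfrac{s(r+s)}{r}D\right)\left(\tfrac r{r+s}\right)^{(z-z_0)\frac{\partial}{\partial z}+(z'-z_0')\frac{\partial}{\partial z'}} ,$$ in particular for $z_0=z_0'=0$. (2) For every entire $f$ on $\mathbb C^2$, every $r\ne0$, all $z_0,z_0'$ and every point $(z,z')$, the identity of (1) holds as an identity of formal expansions in powers of $s$: for every $N$, when both exponential series are cut off to the terms $k<N$, the two sides differ by $O(s^N)$ as $s\to0$. (3) Let $r\neq0$ and $f\in\mathcal E_{\alpha,\beta}$ with $\alpha,\beta\ge 0$. For all $s\in\mathbb C$ with $|sr|\sqrt{\alpha\beta}<|r+s|$ the series in $R_sf$ converges, $R_sf$ is entire in $(z,z')$ and complex differentiable in $s$, and $\frac{\partial}{\partial s}R_sf=DR_sf$, $R_0f=e^{-(z-z_0)(z'-z_0')/r}f$. (4) Let $s>0$, $\alpha,\beta\ge0$, $s\frac{\alpha+\beta}2<1$ and $g\in\mathcal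 E_{\alpha,\beta}$. Then $\exp(sD)g$ converges, and for all $z\in\mathbb C$ the convolution integral converges absolutely and $\left(\exp(sD)g\right)(z,z^*)=\left(G_s*g(\cdot,\cdot^*)\right)(z)$. (5) Let $r,s>0$, $z_0\in\mathbb C$, and let $f:\mathbb C\to\mathbb C$ be arbitrary. For every $z\in\mathbb C$, $$\left(G_s*\left(e^{-\frac{|w-z_0|^2}r}f(w)\right)\right)(z)=\frac r{r+s}\,e^{-\frac{|z-z_0|^2}{r+s}}\left(G_{s(r+s)/r}*f\left(\tfrac{rw+sz_0}{r+s}\right)\right)(z),$$ where one of the two convolution integrals converges absolutely if and only if the other does. (6) If $|s|<|r|$ then $\exp(sD)\frac1{\pi r}e^{-zz'/r}$ converges and equals $\frac1{\pi(r+s)}e^{-zz'/(r+s)}$. If $r,s>0$ then $G_s*G_r=G_{r+s}$, with absolutely convergent integrals. **One variable.** Put $$Q_sf(x)=\sqrt{\tfrac r{r+s}}\;e^{-\frac{(x-x_0)^2}{r+s}}\exp\left(\tfrac{s(r+s)}{4r}\tfrac{\partial^2}{\partial x^2}\right)f\left(\tfrac{rx+sx_0}{r+s}\right)$$ with the principal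 square root. (1') Let $r,s\in\mathbb C$, $r\ne0$, $a\ge0$ and $|s|\left(a+\frac1{|r|}\right)<1$. Then $r+s\ne0$, and for all $f\in\mathcal E_a$ the exponential series below converge and $$\exp\left(\tfrac s4\tfrac{\partial^2}{\partial x^2}\right)e^{-\frac{x^2}r}f(x)=\sqrt{\tfrac r{r+s}}\;e^{-\frac{x^2}{r+s}}\exp\left(\tfrac{s(r+s)}{4r}\tfrac{\partial^2}{\partial x^2}\right)f\left(\tfrac{rx}{r+s}\right),$$ and, for every $x_0\in\mathbb C$, $\exp\left(\frac s4\frac{\partial^2}{\partial x^2}\right)e^{-(x-x_0)^2/r}f(x)=Q_sf(x)$. Moreover, $\left(\frac r{r+s}\right)^{(x-x_0)\frac{\partial}{\partial x}}f(x)=f\left(\tfrac{rx+sx_0}{r+s}\right)$ with a convergent exponential series, and as operators on $\mathcal E_a$ $$\exp\left(\tfrac s4\tfrac{\partial^2}{\partial x^2}\right)e^{-\frac{(x-x_0)^2}r}=\sqrt{\tfrac r{r+s}}\;e^{-\frac{(x-x_0)^2}{r+s}}\exp\left(\tfrac{s(r+s)}{4r}\tfrac{\partial^2}{\partial x^2}\right)\left(\tfrac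 r{r+s}\right)^{(x-x_0)\frac{\partial}{\partial x}}.$$ (2') For every entire $f$ on $\mathbb C$, every $r\neq0$, every $x_0$ and every $x$, the identity of (1') holds as an identity of formal expansions in powers of $s$, in the sense of (2). (3') Let $r\ne0$, $a\ge 0$ and $f\in\mathcal E_a$. For all $s\in\mathbb C$ with $|sr|a<|r+s|$ and $\frac r{r+s}\notin(-\infty,0]$ the series in $Q_sf$ converges, $Q_sf$ is entire in $x$ and complex differentiable in $s$, and $\frac{\partial}{\partial s}Q_sf=\frac14\frac{\partial^2}{\partial x^2}Q_sf$, $Q_0f=e^{-(x-x_0)^2/r}f$. (4') Let $s>0$, $a\ge0$, $sa<1$ and $g\in\mathcal E_a$. Then $\exp\left(\frac s4\frac{\partial^2}{\partial x^2}\right)g$ converges, and for all $x\in\mathbb R$ the convolution integral converges absolutely and $\exp\left(\frac s4\frac{\partial^2}{\partial x^2}\right)g(x)=(g_s*g|_{\mathbb R})(x)$. (5') Let $r,s>0$, $x_0\in\mathbb R$, and let $f:\mathbb R\to\mathbb C$ be arbitrary. For every $x\in\mathbb R$, $$\left(g_s*\left(e^{-\frac{(y-x_0)^2}r}f(y)\right)\right)(x)=\sqrt{\tfrac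 r{r+s}}\;e^{-\frac{(x-x_0)^2}{r+s}}\left(g_{s(r+s)/r}*f\left(\tfrac{ry+sx_0}{r+s}\right)\right)(x),$$ where one of the two convolution integrals converges absolutely if and only if the other does. (6') If $r,s>0$ then $g_s*g_r=g_{r+s}$, with absolutely convergent integrals. In (5) and (5'), if the integrals do not converge absolutely, both are given the value $0$. -/

import Mathlib

open Complex MeasureTheory Filter Topology Asymptotics
open scoped Convolution ComplexConjugate

namespace GaussOp

noncomputable section

/-- Operators acting on complex-valued functions on `X`. -/
abbrev Op (X : Type) : Type := (X → ℂ) → (X → ℂ)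

/-- The operator of multiplication by the function `m`. -/
def mulBy {X : Type} (m : X → ℂ) : Op X := fun f p => m p * f p

/-- The `k`-th term `(A^k f)(p) / k!` of the exponential series `exp(A) f (p)`. -/
def opExpTerm {X : Type} (A : Op X) (f : X → ℂ) (p : X) (k : ℕ) : ℂ :=
  (k.factorial : ℂ)⁻¹ * (A^[k] f) p

/-- The exponential series `∑ (A^k f)(p) / k!` converges absolutely at every point `p`. -/
def OpExpSummable {X : Type} (A : Op X) (f : X → ℂ) : Prop :=
  ∀ p, Summable (opExpTerm A f p)

/-- The operator exponential `exp(A)`, given by `(exp(A) f)(p) = ∑ (A^k f)(p) / k!`. -/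
def opExp {X : Type} (A : Op X) : Op X := fun f p => ∑' k, opExpTerm A f p k

/-! ### Two independent complex variables `(z, z')` -/

/-- The operator `∂² / ∂z ∂z'`. -/
def mixedDeriv : Op (ℂ × ℂ) := fun f p =>
  deriv (fun z => deriv (fun z' => f (z, z')) p.2) p.1

/-- The operator `(z - z₀) ∂/∂z + (z' - z₀') ∂/∂z'`, where `c = (z₀, z₀')`. -/
def euler₂ (c : ℂ × ℂ) : Op (ℂ × ℂ) := fun f p =>
  (p.1 - c.1) * deriv (fun z => f (z, p.2)) p.1 +
    (p.2 - c.2) * deriv (fun z' => f (p.1, z')) p.2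

/-- The function `exp(-(z - z₀)(z' - z₀') / r)`, where `c = (z₀, z₀')`. -/
def gauss₂ (r : ℂ) (c : ℂ × ℂ) : ℂ × ℂ → ℂ := fun p =>
  exp (-((p.1 - c.1) * (p.2 - c.2)) / r)

/-- Entire functions on `ℂ²` with `|f(z, z')| ≤ C exp((α |z|² + β |z'|²) / 2)` for some `C`. -/
def GaussType₂ (α β : ℝ) (f : ℂ × ℂ → ℂ) : Prop :=
  Differentiable ℂ f ∧
    ∃ C : ℝ, ∀ p, ‖f p‖ ≤ C * Real.exp ((α * ‖p.1‖ ^ 2 + β * ‖p.2‖ ^ 2) / 2)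

/-- The function `(z, z') ↦ f((r z + s z₀)/(r+s), (r z' + s z₀')/(r+s))`, where
`c = (z₀, z₀')`. -/
def contract₂ (r s : ℂ) (c : ℂ × ℂ) : Op (ℂ × ℂ) := fun f p =>
  f ((r * p.1 + s * c.1) / (r + s), (r * p.2 + s * c.2) / (r + s))

/-- The function `r/(r+s) exp(-(z-z₀)(z'-z₀')/(r+s)) ·
exp((s(r+s)/r) ∂²/∂z∂z') f((r z + s z₀)/(r+s), (r z' + s z₀')/(r+s))`. -/
def rightSide₂ (r s : ℂ) (c : ℂ × ℂ) (f : ℂ × ℂ → ℂ) : ℂ × ℂ → ℂ := fun p =>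
  r / (r + s) * gauss₂ (r + s) c p *
    opExp ((s * (r + s) / r) • mixedDeriv) (contract₂ r s c f) p

/-- The normalized two-dimensional Gaussian `exp(-z z* / s) / (π s)` on the complex plane. -/
def kernel₂ (s : ℝ) : ℂ → ℂ := fun z => 1 / (Real.pi * s) * exp (-(z * conj z) / s)

/-! ### One variable `x` -/

/-- The operator `∂² / ∂x²`. -/
def secondDeriv : Op ℂ := fun f => deriv (deriv f)

/-- The operator `(x - x₀) ∂/∂x`. -/
def euler₁ (c : ℂ) : Op ℂ := fun f x => (x - c) * deriv f x

/-- The function `exp(-(x - x₀)² / r)`. -/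
def gauss₁ (r c : ℂ) : ℂ → ℂ := fun x => exp (-(x - c) ^ 2 / r)

/-- Entire functions on `ℂ` with `|f(x)| ≤ C exp(a |x|²)` for some `C`. -/
def GaussType₁ (a : ℝ) (f : ℂ → ℂ) : Prop :=
  Differentiable ℂ f ∧ ∃ C : ℝ, ∀ x, ‖f x‖ ≤ C * Real.exp (a * ‖x‖ ^ 2)

/-- The function `x ↦ f((r x + s x₀)/(r+s))`. -/
def contract₁ (r s c : ℂ) : Op ℂ := fun f x => f ((r * x + s * c) / (r + s))

/-- The function `√(r/(r+s)) exp(-(x-x₀)²/(r+s)) ·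
exp((s(r+s)/(4r)) ∂²/∂x²) f((r x + s x₀)/(r+s))`, with the principal square root. -/
def rightSide₁ (r s c : ℂ) (f : ℂ → ℂ) : ℂ → ℂ := fun x =>
  (r / (r + s)) ^ (1 / 2 : ℂ) * gauss₁ (r + s) c x *
    opExp ((s * (r + s) / (4 * r)) • secondDeriv) (contract₁ r s c f) x

/-- The normalized one-dimensional Gaussian `exp(-x² / s) / √(π s)` on the real line. -/
def kernel₁ (s : ℝ) : ℝ → ℂ := fun x =>
  ((1 / Real.sqrt (Real.pi * s) * Real.exp (-x ^ 2 / s) : ℝ) : ℂ)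

/-! ### Convolution, on the plane or on the line -/

/-- The convolution `(g * h)(x) = ∫ g(t) h(x - t) dt` with respect to Lebesgue measure. -/
def conv {G : Type} [AddGroup G] [MeasureSpace G] (g h : G → ℂ) : G → ℂ :=
  g ⋆[ContinuousLinearMap.mul ℂ ℂ, volume] h

/-- The integral that defines `(g * h)(x)` converges absolutely. -/
def ConvAt {G : Type} [AddGroup G] [MeasureSpace G] (g h : G → ℂ) (x : G) : Prop :=
  ConvolutionExistsAt g h x (ContinuousLinearMap.mul ℂ ℂ) volume

end

end GaussOp

namespace GaussOp

/-! ### Holomorphic functions of several variables -/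

section Holomorphic

variable {E : Type*} [NormedAddCommGroup E] [NormedSpace ℂ E]

/-! Both sides of the operator identity solve the heat equation `∂u/∂s = D u` with the same initial
value, and a jointly holomorphic solution on a disc about `s = 0` is determined by that value: its
Taylor coefficients in `s` are `D^k u(0)/k!`, so it is the sum of the exponential series
(`hasSum_opExpTerm_of_heat`). Convergence of the left-hand series therefore need not be estimated;
it suffices that the right-hand side is a holomorphic solution on the right disc.

Moving `D` through the contraction writes the right-hand side as `r/(r+s) exp(-(z-z₀)(z'-z₀')/(r+s))
E(sr/(r+s), q)`, where `E(t, ·) = exp(tD) f` and `q` is the contracted point. This Appell-type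
transform maps solutions to solutions (`deriv_gaussTransform₂`). What remains is that `E` is a
holomorphic solution for `|t| √(αβ) < 1` (`GaussType₂.heat`). For this `E` is represented as a
Gaussian average of `f(z + t a w, z' + b w*)` with `ab = 1`: the `t`-derivative brings down `a w`,
integration by parts turns `w` into `b ∂/∂z'`, and the mean value property gives the initial value.
Optimizing `a` and `b` yields exactly the radius `1/√(αβ)`.

For an arbitrary entire `f`, the truncated series solves the equation up to `t^M K`. The transform
preserves this form of the error, and such an error does not affect the Taylor coefficients up to
order `M` (`iteratedDeriv_eq_mixedDeriv_iterate`).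

With `a = 1/√s`, `b = √s` and `z' = z*` the average is a convolution with a Gaussian
(`opExp_eq_conv₂`). The convolution identities for arbitrary functions use no holomorphy: completing
the square identifies the integrands up to an affine substitution (`conv_gauss₂`, `conv_gauss₁`).

In one variable, `g((z+z')/2)` turns `D` into `(1/4) d²/dx²`, so the results on the heat equation
carry over. Only the transform, with its square root, and the completion of the square are computed
anew. -/

lemma norm_fderiv_le_of_ball {f : E → ℂ} {x : E} {δ M : ℝ} (hδ : 0 < δ)
    (hf : DifferentiableOn ℂ f (Metric.ball x δ)) (hM : ∀ y ∈ Metric.ball x δ, ‖f y‖ ≤ M) :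
    ‖fderiv ℂ f x‖ ≤ 2 * M / δ := by
  -- Schwarz-type estimate: `f` maps the ball into the closed ball of radius `2 * M` about `f x`.
  refine norm_fderiv_le_div_of_mapsTo_ball hf (fun y hy => ?_) hδ
  rw [mem_closedBall_iff_norm]
  have h1 := hM y hy
  have h2 := hM x (Metric.mem_ball_self hδ)
  linarith [norm_sub_le (f y) (f x)]

/-- In each direction the derivative is a pointwise limit of measurable difference quotients, and in
finite dimension a linear form is recovered from its values on a basis. -/
lemma aestronglyMeasurable_fderiv_param [FiniteDimensional ℂ E] {X : Type*} [MeasurableSpace X]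
    {μ : Measure X} {F : E → X → ℂ} {x₀ : E}
    (hd : ∀ a, DifferentiableAt ℂ (fun x => F x a) x₀)
    (hm : ∀ᶠ x in 𝓝 x₀, AEStronglyMeasurable (F x) μ) :
    AEStronglyMeasurable (fun a => fderiv ℂ (fun x => F x a) x₀) μ := by
  have hv : ∀ v : E, AEStronglyMeasurable (fun a => fderiv ℂ (fun x => F x a) x₀ v) μ := by
    intro v
    have h0 : Tendsto (fun n : ℕ => ((n : ℂ) + 1)⁻¹) atTop (𝓝[≠] 0) := by
      refine tendsto_nhdsWithin_iff.2 ⟨?_, Eventually.of_forall fun n => ?_⟩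
      · have := tendsto_one_div_add_atTop_nhds_zero_nat (𝕜 := ℂ)
        simpa using this
      · exact inv_ne_zero (Nat.cast_add_one_ne_zero n)
    have hlim : Tendsto (fun n : ℕ => x₀ + ((n : ℂ) + 1)⁻¹ • v) atTop (𝓝 x₀) := by
      have : Tendsto (fun n : ℕ => x₀ + ((n : ℂ) + 1)⁻¹ • v) atTop (𝓝 (x₀ + (0 : ℂ) • v)) :=
        tendsto_const_nhds.add ((tendsto_nhdsWithin_iff.1 h0).1.smul_const v)
      simpa using this
    -- Measurability is known only near `x₀`, so the sequence of quotients starts at `n₀`.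
    obtain ⟨n₀, hn₀⟩ := eventually_atTop.1 (hlim.eventually hm)
    refine aestronglyMeasurable_of_tendsto_ae (u := atTop)
      (f := fun (n : ℕ) a => ((((n + n₀ : ℕ) : ℂ) + 1)⁻¹)⁻¹ •
        (F (x₀ + (((n + n₀ : ℕ) : ℂ) + 1)⁻¹ • v) a - F x₀ a)) ?_ ?_ 
    · intro n
      have h2 := (hn₀ (n + n₀) (by omega)).sub hm.self_of_nhds
      exact AEStronglyMeasurable.const_smul h2 ((((n + n₀ : ℕ) : ℂ) + 1)⁻¹)⁻¹
    · refine Eventually.of_forall fun a => ?_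
      have h1 := (hd a).hasFDerivAt.hasLineDerivAt v
      exact (h1.tendsto_slope_zero.comp h0).comp (tendsto_add_atTop_nat n₀)
  let b := Module.finBasis ℂ E
  have key : ∀ L : E →L[ℂ] ℂ, L = ∑ i, L (b i) • LinearMap.toContinuousLinearMap (b.coord i) := by
    intro L
    ext x
    conv_lhs => rw [← b.sum_repr x, map_sum]
    simp only [map_smul, smul_eq_mul, FunLike.coe_sum, Finset.sum_apply, FunLike.coe_smul,
      Pi.smul_apply, LinearMap.coe_toContinuousLinearMap', Module.Basis.coord_apply]
    exact Finset.sum_congr rfl fun i _ => mul_comm _ _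
  have : (fun a => fderiv ℂ (fun x => F x a) x₀) = fun a =>
      ∑ i, fderiv ℂ (fun x => F x a) x₀ (b i) • LinearMap.toContinuousLinearMap (b.coord i) :=
    funext fun a => key _
  rw [this]
  exact Finset.aestronglyMeasurable_fun_sum _ fun i _ => (hv (b i)).smul_const _

/-- Differentiation of an integral of holomorphic functions with an integrable bound. -/
theorem hasFDerivAt_integral_of_holomorphic [FiniteDimensional ℂ E] {X : Type*}
    [MeasurableSpace X] {μ : Measure X} {F : E → X → ℂ} {bound : X → ℝ} {x₀ : E} {δ : ℝ}
    (hδ : 0 < δ) (hd : ∀ a, DifferentiableOn ℂ (fun x => F x a) (Metric.ball x₀ δ))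
    (hm : ∀ x ∈ Metric.ball x₀ δ, AEStronglyMeasurable (F x) μ)
    (hb : ∀ x ∈ Metric.ball x₀ δ, ∀ a, ‖F x a‖ ≤ bound a) (hi : Integrable bound μ) :
    Integrable (fun a => fderiv ℂ (fun x => F x a) x₀) μ ∧
    HasFDerivAt (fun x => ∫ a, F x a ∂μ) (∫ a, fderiv ℂ (fun x => F x a) x₀ ∂μ) x₀ := by
  have hx₀ : x₀ ∈ Metric.ball x₀ δ := Metric.mem_ball_self hδ
  have hda : ∀ a, ∀ x ∈ Metric.ball x₀ δ, DifferentiableAt ℂ (fun x => F x a) x := fun a x hx =>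
    (hd a).differentiableAt (Metric.isOpen_ball.mem_nhds hx)
  have hev : ∀ᶠ x in 𝓝 x₀, AEStronglyMeasurable (F x) μ :=
    mem_of_superset (Metric.ball_mem_nhds x₀ hδ) hm
  have hmeas := aestronglyMeasurable_fderiv_param (fun a => hda a x₀ hx₀) hev
  -- The Cauchy estimate on balls of half the radius bounds the derivative by the bound for `F`
  -- itself; no separate domination of derivatives is needed.
  have hbd : ∀ a, ∀ x ∈ Metric.ball x₀ (δ / 2),
      ‖fderiv ℂ (fun x => F x a) x‖ ≤ 2 * bound a / (δ / 2) := by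
    intro a x hx
    have hsub : Metric.ball x (δ / 2) ⊆ Metric.ball x₀ δ := by
      refine Metric.ball_subset_ball' ?_
      have := Metric.mem_ball.1 hx
      linarith
    exact norm_fderiv_le_of_ball (by linarith) ((hd a).mono hsub) fun y hy => hb y (hsub hy) a
  have hbi : Integrable (fun a => 2 * bound a / (δ / 2)) μ := (hi.const_mul 2).div_const _
  refine ⟨hbi.mono' hmeas (Eventually.of_forall fun a =>
    hbd a x₀ (Metric.mem_ball_self (by linarith))), ?_⟩
  exact hasFDerivAt_integral_of_dominated_of_fderiv_le (Metric.ball_mem_nhds x₀ (half_pos hδ)) hev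
    (hi.mono' (hm x₀ hx₀) (Eventually.of_forall (hb x₀ hx₀))) hmeas
    (Eventually.of_forall hbd) hbi
    (Eventually.of_forall fun a x hx => (hda a x
      (Metric.ball_subset_ball (by linarith) hx)).hasFDerivAt)

/-- The Cauchy kernel for the derivative at the centre of a circle of radius `ε`. -/
noncomputable def cauchyWeight (ε θ : ℝ) : ℂ :=
  (2 * Real.pi * I)⁻¹ * (deriv (circleMap 0 ε) θ * (1 / (circleMap 0 ε θ) ^ 2))

lemma continuous_cauchyWeight {ε : ℝ} (hε : 0 < ε) : Continuous (cauchyWeight ε) := by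
  have h0 : ∀ θ, circleMap 0 ε θ ^ 2 ≠ 0 := fun θ =>
    pow_ne_zero _ (circleMap_ne_center hε.ne')
  unfold cauchyWeight
  simp only [deriv_circleMap]
  have := continuous_circleMap 0 ε
  fun_prop (disch := exact h0 _)

lemma integral_cauchyWeight_mul {ε : ℝ} (hε : 0 < ε) {g : E → ℂ} {x v : E}
    (hd : DifferentiableAt ℂ g x)
    (hg : DifferentiableOn ℂ (fun ζ : ℂ => g (x + ζ • v)) (Metric.closedBall 0 ε)) :
    ∫ θ in Set.Ioc 0 (2 * Real.pi), cauchyWeight ε θ * g (x + circleMap 0 ε θ • v) =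
      fderiv ℂ g x v := by
  have h := hg.deriv_eq_smul_circleIntegral hε
  have h1 : deriv (fun ζ : ℂ => g (x + ζ • v)) 0 = fderiv ℂ g x v :=
    (hd.hasFDerivAt.hasLineDerivAt v).lineDeriv
  rw [h1, circleIntegral, intervalIntegral.integral_of_le Real.two_pi_pos.le] at h
  have h2 : (2 * Real.pi * I : ℂ) ≠ 0 := by simp [Real.pi_ne_zero]
  rw [← inv_smul_smul₀ h2 (fderiv ℂ g x v), ← h, ← integral_smul]
  refine integral_congr_ae (Eventually.of_forall fun θ => ?_)
  simp only [cauchyWeight, smul_eq_mul, sub_zero]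
  ring

variable [FiniteDimensional ℂ E] {Ω : Set E} {u : E → ℂ}

/-- Cauchy's formula along the complex line in direction `v` expresses `fderiv ℂ u x v` by values of
`u` alone, on a circle whose radius is the same for all `x` near `x₀`. The formula can then be
differentiated in `x` under the integral. Integrability is recorded so that the resulting operator
can be applied to a vector inside the integral. -/
lemma exists_fderiv_apply_eq_integral (hΩ : IsOpen Ω) (hu : DifferentiableOn ℂ u Ω) (v : E)
    {x₀ : E} (hx₀ : x₀ ∈ Ω) : ∃ ε > 0,
      (∀ θ, x₀ + circleMap 0 ε θ • v ∈ Ω) ∧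
      (∀ ζ ∈ Metric.closedBall (0 : ℂ) ε, x₀ + ζ • v ∈ Ω) ∧
      HasFDerivAt (fun x => fderiv ℂ u x v)
        (∫ θ in Set.Ioc 0 (2 * Real.pi),
          cauchyWeight ε θ • fderiv ℂ u (x₀ + circleMap 0 ε θ • v)) x₀ ∧
      Integrable (fun θ => cauchyWeight ε θ • fderiv ℂ u (x₀ + circleMap 0 ε θ • v))
        (volume.restrict (Set.Ioc 0 (2 * Real.pi))) := by
  have hc : ContinuousAt u x₀ := (hu.differentiableAt (hΩ.mem_nhds hx₀)).continuousAt
  obtain ⟨δ, hδ, hball⟩ := Metric.eventually_nhds_iff_ball.1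
    ((hΩ.eventually_mem hx₀).and (hc.norm.eventually_lt_const (lt_add_one ‖u x₀‖)))
  -- Discs of radius `ε` in direction `v` centred within `δ / 2` of `x₀` stay in the ball where `u`
  -- is bounded by `‖u x₀‖ + 1`.
  obtain ⟨ε, hε, hεv⟩ : ∃ ε > 0, ε * ‖v‖ < δ / 2 := by
    refine ⟨δ / 2 / (‖v‖ + 1), by positivity, ?_⟩
    rw [div_mul_eq_mul_div, div_lt_iff₀ (by positivity)]
    nlinarith [norm_nonneg v]
  have hmem : ∀ x ∈ Metric.ball x₀ (δ / 2), ∀ ζ ∈ Metric.closedBall (0 : ℂ) ε,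
      x + ζ • v ∈ Metric.ball x₀ δ := by
    intro x hx ζ hζ
    rw [mem_ball_iff_norm] at hx ⊢
    rw [mem_closedBall_zero_iff] at hζ
    calc ‖x + ζ • v - x₀‖ = ‖(x - x₀) + ζ • v‖ := by congr 1; abel
      _ ≤ ‖x - x₀‖ + ‖ζ‖ * ‖v‖ := by rw [← norm_smul]; exact norm_add_le _ _
      _ < δ / 2 + δ / 2 := by
        have := mul_le_mul_of_nonneg_right hζ (norm_nonneg v)
        linarith
      _ = δ := by ring
  have hcirc : ∀ θ, circleMap 0 ε θ ∈ Metric.closedBall (0 : ℂ) ε := fun θ =>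
    circleMap_mem_closedBall 0 hε.le θ
  have hx₀' : x₀ ∈ Metric.ball x₀ (δ / 2) := Metric.mem_ball_self (half_pos hδ)
  have hduΩ : ∀ y ∈ Metric.ball x₀ δ, DifferentiableAt ℂ u y := fun y hy =>
    hu.differentiableAt (hΩ.mem_nhds (hball y hy).1)
  have hrep : ∀ x ∈ Metric.ball x₀ (δ / 2),
      ∫ θ in Set.Ioc 0 (2 * Real.pi), cauchyWeight ε θ * u (x + circleMap 0 ε θ • v) =
      fderiv ℂ u x v := by
    intro x hx
    refine integral_cauchyWeight_mul hε
      (hduΩ x (Metric.ball_subset_ball (by linarith) hx)) fun ζ hζ => ?_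
    refine DifferentiableAt.differentiableWithinAt ?_
    exact (hduΩ _ (hmem x hx ζ hζ)).comp ζ (by fun_prop)
  have hfd : ∀ θ, fderiv ℂ (fun x => cauchyWeight ε θ * u (x + circleMap 0 ε θ • v)) x₀ =
      cauchyWeight ε θ • fderiv ℂ u (x₀ + circleMap 0 ε θ • v) := by
    intro θ
    have h1 : HasFDerivAt (fun x => u (x + circleMap 0 ε θ • v))
        (fderiv ℂ u (x₀ + circleMap 0 ε θ • v)) x₀ :=
      (hasFDerivAt_comp_add_right _).2 (hduΩ _ (hmem x₀ hx₀' _ (hcirc θ))).hasFDerivAt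
    exact (h1.const_mul _).fderiv
  have hint := hasFDerivAt_integral_of_holomorphic (E := E) (x₀ := x₀)
    (μ := volume.restrict (Set.Ioc 0 (2 * Real.pi)))
    (F := fun x θ => cauchyWeight ε θ * u (x + circleMap 0 ε θ • v))
    (bound := fun θ => ‖cauchyWeight ε θ‖ * (‖u x₀‖ + 1)) (half_pos hδ) ?_ ?_ ?_ ?_
  · simp only [hfd] at hint
    refine ⟨ε, hε, fun θ => (hball _ (hmem x₀ hx₀' _ (hcirc θ))).1,
      fun ζ hζ => (hball _ (hmem x₀ hx₀' _ hζ)).1, ?_, hint.1⟩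
    refine hint.2.congr_of_eventuallyEq ?_
    filter_upwards [Metric.ball_mem_nhds x₀ (half_pos hδ)] with x hx
    exact (hrep x hx).symm
  · intro θ x hx
    refine DifferentiableAt.differentiableWithinAt ?_
    exact ((hduΩ _ (hmem x hx _ (hcirc θ))).comp x (by fun_prop)).const_mul _
  · intro x hx
    refine Continuous.aestronglyMeasurable ((continuous_cauchyWeight hε).mul ?_)
    refine continuous_iff_continuousAt.2 fun θ => ?_
    refine ContinuousAt.comp (f := fun θ => x + circleMap 0 ε θ • v)
      (hduΩ _ (hmem x hx _ (hcirc θ))).continuousAt ?_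
    have := continuous_circleMap 0 ε
    fun_prop
  · intro x hx θ
    rw [norm_mul]
    exact mul_le_mul_of_nonneg_left (hball _ (hmem x hx _ (hcirc θ))).2.le (norm_nonneg _)
  · exact ((((continuous_cauchyWeight hε).norm.mul continuous_const).continuousOn).integrableOn_compact
      isCompact_Icc).mono_set Set.Ioc_subset_Icc_self

/-- Directional derivatives of holomorphic functions are holomorphic. -/
theorem differentiableOn_fderiv_apply (hΩ : IsOpen Ω) (hu : DifferentiableOn ℂ u Ω) (v : E) :
    DifferentiableOn ℂ (fun x => fderiv ℂ u x v) Ω := fun x₀ hx₀ => by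
  obtain ⟨ε, -, -, -, h, -⟩ := exists_fderiv_apply_eq_integral hΩ hu v hx₀
  exact h.differentiableAt.differentiableWithinAt

/-- Directional derivatives of holomorphic functions commute. -/
theorem fderiv_fderiv_apply_comm (hΩ : IsOpen Ω) (hu : DifferentiableOn ℂ u Ω) (v w : E)
    {x : E} (hx : x ∈ Ω) :
    fderiv ℂ (fun y => fderiv ℂ u y v) x w = fderiv ℂ (fun y => fderiv ℂ u y w) x v := by
  obtain ⟨ε, hε, -, hmem, h, hi⟩ := exists_fderiv_apply_eq_integral hΩ hu v hx
  have hw := differentiableOn_fderiv_apply hΩ hu w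
  -- Applied to `w`, the integral is the Cauchy formula for the `v`-derivative of `fderiv ℂ u · w`,
  -- which is holomorphic by the previous theorem.
  rw [h.fderiv, ContinuousLinearMap.integral_apply hi, ← integral_cauchyWeight_mul hε (v := v)
    (hw.differentiableAt (hΩ.mem_nhds hx))]
  · rfl
  · intro ζ hζ
    refine DifferentiableAt.differentiableWithinAt ?_
    exact (hw.differentiableAt (hΩ.mem_nhds (hmem ζ hζ))).comp ζ
      (f := fun ζ : ℂ => x + ζ • v) (by fun_prop)

end Holomorphic

/-! ### Partial derivatives and powers of operators -/

lemma differentiable_fderiv_apply {E : Type*} [NormedAddCommGroup E] [NormedSpace ℂ E]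
    [FiniteDimensional ℂ E] {f : E → ℂ} (hf : Differentiable ℂ f) (v : E) :
    Differentiable ℂ (fun x => fderiv ℂ f x v) :=
  differentiableOn_univ.1 (differentiableOn_fderiv_apply isOpen_univ hf.differentiableOn v)

lemma deriv_fst_eq_fderiv {f : ℂ × ℂ → ℂ} {p : ℂ × ℂ} (hf : DifferentiableAt ℂ f p) :
    deriv (fun z => f (z, p.2)) p.1 = fderiv ℂ f p (1, 0) :=
  (hf.hasFDerivAt.comp_hasDerivAt (x := p.1) (f := fun z => (z, p.2))
    ((hasDerivAt_id p.1).prodMk (hasDerivAt_const p.1 p.2))).deriv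

lemma deriv_snd_eq_fderiv {f : ℂ × ℂ → ℂ} {p : ℂ × ℂ} (hf : DifferentiableAt ℂ f p) :
    deriv (fun z' => f (p.1, z')) p.2 = fderiv ℂ f p (0, 1) :=
  (hf.hasFDerivAt.comp_hasDerivAt (x := p.2) (f := fun z' => (p.1, z'))
    ((hasDerivAt_const p.2 p.1).prodMk (hasDerivAt_id p.2))).deriv

/-- Bridge from iterated one-variable derivatives to directional derivatives, for which regularity
and commutation are available. -/
lemma mixedDeriv_eq_fderiv {f : ℂ × ℂ → ℂ} (hf : Differentiable ℂ f) :
    mixedDeriv f = fun p => fderiv ℂ (fun q => fderiv ℂ f q (0, 1)) p (1, 0) := by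
  funext p
  rw [← deriv_fst_eq_fderiv (differentiable_fderiv_apply hf _ p)]
  simp only [mixedDeriv]
  congr 1
  funext z
  exact deriv_snd_eq_fderiv (p := (z, p.2)) (hf _)

lemma differentiable_mixedDeriv {f : ℂ × ℂ → ℂ} (hf : Differentiable ℂ f) :
    Differentiable ℂ (mixedDeriv f) := by
  rw [mixedDeriv_eq_fderiv hf]
  exact differentiable_fderiv_apply (differentiable_fderiv_apply hf _) _

lemma differentiable_mixedDeriv_iterate {f : ℂ × ℂ → ℂ} (hf : Differentiable ℂ f) (k : ℕ) :
    Differentiable ℂ (mixedDeriv^[k] f) := by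
  induction k with
  | zero => exact hf
  | succ k ih =>
    rw [Function.iterate_succ_apply']
    exact differentiable_mixedDeriv ih

/-- An operator that commutes with multiplication by scalars. -/
def Homogeneous {X : Type} (A : Op X) : Prop := ∀ (c : ℂ) (f : X → ℂ), A (c • f) = c • A f

lemma homogeneous_mixedDeriv : Homogeneous mixedDeriv := fun c f => by
  funext p
  simp only [mixedDeriv, Pi.smul_apply, deriv_fun_const_smul_field]

lemma homogeneous_secondDeriv : Homogeneous secondDeriv := fun c f => by
  funext p
  have : deriv (c • f) = c • deriv f := by
    funext x
    simp [deriv_const_smul_field]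
  simp only [secondDeriv, this, Pi.smul_apply, deriv_const_smul_field]

lemma homogeneous_euler₂ (c : ℂ × ℂ) : Homogeneous (euler₂ c) := fun a f => by
  funext p
  simp only [euler₂, Pi.smul_apply, smul_eq_mul, deriv_const_mul_field]
  ring

lemma homogeneous_euler₁ (c : ℂ) : Homogeneous (euler₁ c) := fun a f => by
  funext p
  simp only [euler₁, Pi.smul_apply, deriv_const_smul_field, smul_eq_mul]
  ring

namespace Homogeneous

variable {X : Type} {A : Op X}

lemma smul_iterate (hA : Homogeneous A) (t : ℂ) (k : ℕ) (f : X → ℂ) :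
    (t • A)^[k] f = t ^ k • A^[k] f := by
  induction k with
  | zero => simp
  | succ k ih =>
    rw [Function.iterate_succ_apply', Function.iterate_succ_apply', ih, Pi.smul_apply, hA,
      smul_smul, pow_succ']

lemma opExpTerm_smul (hA : Homogeneous A) (t : ℂ) (f : X → ℂ) (p : X) (k : ℕ) :
    opExpTerm (t • A) f p k = (k.factorial : ℂ)⁻¹ * (t ^ k * (A^[k] f) p) := by
  rw [opExpTerm, hA.smul_iterate]
  rfl

lemma opExp_zero (hA : Homogeneous A) (f : X → ℂ) : opExp ((0 : ℂ) • A) f = f := by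
  funext p
  rw [opExp, tsum_eq_single 0]
  · simp [opExpTerm]
  · intro k hk
    rw [hA.opExpTerm_smul, zero_pow hk, zero_mul, mul_zero]

end Homogeneous

/-! ### Differential operators under affine contraction -/

lemma deriv_comp_affine (g : ℂ → ℂ) (a b z : ℂ) :
    deriv (fun w => g (a * w + b)) z = a * deriv g (a * z + b) := by
  have h := deriv_comp_mul_left a (fun w => g (w + b)) z
  rw [deriv_comp_add_const] at h
  exact h

lemma contract₁_eq (r s c : ℂ) (f : ℂ → ℂ) :
    contract₁ r s c f = fun x => f (r / (r + s) * x + s * c / (r + s)) := by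
  funext x
  simp only [contract₁]
  congr 1
  ring

lemma contract₂_eq (r s : ℂ) (c : ℂ × ℂ) (f : ℂ × ℂ → ℂ) :
    contract₂ r s c f = fun p => f (r / (r + s) * p.1 + s * c.1 / (r + s),
      r / (r + s) * p.2 + s * c.2 / (r + s)) := by
  funext p
  simp only [contract₂]
  congr 2 <;> ring

/-- The one-variable chain rule for affine maps holds for every function, with the default value of
`deriv`, so no differentiability is required. -/
lemma mixedDeriv_contract₂ (r s : ℂ) (c : ℂ × ℂ) (f : ℂ × ℂ → ℂ) :
    mixedDeriv (contract₂ r s c f) = (r / (r + s)) ^ 2 • contract₂ r s c (mixedDeriv f) := by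
  funext p
  simp only [contract₂_eq, Pi.smul_apply, mixedDeriv, smul_eq_mul]
  set a := r / (r + s)
  have h1 : ∀ z, deriv (fun z' => f (a * z + s * c.1 / (r + s), a * z' + s * c.2 / (r + s))) p.2 =
      a * deriv (fun w => f (a * z + s * c.1 / (r + s), w)) (a * p.2 + s * c.2 / (r + s)) :=
    fun z => deriv_comp_affine (fun w => f (a * z + s * c.1 / (r + s), w)) _ _ _
  simp only [h1, deriv_const_mul_field]
  rw [deriv_comp_affine (fun w => deriv (fun w' => f (w, w')) (a * p.2 + s * c.2 / (r + s)))]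
  ring

lemma secondDeriv_contract₁ (r s c : ℂ) (f : ℂ → ℂ) :
    secondDeriv (contract₁ r s c f) = (r / (r + s)) ^ 2 • contract₁ r s c (secondDeriv f) := by
  funext p
  simp only [contract₁_eq, Pi.smul_apply, secondDeriv, smul_eq_mul]
  have h1 : deriv (fun x => f (r / (r + s) * x + s * c / (r + s))) =
      fun x => r / (r + s) * deriv f (r / (r + s) * x + s * c / (r + s)) :=
    funext fun z => deriv_comp_affine _ _ _ _
  rw [h1, deriv_const_mul_field, deriv_comp_affine]
  ring

lemma iterate_of_comp_eq_smul {X : Type} {A B : Op X} (hA : Homogeneous A) {a : ℂ}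
    (h : ∀ f, A (B f) = a • B (A f)) (k : ℕ) (f : X → ℂ) :
    A^[k] (B f) = a ^ k • B (A^[k] f) := by
  induction k with
  | zero => simp
  | succ k ih =>
    rw [Function.iterate_succ_apply', ih, hA, h, Function.iterate_succ_apply', smul_smul, pow_succ]

/-- Each `D` passing the contraction costs `(r/(r+s))²`, and `s(r+s)/r · (r/(r+s))² = sr/(r+s)`. As
the terms agree one by one, convergence, sums and partial sums all transfer. -/
lemma opExpTerm_contract₂ {r s : ℂ} (hr : r ≠ 0) (hrs : r + s ≠ 0) (c : ℂ × ℂ) (f : ℂ × ℂ → ℂ)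
    (p : ℂ × ℂ) (k : ℕ) :
    opExpTerm ((s * (r + s) / r) • mixedDeriv) (contract₂ r s c f) p k =
      opExpTerm ((s * r / (r + s)) • mixedDeriv) f
        ((r * p.1 + s * c.1) / (r + s), (r * p.2 + s * c.2) / (r + s)) k := by
  rw [homogeneous_mixedDeriv.opExpTerm_smul, homogeneous_mixedDeriv.opExpTerm_smul,
    iterate_of_comp_eq_smul homogeneous_mixedDeriv (mixedDeriv_contract₂ r s c)]
  have : (s * r / (r + s)) ^ k = (s * (r + s) / r) ^ k * ((r / (r + s)) ^ 2) ^ k := by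
    rw [← mul_pow]
    congr 1
    field_simp
  rw [this]
  simp only [Pi.smul_apply, contract₂, smul_eq_mul]
  ring

lemma opExpTerm_contract₁ {r s : ℂ} (hr : r ≠ 0) (hrs : r + s ≠ 0) (c : ℂ) (f : ℂ → ℂ)
    (x : ℂ) (k : ℕ) :
    opExpTerm ((s * (r + s) / (4 * r)) • secondDeriv) (contract₁ r s c f) x k =
      opExpTerm ((s * r / (r + s) / 4) • secondDeriv) f ((r * x + s * c) / (r + s)) k := by
  rw [homogeneous_secondDeriv.opExpTerm_smul, homogeneous_secondDeriv.opExpTerm_smul,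
    iterate_of_comp_eq_smul homogeneous_secondDeriv (secondDeriv_contract₁ r s c)]
  have : (s * r / (r + s) / 4) ^ k = (s * (r + s) / (4 * r)) ^ k * ((r / (r + s)) ^ 2) ^ k := by
    rw [← mul_pow]
    congr 1
    field_simp
  rw [this]
  simp only [Pi.smul_apply, contract₁, smul_eq_mul]
  ring

/-! ### The exponential of the Euler operator -/

lemma differentiable_euler₂ (c : ℂ × ℂ) {f : ℂ × ℂ → ℂ} (hf : Differentiable ℂ f) :
    Differentiable ℂ (euler₂ c f) := by
  have h : euler₂ c f = fun p => (p.1 - c.1) * fderiv ℂ f p (1, 0) +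
      (p.2 - c.2) * fderiv ℂ f p (0, 1) := by
    funext p
    rw [← deriv_fst_eq_fderiv (hf p), ← deriv_snd_eq_fderiv (hf p)]
    rfl
  rw [h]
  have := differentiable_fderiv_apply hf (1, 0)
  have := differentiable_fderiv_apply hf (0, 1)
  fun_prop

lemma deriv_comp_exp_euler₂ (c p : ℂ × ℂ) {f : ℂ × ℂ → ℂ} (hf : Differentiable ℂ f) :
    deriv (fun ζ => f (c + exp ζ • (p - c))) = fun ζ => euler₂ c f (c + exp ζ • (p - c)) := by
  funext ζ
  have h1 : HasDerivAt (fun ζ => c + exp ζ • (p - c)) (exp ζ • (p - c)) ζ :=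
    ((hasDerivAt_exp ζ).smul_const (p - c)).const_add c
  have h2 := (hf (c + exp ζ • (p - c))).hasFDerivAt.comp_hasDerivAt ζ h1
  refine h2.deriv.trans ?_
  simp only [euler₂]
  rw [deriv_fst_eq_fderiv (hf _), deriv_snd_eq_fderiv (hf _)]
  have h3 : exp ζ • (p - c) = (exp ζ * (p.1 - c.1)) • ((1, 0) : ℂ × ℂ) +
      (exp ζ * (p.2 - c.2)) • ((0, 1) : ℂ × ℂ) := by
    ext <;> simp
  rw [h3, map_add, map_smul, map_smul]
  simp

/-- Along `ζ ↦ c + e^ζ (p - c)` the Euler operator is `d/dζ`. The series is thus the Taylor series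
at `0` of an entire function of `ζ`, evaluated at `γ`; no growth condition enters. -/
theorem hasSum_opExpTerm_euler₂ (c p : ℂ × ℂ) (γ : ℂ) {f : ℂ × ℂ → ℂ} (hf : Differentiable ℂ f) :
    HasSum (opExpTerm (γ • euler₂ c) f p) (f (c + exp γ • (p - c))) := by
  have hd : Differentiable ℂ (fun ζ => f (c + exp ζ • (p - c))) :=
    hf.comp ((differentiable_exp.smul_const (p - c)).const_add c)
  have hk : ∀ k, Differentiable ℂ ((euler₂ c)^[k] f) ∧
      iteratedDeriv k (fun ζ => f (c + exp ζ • (p - c))) =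
        fun ζ => ((euler₂ c)^[k] f) (c + exp ζ • (p - c)) := by
    intro k
    induction k with
    | zero => exact ⟨hf, by simp⟩
    | succ k ih =>
      rw [Function.iterate_succ_apply', iteratedDeriv_succ, ih.2, deriv_comp_exp_euler₂ c p ih.1]
      exact ⟨differentiable_euler₂ c ih.1, rfl⟩
  have h := hasSum_taylorSeries_of_entire hd 0 γ
  refine (congrArg (fun t : ℕ → ℂ => HasSum t _) (funext fun k => ?_)).mpr h
  rw [(homogeneous_euler₂ c).opExpTerm_smul, (hk k).2]
  simp

lemma deriv_comp_exp_euler₁ (c x : ℂ) {f : ℂ → ℂ} (hf : Differentiable ℂ f) :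
    deriv (fun ζ => f (c + exp ζ * (x - c))) = fun ζ => euler₁ c f (c + exp ζ * (x - c)) := by
  funext ζ
  have h1 : HasDerivAt (fun ζ => c + exp ζ * (x - c)) (exp ζ * (x - c)) ζ :=
    ((hasDerivAt_exp ζ).mul_const (x - c)).const_add c
  have h2 := (hf (c + exp ζ * (x - c))).hasDerivAt.comp ζ h1
  refine h2.deriv.trans ?_
  simp only [euler₁]
  ring

theorem hasSum_opExpTerm_euler₁ (c x γ : ℂ) {f : ℂ → ℂ} (hf : Differentiable ℂ f) :
    HasSum (opExpTerm (γ • euler₁ c) f x) (f (c + exp γ * (x - c))) := by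
  have hd : Differentiable ℂ (fun ζ => f (c + exp ζ * (x - c))) :=
    hf.comp ((differentiable_exp.mul_const (x - c)).const_add c)
  have hk : ∀ k, Differentiable ℂ ((euler₁ c)^[k] f) ∧
      iteratedDeriv k (fun ζ => f (c + exp ζ * (x - c))) =
        fun ζ => ((euler₁ c)^[k] f) (c + exp ζ * (x - c)) := by
    intro k
    induction k with
    | zero => exact ⟨hf, by simp⟩
    | succ k ih =>
      rw [Function.iterate_succ_apply', iteratedDeriv_succ, ih.2, deriv_comp_exp_euler₁ c x ih.1]
      refine ⟨?_, rfl⟩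
      have := differentiableOn_univ.1 (ih.1.differentiableOn.deriv isOpen_univ)
      unfold euler₁
      fun_prop
  have h := hasSum_taylorSeries_of_entire hd 0 γ
  refine (congrArg (fun t : ℕ → ℂ => HasSum t _) (funext fun k => ?_)).mpr h
  rw [(homogeneous_euler₁ c).opExpTerm_smul, (hk k).2]
  simp

/-! ### Holomorphic solutions of the heat equation -/

section Heat

variable {S : Set ℂ} {u H : ℂ × (ℂ × ℂ) → ℂ}

lemma isOpen_prod_univ (hS : IsOpen S) : IsOpen (S ×ˢ (Set.univ : Set (ℂ × ℂ))) :=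
  hS.prod isOpen_univ

lemma mem_prod_univ {s : ℂ} (hs : s ∈ S) (p : ℂ × ℂ) : (s, p) ∈ S ×ˢ (Set.univ : Set (ℂ × ℂ)) :=
  ⟨hs, trivial⟩

lemma deriv_time_eq_fderiv {x : ℂ × (ℂ × ℂ)} (hu : DifferentiableAt ℂ u x) :
    deriv (fun σ => u (σ, x.2)) x.1 = fderiv ℂ u x (1, 0) :=
  (hu.hasFDerivAt.comp_hasDerivAt (x := x.1) (f := fun σ => (σ, x.2))
    ((hasDerivAt_id x.1).prodMk (hasDerivAt_const x.1 x.2))).deriv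

lemma fderiv_slice_apply {s : ℂ} {p : ℂ × ℂ} (hu : DifferentiableAt ℂ u (s, p)) (v : ℂ × ℂ) :
    fderiv ℂ (fun q => u (s, q)) p v = fderiv ℂ u (s, p) (0, v) := by
  have h : HasFDerivAt (fun q : ℂ × ℂ => (s, q))
      ((0 : ℂ × ℂ →L[ℂ] ℂ).prod (ContinuousLinearMap.id ℂ (ℂ × ℂ))) p :=
    (hasFDerivAt_const s p).prodMk (hasFDerivAt_id p)
  have h2 : HasFDerivAt (fun q => u (s, q)) _ p := hu.hasFDerivAt.comp p h
  rw [h2.fderiv]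
  simp

lemma differentiable_slice (hS : IsOpen S) (hu : DifferentiableOn ℂ u (S ×ˢ Set.univ)) {s : ℂ}
    (hs : s ∈ S) : Differentiable ℂ (fun q => u (s, q)) := fun q =>
  (hu.differentiableAt ((isOpen_prod_univ hS).mem_nhds (mem_prod_univ hs q))).comp q
    (by fun_prop)

/-- Expresses `D` at fixed time by directional derivatives in all three variables jointly, where it
can be commuted with `∂/∂s`. -/
lemma mixedDeriv_slice (hS : IsOpen S) (hu : DifferentiableOn ℂ u (S ×ˢ Set.univ)) {s : ℂ}
    (hs : s ∈ S) (p : ℂ × ℂ) :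
    mixedDeriv (fun q => u (s, q)) p =
      fderiv ℂ (fun x => fderiv ℂ u x (0, (0, 1))) (s, p) (0, (1, 0)) := by
  have hΩ := isOpen_prod_univ hS
  rw [mixedDeriv_eq_fderiv (differentiable_slice hS hu hs), ← fderiv_slice_apply
    ((differentiableOn_fderiv_apply hΩ hu _).differentiableAt (hΩ.mem_nhds (mem_prod_univ hs p)))]
  refine congrArg (fun g : ℂ × ℂ → ℂ => fderiv ℂ g p (1, 0)) (funext fun q => ?_)
  exact fderiv_slice_apply (hu.differentiableAt (hΩ.mem_nhds (mem_prod_univ hs q))) _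

/-- The Taylor coefficients in `s` of a function that solves `∂u/∂s = ∂²u/∂z∂z'` up to terms of
order `s ^ M`. -/
theorem iteratedDeriv_eq_mixedDeriv_iterate (hS : IsOpen S) (h0 : 0 ∈ S) {k M : ℕ} (hkM : k ≤ M)
    (hu : DifferentiableOn ℂ u (S ×ˢ Set.univ)) (hH : DifferentiableOn ℂ H (S ×ˢ Set.univ))
    (heat : ∀ s ∈ S, ∀ p, deriv (fun σ => u (σ, p)) s =
      mixedDeriv (fun q => u (s, q)) p - s ^ M * H (s, p)) (p : ℂ × ℂ) :
    iteratedDeriv k (fun σ => u (σ, p)) 0 = (mixedDeriv^[k] (fun q => u (0, q))) p := by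
  have hΩ := isOpen_prod_univ hS
  induction k generalizing M u H with
  | zero => simp
  | succ k ih =>
    obtain ⟨M, rfl⟩ : ∃ m, M = m + 1 := ⟨M - 1, by omega⟩
    -- Induction step: `v = ∂u/∂s` satisfies an equation of the same kind with an error of order one
    -- less.
    set v : ℂ × (ℂ × ℂ) → ℂ := fun x => fderiv ℂ u x (1, 0) with hv
    have hvd : DifferentiableOn ℂ v (S ×ˢ Set.univ) := differentiableOn_fderiv_apply hΩ hu _
    have hat : ∀ {w : ℂ × (ℂ × ℂ) → ℂ}, DifferentiableOn ℂ w (S ×ˢ Set.univ) → ∀ s ∈ S, ∀ p,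
        DifferentiableAt ℂ w (s, p) := fun hw s hs p =>
      hw.differentiableAt (hΩ.mem_nhds (mem_prod_univ hs p))
    have hderiv : ∀ s ∈ S, ∀ p, deriv (fun σ => u (σ, p)) s = v (s, p) := fun s hs p =>
      deriv_time_eq_fderiv (x := (s, p)) (hat hu s hs p)
    set w : ℂ × (ℂ × ℂ) → ℂ := fun x => fderiv ℂ u x (0, (0, 1)) with hw
    have hwd : DifferentiableOn ℂ w (S ×ˢ Set.univ) := differentiableOn_fderiv_apply hΩ hu _
    have hw1d : DifferentiableOn ℂ (fun x => fderiv ℂ w x (0, (1, 0))) (S ×ˢ Set.univ) :=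
      differentiableOn_fderiv_apply hΩ hwd _
    have hvw : ∀ s ∈ S, ∀ p, v (s, p) = fderiv ℂ w (s, p) (0, (1, 0)) - s ^ (M + 1) * H (s, p) :=
      fun s hs p => by
        rw [← hderiv s hs p, heat s hs p, mixedDeriv_slice hS hu hs p]
    have hheat : ∀ s ∈ S, ∀ p, deriv (fun σ => v (σ, p)) s =
        mixedDeriv (fun q => v (s, q)) p -
          s ^ M * ((fun x => (M + 1) * H x + x.1 * fderiv ℂ H x (1, 0)) (s, p)) := by
      intro s hs p
      have e1 : (fun σ => v (σ, p)) =ᶠ[𝓝 s]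
          fun σ => fderiv ℂ w (σ, p) (0, (1, 0)) - σ ^ (M + 1) * H (σ, p) := by
        filter_upwards [hS.mem_nhds hs] with σ hσ using hvw σ hσ p
      have sl : ∀ {g : ℂ × (ℂ × ℂ) → ℂ}, DifferentiableOn ℂ g (S ×ˢ Set.univ) →
          HasDerivAt (fun σ => g (σ, p)) (fderiv ℂ g (s, p) (1, 0)) s := fun {g} hg => by
        rw [← deriv_time_eq_fderiv (x := (s, p)) (hat hg s hs p)]
        exact ((hat hg s hs p).comp s (f := fun σ => (σ, p)) (by fun_prop)).hasDerivAt
      have e0 : HasDerivAt (fun σ => fderiv ℂ w (σ, p) (0, (1, 0)) - σ ^ (M + 1) * H (σ, p)) _ s :=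
        (sl hw1d).sub ((hasDerivAt_pow (M + 1) s).mul (sl hH))
      -- `∂/∂s` is commuted past `∂/∂z` here and past `∂/∂z'` in `e2`. The error `s^(M+1) H`
      -- differentiates to `s^M ((M+1) H + s ∂H/∂s)`.
      rw [e1.deriv_eq, e0.deriv,
        fderiv_fderiv_apply_comm hΩ hwd _ _ (mem_prod_univ hs p), mixedDeriv_slice hS hvd hs p]
      have e2 : (fun x => fderiv ℂ w x (1, 0)) =ᶠ[𝓝 (s, p)]
          fun x => fderiv ℂ v x (0, (0, 1)) := by
        filter_upwards [hΩ.mem_nhds (mem_prod_univ hs p)] with x hx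
        exact fderiv_fderiv_apply_comm hΩ hu _ _ hx
      rw [e2.fderiv_eq]
      push_cast
      ring
    have e3 : deriv (fun σ => u (σ, p)) =ᶠ[𝓝 0] fun σ => v (σ, p) := by
      filter_upwards [hS.mem_nhds h0] with σ hσ using hderiv σ hσ p
    rw [iteratedDeriv_succ', e3.iteratedDeriv_eq, ih (Nat.le_of_succ_le_succ hkM)
      (H := fun x => (M + 1) * H x + x.1 * fderiv ℂ H x (1, 0)) hvd ?_ hheat]
    · rw [Function.iterate_succ_apply]
      refine congrArg (fun g => (mixedDeriv^[k] g) p) (funext fun q => ?_)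
      -- At `s = 0` the error vanishes because its exponent is at least one, so `v(0, ·) = D u(0,
      -- ·)`.
      rw [← hderiv 0 h0 q, heat 0 h0 q]
      simp
    · have := differentiableOn_fderiv_apply hΩ hH (1, 0)
      fun_prop

/-- A holomorphic solution of `∂u/∂s = ∂²u/∂z∂z'` is the exponential series of its initial
value. -/
theorem hasSum_opExpTerm_of_heat {ρ : ℝ} (hu : DifferentiableOn ℂ u (Metric.ball 0 ρ ×ˢ Set.univ))
    (heat : ∀ s ∈ Metric.ball 0 ρ, ∀ p, deriv (fun σ => u (σ, p)) s =
      mixedDeriv (fun q => u (s, q)) p) {s : ℂ} (hs : s ∈ Metric.ball 0 ρ) (p : ℂ × ℂ) :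
    HasSum (opExpTerm (s • mixedDeriv) (fun q => u (0, q)) p) (u (s, p)) := by
  have h0 : (0 : ℂ) ∈ Metric.ball 0 ρ := Metric.mem_ball_self (Metric.pos_of_mem_ball hs)
  have hd : DifferentiableOn ℂ (fun σ => u (σ, p)) (Metric.ball 0 ρ) := fun σ hσ =>
    ((hu.differentiableAt ((isOpen_prod_univ Metric.isOpen_ball).mem_nhds
      (mem_prod_univ hσ p))).comp σ (f := fun σ => (σ, p)) (by fun_prop)).differentiableWithinAt
  have h := hasSum_taylorSeries_on_ball hd hs
  refine (congrArg (fun t : ℕ → ℂ => HasSum t _) (funext fun k => ?_)).mpr h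
  -- With `H = 0` the order of the error is free; it is taken equal to `k`.
  rw [homogeneous_mixedDeriv.opExpTerm_smul, iteratedDeriv_eq_mixedDeriv_iterate
    Metric.isOpen_ball h0 (le_refl k) hu (H := 0) (differentiableOn_const 0)]
  · simp
  · intro s hs p
    simp [heat s hs p]

end Heat

/-! ### Growth estimates -/

/-- The cross term is absorbed so that the coefficient of `y²` barely exceeds one: `y` will be the
part that grows with `w`, whose coefficient must stay below a threshold. -/
lemma sq_add_le {ε : ℝ} (hε : 0 < ε) (x y : ℝ) :
    (x + y) ^ 2 ≤ (1 + 1 / ε) * x ^ 2 + (1 + ε) * y ^ 2 := by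
  have h : (1 + 1 / ε) * x ^ 2 + (1 + ε) * y ^ 2 - (x + y) ^ 2 = (x - ε * y) ^ 2 / ε := by
    field_simp
    ring
  have : 0 ≤ (x - ε * y) ^ 2 / ε := by positivity
  linarith

/-- Cauchy estimate on a unit ball; replacing `|z|` by `|z| + 1` costs an arbitrarily small increase
of the exponents and a constant. -/
lemma GaussType₂.fderiv_apply {α β α' β' : ℝ} {f : ℂ × ℂ → ℂ} (hf : GaussType₂ α β f)
    (hα : 0 ≤ α) (hβ : 0 ≤ β) (hα' : α < α') (hβ' : β < β') (v : ℂ × ℂ) :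
    GaussType₂ α' β' (fun p => fderiv ℂ f p v) := by
  obtain ⟨hd, C, hC⟩ := hf
  have aux : ∀ {α α' x y : ℝ}, 0 ≤ α → α < α' → 0 ≤ y → y ≤ x + 1 →
      α * y ^ 2 ≤ α' * x ^ 2 + (α + α ^ 2 / (α' - α)) := by
    intro α α' x y h0 h1 h2 h3
    have h4 : 0 < α' - α := sub_pos.2 h1
    have h5 : α' * x ^ 2 + (α + α ^ 2 / (α' - α)) - α * (x + 1) ^ 2 =
        ((α' - α) * x - α) ^ 2 / (α' - α) := by
      field_simp
      ring
    have h6 : 0 ≤ ((α' - α) * x - α) ^ 2 / (α' - α) := by positivity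
    have h7 : α * y ^ 2 ≤ α * (x + 1) ^ 2 := by gcongr
    linarith
  have hC0 : 0 ≤ C := by
    have := (norm_nonneg _).trans (hC 0)
    exact nonneg_of_mul_nonneg_left this (Real.exp_pos _)
  refine ⟨differentiable_fderiv_apply hd v, 2 * (C * Real.exp ((α + α ^ 2 / (α' - α) +
    (β + β ^ 2 / (β' - β))) / 2)) / 1 * ‖v‖, fun p => ?_⟩
  have hb : ∀ y ∈ Metric.ball p 1, ‖f y‖ ≤ C * Real.exp ((α + α ^ 2 / (α' - α) +
      (β + β ^ 2 / (β' - β))) / 2) * Real.exp ((α' * ‖p.1‖ ^ 2 + β' * ‖p.2‖ ^ 2) / 2) := by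
    intro y hy
    rw [mem_ball_iff_norm] at hy
    have h1 : ‖y.1‖ ≤ ‖p.1‖ + 1 := by
      have := norm_fst_le (y - p)
      have := norm_le_insert' y.1 p.1
      simp only [Prod.fst_sub] at *
      linarith
    have h2 : ‖y.2‖ ≤ ‖p.2‖ + 1 := by
      have := norm_snd_le (y - p)
      have := norm_le_insert' y.2 p.2
      simp only [Prod.snd_sub] at *
      linarith
    refine (hC y).trans ?_
    rw [mul_assoc, ← Real.exp_add]
    have h3 := aux hα hα' (norm_nonneg _) h1
    have h4 := aux hβ hβ' (norm_nonneg _) h2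
    gcongr
    linarith
  have h := norm_fderiv_le_of_ball one_pos hd.differentiableOn hb
  calc ‖fderiv ℂ f p v‖ ≤ ‖fderiv ℂ f p‖ * ‖v‖ := ContinuousLinearMap.le_opNorm _ _
    _ ≤ _ := mul_le_mul_of_nonneg_right h (norm_nonneg v)
    _ = _ := by ring

/-- In the heat integral `f` grows essentially like `exp(m |w|²)`, with `m` the left side of `hm`;
`m < 1` lets the weight `exp(-|w|²)` win. The rate `κ` serves all base points, only `C` depends on
their bound `R`. -/
lemma GaussType₂.exists_bound {α β T a b : ℝ} {f : ℂ × ℂ → ℂ} (hf : GaussType₂ α β f)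
    (hα : 0 ≤ α) (hβ : 0 ≤ β) (hm : (α * (T * a) ^ 2 + β * b ^ 2) / 2 < 1) :
    ∃ κ < 1, ∀ R, ∃ C, 0 ≤ C ∧ ∀ x : ℂ × (ℂ × ℂ), ‖x.1‖ ≤ T → ‖x.2‖ ≤ R → ∀ w : ℂ,
      ‖f (x.2.1 + x.1 * (a * w), x.2.2 + b * conj w)‖ ≤ C * Real.exp (κ * ‖w‖ ^ 2) := by
  obtain ⟨-, C, hC⟩ := hf
  have hC0 : 0 ≤ C := by
    have := (norm_nonneg _).trans (hC 0)
    exact nonneg_of_mul_nonneg_left this (Real.exp_pos _)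
  set m := (α * (T * a) ^ 2 + β * b ^ 2) / 2 with hmdef
  -- This makes `(1 + ε) * m < 1`.
  set ε := (1 - m) / 2 with hε
  have hm0 : 0 ≤ m := by positivity
  have hε0 : 0 < ε := by linarith
  refine ⟨(1 + ε) * m, by nlinarith, fun R => ⟨C * Real.exp ((α + β) / 2 * ((1 + 1 / ε) * R ^ 2)),
    by positivity, fun x hx hR w => ?_⟩⟩
  have h1 : ‖x.2.1 + x.1 * (a * w)‖ ≤ R + T * |a| * ‖w‖ := by
    refine (norm_add_le _ _).trans ?_
    rw [norm_mul, norm_mul, Complex.norm_real, Real.norm_eq_abs, mul_assoc]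
    have := (norm_fst_le x.2).trans hR
    gcongr
  have h2 : ‖x.2.2 + b * conj w‖ ≤ R + |b| * ‖w‖ := by
    refine (norm_add_le _ _).trans ?_
    rw [norm_mul, Complex.norm_real, Real.norm_eq_abs, RCLike.norm_conj]
    have := (norm_snd_le x.2).trans hR
    gcongr
  have h3 : ‖x.2.1 + x.1 * (a * w)‖ ^ 2 ≤
      (1 + 1 / ε) * R ^ 2 + (1 + ε) * ((T * a) ^ 2 * ‖w‖ ^ 2) := by
    refine (pow_le_pow_left₀ (norm_nonneg _) h1 2).trans ((sq_add_le hε0 _ _).trans_eq ?_)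
    rw [mul_pow, mul_pow, sq_abs, mul_pow]
  have h4 : ‖x.2.2 + b * conj w‖ ^ 2 ≤ (1 + 1 / ε) * R ^ 2 + (1 + ε) * (b ^ 2 * ‖w‖ ^ 2) := by
    refine (pow_le_pow_left₀ (norm_nonneg _) h2 2).trans ((sq_add_le hε0 _ _).trans_eq ?_)
    rw [mul_pow, sq_abs]
  refine (hC _).trans ?_
  rw [mul_assoc, ← Real.exp_add]
  have h5 := mul_le_mul_of_nonneg_left h3 hα
  have h6 := mul_le_mul_of_nonneg_left h4 hβ
  refine mul_le_mul_of_nonneg_left (Real.exp_le_exp.2 ?_) hC0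
  simp only
  rw [hmdef]
  linarith

/-- The condition is open, which leaves room for the loss in `GaussType₂.fderiv_apply`. -/
lemma exists_admissible_gt {α β T a b : ℝ} (hm : (α * (T * a) ^ 2 + β * b ^ 2) / 2 < 1) :
    ∃ α' > α, ∃ β' > β, (α' * (T * a) ^ 2 + β' * b ^ 2) / 2 < 1 := by
  have hc : ContinuousAt (fun ε : ℝ => ((α + ε) * (T * a) ^ 2 + (β + ε) * b ^ 2) / 2) 0 := by
    fun_prop
  have h := hc.eventually_lt_const (u := 1) (by simpa using hm)
  obtain ⟨ε, h1, h2⟩ := ((h.filter_mono nhdsWithin_le_nhds).and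
    (self_mem_nhdsWithin (s := Set.Ioi (0 : ℝ)))).exists
  exact ⟨α + ε, lt_add_of_pos_right _ h2, β + ε, lt_add_of_pos_right _ h2, h1⟩

lemma exists_time_gt {α β T a b : ℝ} (hm : (α * (T * a) ^ 2 + β * b ^ 2) / 2 < 1) :
    ∃ T' > T, (α * (T' * a) ^ 2 + β * b ^ 2) / 2 < 1 := by
  have hc : ContinuousAt (fun ε : ℝ => (α * ((T + ε) * a) ^ 2 + β * b ^ 2) / 2) 0 := by
    fun_prop
  have h := hc.eventually_lt_const (u := 1) (by simpa using hm)
  obtain ⟨ε, h1, h2⟩ := ((h.filter_mono nhdsWithin_le_nhds).and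
    (self_mem_nhdsWithin (s := Set.Ioi (0 : ℝ)))).exists
  exact ⟨T + ε, lt_add_of_pos_right _ h2, h1⟩

/-! ### Gaussian integrals over the complex plane -/

lemma integrable_exp_neg_mul_sq_norm {c : ℝ} (hc : 0 < c) :
    Integrable (fun w : ℂ => Real.exp (-c * ‖w‖ ^ 2)) := by
  have h := GaussianFourier.integrable_cexp_neg_mul_sq_norm_add (V := ℂ) (b := c)
    (by simpa using hc) 0 0
  refine h.norm.congr (Eventually.of_forall fun w => ?_)
  simp only [zero_mul, add_zero, Complex.norm_exp]
  congr 1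
  norm_cast

/-- The normalized Gaussian on the complex plane. -/
noncomputable def gaussWeight (w : ℂ) : ℂ := ((Real.pi⁻¹ * Real.exp (-‖w‖ ^ 2) : ℝ) : ℂ)

lemma continuous_gaussWeight : Continuous gaussWeight := by
  unfold gaussWeight
  fun_prop

lemma norm_gaussWeight (w : ℂ) : ‖gaussWeight w‖ = Real.pi⁻¹ * Real.exp (-‖w‖ ^ 2) := by
  rw [gaussWeight, Complex.norm_real, Real.norm_of_nonneg]
  have := Real.pi_pos
  positivity

lemma integral_gaussWeight : ∫ w, gaussWeight w = 1 := by
  have h := GaussianFourier.integral_rexp_neg_mul_sq_norm (V := ℂ) one_pos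
  simp only [neg_mul, one_mul, Complex.finrank_real_complex, div_one] at h
  unfold gaussWeight
  rw [integral_complex_ofReal, integral_const_mul, h]
  simp [Real.pi_ne_zero]

lemma integrable_gaussWeight_mul {κ C : ℝ} (hκ : κ < 1) {g : ℂ → ℂ} (hg : Continuous g)
    (hb : ∀ w, ‖g w‖ ≤ C * Real.exp (κ * ‖w‖ ^ 2)) :
    Integrable (fun w => gaussWeight w * g w) := by
  refine Integrable.mono' ((integrable_exp_neg_mul_sq_norm (sub_pos.2 hκ)).const_mul
    (Real.pi⁻¹ * C)) (continuous_gaussWeight.mul hg).aestronglyMeasurable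
    (Eventually.of_forall fun w => ?_)
  rw [norm_mul, norm_gaussWeight]
  have h1 : 0 ≤ Real.pi⁻¹ * Real.exp (-‖w‖ ^ 2) := by
    have := Real.pi_pos
    positivity
  refine (mul_le_mul_of_nonneg_left (hb w) h1).trans_eq ?_
  have : Real.exp (-(1 - κ) * ‖w‖ ^ 2) = Real.exp (-‖w‖ ^ 2) * Real.exp (κ * ‖w‖ ^ 2) := by
    rw [← Real.exp_add]
    congr 1
    ring
  rw [this]
  ring

/-- A factor of linear growth is absorbed by half of the gap `1 - κ`. -/
lemma integrable_gaussWeight_mul_mul {κ C : ℝ} (hκ : κ < 1) {g l : ℂ → ℂ} (hg : Continuous g)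
    (hl : Continuous l) (hll : ∀ w, ‖l w‖ ≤ ‖w‖) (_hC : 0 ≤ C)
    (hb : ∀ w, ‖g w‖ ≤ C * Real.exp (κ * ‖w‖ ^ 2)) :
    Integrable (fun w => gaussWeight w * (l w * g w)) := by
  set η := (1 - κ) / 2 with hη
  have hη0 : 0 < η := by linarith
  refine integrable_gaussWeight_mul (κ := κ + η) (C := (1 + 1 / η) * C) (by linarith)
    (hl.mul hg) fun w => ?_
  have h1 : ‖w‖ ≤ (1 + 1 / η) * Real.exp (η * ‖w‖ ^ 2) := by
    have h2 := Real.add_one_le_exp (η * ‖w‖ ^ 2)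
    have h3 : ‖w‖ ≤ (1 + 1 / η) * (η * ‖w‖ ^ 2 + 1) := by
      have : (1 + 1 / η) * (η * ‖w‖ ^ 2 + 1) = η * ‖w‖ ^ 2 + 1 + ‖w‖ ^ 2 + 1 / η := by
        field_simp
        ring
      rw [this]
      have : 0 < 1 / η := by positivity
      nlinarith [sq_nonneg (‖w‖ - 1), mul_nonneg hη0.le (sq_nonneg ‖w‖)]
    exact h3.trans (mul_le_mul_of_nonneg_left h2 (by positivity))
  rw [norm_mul]
  calc ‖l w‖ * ‖g w‖ ≤ ((1 + 1 / η) * Real.exp (η * ‖w‖ ^ 2)) * (C * Real.exp (κ * ‖w‖ ^ 2)) :=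
        mul_le_mul ((hll w).trans h1) (hb w) (norm_nonneg _) (by positivity)
    _ = (1 + 1 / η) * C * Real.exp ((κ + η) * ‖w‖ ^ 2) := by
        rw [add_mul κ, Real.exp_add]
        ring

lemma hasLineDerivAt_gaussWeight_one (w : ℂ) :
    HasLineDerivAt ℝ gaussWeight (-(2 * (w.re : ℂ) * gaussWeight w)) w 1 := by
  have h : ∀ t : ℝ, gaussWeight (w + t • 1) =
      ((Real.pi⁻¹ * Real.exp (-((w.re + t) ^ 2 + w.im ^ 2)) : ℝ) : ℂ) := fun t => by
    rw [gaussWeight, Complex.sq_norm, normSq_apply]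
    simp [sq]
  unfold HasLineDerivAt
  simp only [h]
  rw [gaussWeight, Complex.sq_norm, normSq_apply]
  have : HasDerivAt (fun t : ℝ => Real.pi⁻¹ * Real.exp (-((w.re + t) ^ 2 + w.im ^ 2)))
      (Real.pi⁻¹ * (Real.exp (-((w.re + 0) ^ 2 + w.im ^ 2)) * -(2 * (w.re + 0)))) 0 := by
    refine (HasDerivAt.exp ?_).const_mul _
    have := (((hasDerivAt_id (0 : ℝ)).const_add w.re).pow 2).add_const (w.im ^ 2)
    convert! this.neg using 1
    simp
  convert! this.ofReal_comp using 1
  push_cast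
  simp only [sq, add_zero]
  ring

lemma hasLineDerivAt_gaussWeight_I (w : ℂ) :
    HasLineDerivAt ℝ gaussWeight (-(2 * (w.im : ℂ) * gaussWeight w)) w I := by
  have h : ∀ t : ℝ, gaussWeight (w + t • I) =
      ((Real.pi⁻¹ * Real.exp (-(w.re ^ 2 + (w.im + t) ^ 2)) : ℝ) : ℂ) := fun t => by
    rw [gaussWeight, Complex.sq_norm, normSq_apply]
    simp [sq]
  unfold HasLineDerivAt
  simp only [h]
  rw [gaussWeight, Complex.sq_norm, normSq_apply]
  have : HasDerivAt (fun t : ℝ => Real.pi⁻¹ * Real.exp (-(w.re ^ 2 + (w.im + t) ^ 2)))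
      (Real.pi⁻¹ * (Real.exp (-(w.re ^ 2 + (w.im + 0) ^ 2)) * -(2 * (w.im + 0)))) 0 := by
    refine (HasDerivAt.exp ?_).const_mul _
    have := (((hasDerivAt_id (0 : ℝ)).const_add w.im).pow 2).const_add (w.re ^ 2)
    convert! this.neg using 1
    simp
  convert! this.ofReal_comp using 1
  push_cast
  simp only [sq, add_zero]
  ring

/-! ### The heat integral -/

/-- The integral `∫ π⁻¹ exp(-|w|²) f(z + t a w, z' + b w*) dw`, where `x = (t, (z, z'))`. -/
noncomputable def heatIntegral (a b : ℝ) (f : ℂ × ℂ → ℂ) (x : ℂ × (ℂ × ℂ)) : ℂ :=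
  ∫ w : ℂ, gaussWeight w * f (x.2.1 + x.1 * (a * w), x.2.2 + b * conj w)

section HeatIntegral

variable {α β T a b : ℝ} {f : ℂ × ℂ → ℂ}

lemma continuous_comp_shift (hf : Continuous f) (x : ℂ × (ℂ × ℂ)) :
    Continuous (fun w : ℂ => f (x.2.1 + x.1 * (a * w), x.2.2 + b * conj w)) := by
  have : Continuous (fun w : ℂ => conj w) := continuous_conj
  fun_prop

lemma hasFDerivAt_shift (hf : Differentiable ℂ f) (x : ℂ × (ℂ × ℂ)) (w : ℂ) :
    HasFDerivAt (fun x : ℂ × (ℂ × ℂ) =>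
        gaussWeight w * f (x.2.1 + x.1 * (a * w), x.2.2 + b * conj w))
      (gaussWeight w • (fderiv ℂ f (x.2.1 + x.1 * (a * w), x.2.2 + b * conj w)).comp
        (ContinuousLinearMap.snd ℂ ℂ (ℂ × ℂ) +
          (ContinuousLinearMap.fst ℂ ℂ (ℂ × ℂ)).smulRight ((a * w, 0) : ℂ × ℂ))) x := by
  have h1 : HasFDerivAt (fun x : ℂ × (ℂ × ℂ) => (x.2.1 + x.1 * (a * w), x.2.2 + b * conj w))
      (ContinuousLinearMap.snd ℂ ℂ (ℂ × ℂ) +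
          (ContinuousLinearMap.fst ℂ ℂ (ℂ × ℂ)).smulRight ((a * w, 0) : ℂ × ℂ)) x := by
    have h2 := (((ContinuousLinearMap.snd ℂ ℂ (ℂ × ℂ)).hasFDerivAt (x := x)).add
      (((ContinuousLinearMap.fst ℂ ℂ (ℂ × ℂ)).smulRight
        ((a * w, 0) : ℂ × ℂ)).hasFDerivAt (x := x))).add_const ((0, b * conj w) : ℂ × ℂ)
    refine h2.congr_of_eventuallyEq (Eventually.of_forall fun y => ?_)
    ext <;> simp
  exact ((hf _).hasFDerivAt.comp x h1).const_mul _

/-- Differentiation under the integral: space directions act on `f` alone, while the time direction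
brings down `a w`. -/
lemma heatIntegral_hasFDerivAt (hf : GaussType₂ α β f) (hα : 0 ≤ α) (hβ : 0 ≤ β)
    (hm : (α * (T * a) ^ 2 + β * b ^ 2) / 2 < 1) {x : ℂ × (ℂ × ℂ)} (hx : ‖x.1‖ < T) :
    ∃ L : ℂ × (ℂ × ℂ) →L[ℂ] ℂ, HasFDerivAt (heatIntegral a b f) L x ∧
      (∀ v, L (0, v) = heatIntegral a b (fun p => fderiv ℂ f p v) x) ∧
      L (1, 0) = a * ∫ w : ℂ, gaussWeight w * (w *
        fderiv ℂ f (x.2.1 + x.1 * (a * w), x.2.2 + b * conj w) (1, 0)) := by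
  have hT : 0 < T := (norm_nonneg _).trans_lt hx
  obtain ⟨κ, hκ, hb⟩ := hf.exists_bound hα hβ hm
  obtain ⟨C, hC, hb⟩ := hb (‖x.2‖ + (T - ‖x.1‖))
  have hball : ∀ y ∈ Metric.ball x (T - ‖x.1‖), ‖y.1‖ ≤ T ∧ ‖y.2‖ ≤ ‖x.2‖ + (T - ‖x.1‖) := by
    intro y hy
    rw [mem_ball_iff_norm] at hy
    have h1 := norm_fst_le (y - x)
    have h2 := norm_snd_le (y - x)
    have h3 := norm_le_insert' y.1 x.1
    have h4 := norm_le_insert' y.2 x.2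
    simp only [Prod.fst_sub, Prod.snd_sub] at *
    constructor <;> linarith
  have key := hasFDerivAt_integral_of_holomorphic (μ := volume) (x₀ := x)
    (F := fun x (w : ℂ) => gaussWeight w * f (x.2.1 + x.1 * (a * w), x.2.2 + b * conj w))
    (bound := fun w => Real.pi⁻¹ * C * Real.exp (-(1 - κ) * ‖w‖ ^ 2)) (sub_pos.2 hx)
    (fun w y _ => (hasFDerivAt_shift hf.1 y w).differentiableAt.differentiableWithinAt)
    (fun y _ => (continuous_gaussWeight.mul
      (continuous_comp_shift hf.1.continuous y)).aestronglyMeasurable)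
    (fun y hy w => ?_) ((integrable_exp_neg_mul_sq_norm (sub_pos.2 hκ)).const_mul _)
  · refine ⟨_, key.2, fun v => ?_, ?_⟩
    · rw [ContinuousLinearMap.integral_apply key.1]
      refine integral_congr_ae (Eventually.of_forall fun w => ?_)
      simp only [(hasFDerivAt_shift hf.1 x w).fderiv]
      simp
    · rw [ContinuousLinearMap.integral_apply key.1, ← integral_const_mul]
      refine integral_congr_ae (Eventually.of_forall fun w => ?_)
      simp only [(hasFDerivAt_shift hf.1 x w).fderiv]
      have : ((a * w, 0) : ℂ × ℂ) = (a * w) • ((1, 0) : ℂ × ℂ) := by simp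
      simp only [FunLike.coe_smul, Pi.smul_apply, ContinuousLinearMap.comp_apply, 
        FunLike.coe_add, Pi.add_apply, ContinuousLinearMap.coe_snd', 
        ContinuousLinearMap.smulRight_apply, ContinuousLinearMap.coe_fst', zero_add, one_smul,
        this, map_smul, smul_eq_mul]
      ring
  · have h1 := hb y (hball y hy).1 (hball y hy).2 w
    rw [norm_mul, norm_gaussWeight]
    have h2 : 0 ≤ Real.pi⁻¹ * Real.exp (-‖w‖ ^ 2) := by
      have := Real.pi_pos
      positivity
    refine (mul_le_mul_of_nonneg_left h1 h2).trans_eq ?_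
    have : Real.exp (-(1 - κ) * ‖w‖ ^ 2) = Real.exp (-‖w‖ ^ 2) * Real.exp (κ * ‖w‖ ^ 2) := by
      rw [← Real.exp_add]
      congr 1
      ring
    rw [this]
    ring

lemma differentiableOn_heatIntegral (hf : GaussType₂ α β f) (hα : 0 ≤ α) (hβ : 0 ≤ β)
    (hm : (α * (T * a) ^ 2 + β * b ^ 2) / 2 < 1) :
    DifferentiableOn ℂ (heatIntegral a b f) (Metric.ball 0 T ×ˢ Set.univ) := fun x hx => by
  obtain ⟨L, hL, -⟩ := heatIntegral_hasFDerivAt hf hα hβ hm (mem_ball_zero_iff.1 hx.1)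
  exact hL.differentiableAt.differentiableWithinAt

/-- Integration by parts with `∂/∂w*`. -/
lemma integral_gaussWeight_mul_id (hf : GaussType₂ α β f) (hα : 0 ≤ α) (hβ : 0 ≤ β)
    (hm : (α * (T * a) ^ 2 + β * b ^ 2) / 2 < 1) {x : ℂ × (ℂ × ℂ)} (hx : ‖x.1‖ ≤ T) :
    ∫ w : ℂ, gaussWeight w * (w * f (x.2.1 + x.1 * (a * w), x.2.2 + b * conj w)) =
      b * heatIntegral a b (fun p => fderiv ℂ f p (0, 1)) x := by
  set g : ℂ → ℂ := fun w => f (x.2.1 + x.1 * (a * w), x.2.2 + b * conj w) with hg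
  have hgc : Continuous g := continuous_comp_shift hf.1.continuous x
  obtain ⟨κ, hκ, hb⟩ := hf.exists_bound hα hβ hm
  obtain ⟨C, hC, hb⟩ := hb ‖x.2‖
  have hgb : ∀ w, ‖g w‖ ≤ C * Real.exp (κ * ‖w‖ ^ 2) := hb x hx le_rfl
  -- Partial derivatives of `f` have slightly larger exponents, still admissible.
  obtain ⟨α', hα', β', hβ', hm'⟩ := exists_admissible_gt hm
  have hpart : ∀ v : ℂ × ℂ, Integrable (fun w : ℂ => gaussWeight w *
      fderiv ℂ f (x.2.1 + x.1 * (a * w), x.2.2 + b * conj w) v) := by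
    intro v
    have hv := hf.fderiv_apply hα hβ hα' hβ' v
    obtain ⟨κ, hκ, hb⟩ := hv.exists_bound (hα.trans hα'.le) (hβ.trans hβ'.le) hm'
    obtain ⟨C, hC, hb⟩ := hb ‖x.2‖
    exact integrable_gaussWeight_mul hκ (continuous_comp_shift hv.1.continuous x)
      (hb x hx le_rfl)
  have hgd : ∀ w v : ℂ, HasLineDerivAt ℝ g
      (x.1 * (a * v) * fderiv ℂ f (x.2.1 + x.1 * (a * w), x.2.2 + b * conj w) (1, 0) +
        b * conj v * fderiv ℂ f (x.2.1 + x.1 * (a * w), x.2.2 + b * conj w) (0, 1)) w v := by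
    intro w v
    have h1 : HasDerivAt (fun t : ℝ => ((x.2.1 + x.1 * (a * w), x.2.2 + b * conj w) +
        t • (x.1 * (a * v), b * conj v) : ℂ × ℂ)) (x.1 * (a * v), b * conj v) 0 := by
      have := ((hasDerivAt_id (0 : ℝ)).smul_const ((x.1 * (a * v), b * conj v) : ℂ × ℂ)).const_add
        ((x.2.1 + x.1 * (a * w), x.2.2 + b * conj w) : ℂ × ℂ)
      simpa using this
    have h2 := (hf.1 ((x.2.1 + x.1 * (a * w), x.2.2 + b * conj w) +
      (0 : ℝ) • (x.1 * (a * v), b * conj v))).hasFDerivAt.restrictScalars ℝ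
    have h3 := h2.comp_hasDerivAt (0 : ℝ) h1
    unfold HasLineDerivAt
    have h4 : (fun t : ℝ => g (w + t • v)) = f ∘ fun t : ℝ =>
        ((x.2.1 + x.1 * (a * w), x.2.2 + b * conj w) +
          t • (x.1 * (a * v), b * conj v) : ℂ × ℂ) := by
      funext t
      simp only [hg, Function.comp]
      congr 1
      ext
      · simp
        ring
      · simp
        ring
    rw [h4]
    convert! h3 using 1
    have h5 : ((x.1 * (a * v), b * conj v) : ℂ × ℂ) =
        (x.1 * (a * v)) • ((1, 0) : ℂ × ℂ) + (b * conj v) • ((0, 1) : ℂ × ℂ) := by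
      ext <;> simp
    rw [h5]
    simp only [zero_smul, add_zero, ContinuousLinearMap.coe_restrictScalars', map_add, map_smul,
      smul_eq_mul]
  set P := ∫ w : ℂ, gaussWeight w *
    fderiv ℂ f (x.2.1 + x.1 * (a * w), x.2.2 + b * conj w) (1, 0) with hP
  set Q := ∫ w : ℂ, gaussWeight w *
    fderiv ℂ f (x.2.1 + x.1 * (a * w), x.2.2 + b * conj w) (0, 1) with hQ
  have hre : Integrable (fun w : ℂ => gaussWeight w * ((w.re : ℂ) * g w)) :=
    integrable_gaussWeight_mul_mul hκ hgc (by fun_prop)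
      (fun w => by rw [Complex.norm_real]; exact abs_re_le_norm w) hC hgb
  have him : Integrable (fun w : ℂ => gaussWeight w * ((w.im : ℂ) * g w)) :=
    integrable_gaussWeight_mul_mul hκ hgc (by fun_prop)
      (fun w => by rw [Complex.norm_real]; exact abs_im_le_norm w) hC hgb
  have hdint : ∀ v : ℂ, Integrable (fun w => gaussWeight w *
      (x.1 * (a * v) * fderiv ℂ f (x.2.1 + x.1 * (a * w), x.2.2 + b * conj w) (1, 0) +
        b * conj v * fderiv ℂ f (x.2.1 + x.1 * (a * w), x.2.2 + b * conj w) (0, 1))) := by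
    intro v
    refine (((hpart (1, 0)).const_mul (x.1 * (a * v))).add
      ((hpart (0, 1)).const_mul (b * conj v))).congr (Eventually.of_forall fun w => ?_)
    simp only [Pi.add_apply]
    ring
  have hdval : ∀ v : ℂ, ∫ w, gaussWeight w *
      (x.1 * (a * v) * fderiv ℂ f (x.2.1 + x.1 * (a * w), x.2.2 + b * conj w) (1, 0) +
        b * conj v * fderiv ℂ f (x.2.1 + x.1 * (a * w), x.2.2 + b * conj w) (0, 1)) =
      x.1 * (a * v) * P + b * conj v * Q := by
    intro v
    rw [hP, hQ, ← integral_const_mul, ← integral_const_mul, ← integral_add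
      ((hpart (1, 0)).const_mul _) ((hpart (0, 1)).const_mul _)]
    refine integral_congr_ae (Eventually.of_forall fun w => ?_)
    simp only
    ring
  -- Real integration by parts in direction `v`, used for `v = 1` and `v = I`; the weight yields `2
  -- Re w` and `2 Im w`.
  have parts : ∀ (v : ℂ) (l : ℂ → ℝ), Integrable (fun w : ℂ => gaussWeight w * ((l w : ℂ) * g w)) →
      (∀ w, HasLineDerivAt ℝ gaussWeight (-(2 * (l w : ℂ) * gaussWeight w)) w v) →
      2 * ∫ w, gaussWeight w * ((l w : ℂ) * g w) = x.1 * (a * v) * P + b * conj v * Q := by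
    intro v l hl hline
    have h := integral_bilinear_hasLineDerivAt_right_eq_neg_left_of_integrable (μ := volume)
      (f := gaussWeight) (g := g) (B := ContinuousLinearMap.mul ℝ ℂ) (v := v)
      (f' := fun w => -(2 * (l w : ℂ) * gaussWeight w)) ?_ (hdint v)
      (integrable_gaussWeight_mul hκ hgc hgb) (fun w _ => hline w) (fun w _ => hgd w v)
    · simp only [ContinuousLinearMap.mul_apply'] at h
      rw [← hdval v, h, ← integral_neg, ← integral_const_mul]
      refine integral_congr_ae (Eventually.of_forall fun w => ?_)
      simp only
      ring
    · refine (hl.const_mul (-2)).congr (Eventually.of_forall fun w => ?_)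
      simp only [ContinuousLinearMap.mul_apply']
      ring
  have e1 := parts 1 re hre hasLineDerivAt_gaussWeight_one
  have e2 := parts I im him hasLineDerivAt_gaussWeight_I
  have e3 : ∫ w : ℂ, gaussWeight w * (w * g w) =
      (∫ w : ℂ, gaussWeight w * ((w.re : ℂ) * g w)) +
        I * ∫ w : ℂ, gaussWeight w * ((w.im : ℂ) * g w) := by
    rw [← integral_const_mul, ← integral_add hre (him.const_mul _)]
    refine integral_congr_ae (Eventually.of_forall fun w => ?_)
    simp only
    conv_lhs => rw [← re_add_im w]
    have : g (w.re + w.im * I) = g w := by rw [re_add_im]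
    have h' : gaussWeight (w.re + w.im * I) = gaussWeight w := by rw [re_add_im]
    rw [this, h']
    ring
  change _ = b * Q
  rw [e3]
  simp only [map_one, conj_I, mul_one] at e1 e2
  have hI : I * I = -1 := I_mul_I
  -- The combination `(∂₁ + I ∂₂)/2` is `∂/∂w*`: the contributions of `∂f/∂z`, which comes with `w`,
  -- cancel, and those of `∂f/∂z'` add up to `b Q`.
  linear_combination (1 / 2) * e1 + (I / 2) * e2 + (x.1 * a * P / 2 - b * Q / 2) * hI

/-- Mean value property. `G(t)`, the average of `f(q.1, q.2 + t b w)`, is holomorphic beyond the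
unit disc and constant on the unit circle by rotation invariance of the weight, hence `G 0 = G 1`.
Here `G 0 = f q`, and `w ↦ w*` identifies `G 1` with the heat integral at time zero. -/
lemma heatIntegral_zero (hf : GaussType₂ α β f) (hα : 0 ≤ α) (hβ : 0 ≤ β)
    (hm : β * b ^ 2 / 2 < 1) (q : ℂ × ℂ) : heatIntegral a b f (0, q) = f q := by
  -- After swapping the variables `G` is itself a heat integral, with parameters `b` and `0`, so its
  -- holomorphy is already known.
  set f' : ℂ × ℂ → ℂ := fun p => f p.swap with hf'
  have hft : GaussType₂ β α f' := by
    obtain ⟨hd, C, hC⟩ := hf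
    refine ⟨hd.comp (by unfold Prod.swap; fun_prop), C, fun p => (hC p.swap).trans_eq ?_⟩
    simp [add_comm]
  obtain ⟨T, hT, hm'⟩ := exists_time_gt (α := β) (β := α) (T := 1) (a := b) (b := 0)
    (by simpa using hm)
  set G : ℂ → ℂ := fun t => heatIntegral b 0 f' (t, q.swap) with hG
  have hGd : ∀ t ∈ Metric.ball (0 : ℂ) T, DifferentiableAt ℂ G t := fun t ht =>
    DifferentiableAt.comp t (f := fun t => (t, q.swap))
      ((differentiableOn_heatIntegral hft hβ hα hm').differentiableAt
        ((isOpen_prod_univ Metric.isOpen_ball).mem_nhds (mem_prod_univ ht _))) (by fun_prop)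
  have hGint : ∀ t, G t = ∫ w : ℂ, gaussWeight w * f (q.1, q.2 + t * (b * w)) := fun t => by
    simp only [hG, heatIntegral, hf']
    simp
  have hinv : ∀ t ∈ frontier (Metric.ball (0 : ℂ) 1), G t = G 1 := by
    intro t ht
    rw [frontier_ball _ one_ne_zero] at ht
    rw [hGint, hGint]
    have h := (rotation (⟨t, ht⟩ : Circle)).measurePreserving.integral_comp
      (rotation (⟨t, ht⟩ : Circle)).toHomeomorph.measurableEmbedding
      (fun w => gaussWeight w * f (q.1, q.2 + 1 * (b * w)))
    rw [← h]
    refine integral_congr_ae (Eventually.of_forall fun w => ?_)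
    have hn : gaussWeight (t * w) = gaussWeight w := by
      rw [mem_sphere_zero_iff_norm] at ht
      simp [gaussWeight, ht]
    change _ = gaussWeight (t * w) * f (q.1, q.2 + 1 * (b * (t * w)))
    rw [hn, one_mul, mul_left_comm (b : ℂ)]
  have hcl : DiffContOnCl ℂ G (Metric.ball 0 1) := by
    refine DifferentiableOn.diffContOnCl fun t ht => (hGd t ?_).differentiableWithinAt
    rw [closure_ball _ one_ne_zero] at ht
    exact Metric.closedBall_subset_ball hT ht
  have h0 : G 0 = G 1 := Complex.eqOn_of_eqOn_frontier Metric.isBounded_ball hcl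
    (diffContOnCl_const (c := G 1)) (fun t ht => hinv t ht) (Metric.mem_ball_self one_pos)
  have h1 : G 1 = heatIntegral a b f (0, q) := by
    rw [hGint, heatIntegral]
    have h := conjLIE.measurePreserving.integral_comp conjLIE.toHomeomorph.measurableEmbedding
      (fun w => gaussWeight w * f (q.1, q.2 + 1 * (b * w)))
    rw [← h]
    refine integral_congr_ae (Eventually.of_forall fun w => ?_)
    simp [gaussWeight]
  rw [← h1, ← h0, hGint]
  simp [integral_mul_const, integral_gaussWeight]

/-- The time derivative averages `a w ∂f/∂z`; integration by parts makes this `ab ∂²f/∂z'∂z`, and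
`ab = 1`. -/
lemma deriv_heatIntegral (hf : GaussType₂ α β f) (hα : 0 ≤ α) (hβ : 0 ≤ β) (hab : a * b = 1)
    (hm : (α * (T * a) ^ 2 + β * b ^ 2) / 2 < 1) {s : ℂ} (hs : s ∈ Metric.ball 0 T)
    (p : ℂ × ℂ) :
    deriv (fun σ => heatIntegral a b f (σ, p)) s =
      mixedDeriv (fun q => heatIntegral a b f (s, q)) p := by
  have hs' := mem_ball_zero_iff.1 hs
  obtain ⟨α', hα', β', hβ', hm'⟩ := exists_admissible_gt hm
  have hd := differentiableOn_heatIntegral hf hα hβ hm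
  obtain ⟨L, hL, -, hL1⟩ := heatIntegral_hasFDerivAt hf hα hβ hm (x := (s, p)) hs'
  have hf1 := hf.fderiv_apply hα hβ hα' hβ' (1, 0)
  have hf2 := hf.fderiv_apply hα hβ hα' hβ' (0, 1)
  rw [mixedDeriv_slice Metric.isOpen_ball hd hs p, deriv_time_eq_fderiv (x := (s, p))
    hL.differentiableAt, hL.fderiv, hL1, integral_gaussWeight_mul_id hf1 (hα.trans hα'.le)
    (hβ.trans hβ'.le) hm' (x := (s, p)) hs'.le]
  have hev : (fun x => fderiv ℂ (heatIntegral a b f) x (0, (0, 1))) =ᶠ[𝓝 (s, p)]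
      heatIntegral a b (fun p => fderiv ℂ f p (0, 1)) := by
    filter_upwards [(isOpen_prod_univ Metric.isOpen_ball).mem_nhds (mem_prod_univ hs p)] with x hx
    obtain ⟨L, hL, hL0, -⟩ := heatIntegral_hasFDerivAt hf hα hβ hm (mem_ball_zero_iff.1 hx.1)
    rw [hL.fderiv, hL0]
  obtain ⟨L', hL', hL0', -⟩ := heatIntegral_hasFDerivAt hf2 (hα.trans hα'.le)
    (hβ.trans hβ'.le) hm' (x := (s, p)) hs'
  rw [hev.fderiv_eq, hL'.fderiv, hL0', ← mul_assoc]
  have hab' : (a : ℂ) * b = 1 := by exact_mod_cast hab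
  rw [hab', one_mul]
  congr 1
  funext y
  exact fderiv_fderiv_apply_comm isOpen_univ hf.1.differentiableOn _ _ (Set.mem_univ y)

/-- The exponential of `s ∂²/∂z∂z'` as a Gaussian integral. -/
theorem hasSum_heatIntegral (hf : GaussType₂ α β f) (hα : 0 ≤ α) (hβ : 0 ≤ β) (hab : a * b = 1)
    (hm : (α * (T * a) ^ 2 + β * b ^ 2) / 2 < 1) {s : ℂ} (hs : s ∈ Metric.ball 0 T)
    (p : ℂ × ℂ) :
    HasSum (opExpTerm (s • mixedDeriv) f p) (heatIntegral a b f (s, p)) := by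
  have h := hasSum_opExpTerm_of_heat (differentiableOn_heatIntegral hf hα hβ hm)
    (fun s hs p => deriv_heatIntegral hf hα hβ hab hm hs p) hs p
  have h0 : (fun q => heatIntegral a b f (0, q)) = f := funext fun q =>
    heatIntegral_zero hf hα hβ (lt_of_le_of_lt (by
      have : 0 ≤ α * (T * a) ^ 2 := by positivity
      linarith) hm) q
  rwa [h0] at h

end HeatIntegral

/-! ### The domain of convergence of the exponential series -/

lemma exists_scaling {α β T : ℝ} (hα : 0 ≤ α) (hβ : 0 ≤ β) (hT : 0 < T)
    (h : T * Real.sqrt (α * β) < 1) :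
    ∃ a b : ℝ, a * b = 1 ∧ (α * (T * a) ^ 2 + β * b ^ 2) / 2 < 1 := by
  have h1 : T ^ 2 * (α * β) < 1 := by
    rw [← Real.sq_sqrt (mul_nonneg hα hβ), ← mul_pow]
    exact pow_lt_one₀ (by positivity) h two_ne_zero
  -- A larger `α'` is positive even if `α = 0`. With `b = T √α'` and `a = 1/b` the two summands
  -- become `α/α'` and `T² α' β`, each below one.
  obtain ⟨α', hα', h2⟩ : ∃ α' > α, T ^ 2 * (α' * β) < 1 := by
    have hc : ContinuousAt (fun ε : ℝ => T ^ 2 * ((α + ε) * β)) 0 := by fun_prop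
    have h := hc.eventually_lt_const (u := 1) (by simpa using h1)
    obtain ⟨ε, h1, h2⟩ := ((h.filter_mono nhdsWithin_le_nhds).and
      (self_mem_nhdsWithin (s := Set.Ioi (0 : ℝ)))).exists
    exact ⟨α + ε, lt_add_of_pos_right _ h2, h1⟩
  have hα0 : 0 < α' := hα.trans_lt hα'
  have hsq := Real.sq_sqrt hα0.le
  have hs0 := Real.sqrt_pos.2 hα0
  refine ⟨1 / (T * Real.sqrt α'), T * Real.sqrt α', by field_simp, ?_⟩
  have h3 : α * (T * (1 / (T * Real.sqrt α'))) ^ 2 = α / α' := by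
    field_simp
    rw [hsq]
  have h4 : α / α' < 1 := (div_lt_one hα0).2 hα'
  have h5 : β * (T * Real.sqrt α') ^ 2 = T ^ 2 * (α' * β) := by
    rw [mul_pow, hsq]
    ring
  rw [h3, h5]
  linarith

/-- The times at which the exponential series of functions of Gaussian type converge, where
`κ = √(αβ)`. -/
def convergenceDomain (κ : ℝ) : Set ℂ := {t | ‖t‖ * κ < 1}

lemma isOpen_convergenceDomain (κ : ℝ) : IsOpen (convergenceDomain κ) :=
  isOpen_lt (by fun_prop) continuous_const

/-- For functions of Gaussian type the exponential series of `t ∂²/∂z∂z'` is a holomorphic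
solution of the heat equation. -/
theorem GaussType₂.heat {α β : ℝ} {f : ℂ × ℂ → ℂ} (hf : GaussType₂ α β f) (hα : 0 ≤ α)
    (hβ : 0 ≤ β) :
    DifferentiableOn ℂ (fun x : ℂ × (ℂ × ℂ) => opExp (x.1 • mixedDeriv) f x.2)
      (convergenceDomain (Real.sqrt (α * β)) ×ˢ Set.univ) ∧
    ∀ s ∈ convergenceDomain (Real.sqrt (α * β)), ∀ p,
      Summable (opExpTerm (s • mixedDeriv) f p) ∧
      deriv (fun σ : ℂ => opExp (σ • mixedDeriv) f p) s =
        mixedDeriv (fun q => opExp (s • mixedDeriv) f q) p := by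
  -- The scaling `a`, `b` depends on `s`, but the series does not, so the local integral
  -- representations suffice.
  have key : ∀ s ∈ convergenceDomain (Real.sqrt (α * β)), ∃ T a b : ℝ, s ∈ Metric.ball 0 T ∧
      a * b = 1 ∧ (α * (T * a) ^ 2 + β * b ^ 2) / 2 < 1 := by
    intro s hs
    have hc : ContinuousAt (fun ε : ℝ => (‖s‖ + ε) * Real.sqrt (α * β)) 0 := by fun_prop
    have h := hc.eventually_lt_const (u := 1)
      (by simpa using (show ‖s‖ * Real.sqrt (α * β) < 1 from hs))
    obtain ⟨ε, h1, h2⟩ := ((h.filter_mono nhdsWithin_le_nhds).and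
      (self_mem_nhdsWithin (s := Set.Ioi (0 : ℝ)))).exists
    have h2' : 0 < ε := h2
    obtain ⟨a, b, hab, hm⟩ := exists_scaling hα hβ (T := ‖s‖ + ε) (by positivity) h1
    exact ⟨_, a, b, by simpa using h2', hab, hm⟩
  constructor
  · rintro ⟨s, p⟩ hx
    obtain ⟨T, a, b, hs, hab, hm⟩ := key s hx.1
    have hΩ := (isOpen_prod_univ (S := Metric.ball 0 T) Metric.isOpen_ball).mem_nhds
      (mem_prod_univ hs p)
    refine (((differentiableOn_heatIntegral hf hα hβ hm).differentiableAt
      hΩ).congr_of_eventuallyEq ?_).differentiableWithinAt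
    filter_upwards [hΩ] with x hx
    exact (hasSum_heatIntegral hf hα hβ hab hm hx.1 x.2).tsum_eq
  · intro s hs p
    obtain ⟨T, a, b, hs, hab, hm⟩ := key s hs
    have hsum : ∀ {s : ℂ}, s ∈ Metric.ball (0 : ℂ) T → ∀ p,
        HasSum (opExpTerm (s • mixedDeriv) f p) (heatIntegral a b f (s, p)) := fun hs p =>
      hasSum_heatIntegral hf hα hβ hab hm hs p
    refine ⟨(hsum hs p).summable, ?_⟩
    have h1 : (fun σ : ℂ => opExp (σ • mixedDeriv) f p) =ᶠ[𝓝 s]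
        fun σ => heatIntegral a b f (σ, p) := by
      filter_upwards [Metric.isOpen_ball.mem_nhds hs] with σ hσ using (hsum hσ p).tsum_eq
    have h2 : (fun q => opExp (s • mixedDeriv) f q) = fun q => heatIntegral a b f (s, q) :=
      funext fun q => (hsum hs q).tsum_eq
    rw [h1.deriv_eq, h2, deriv_heatIntegral hf hα hβ hab hm hs p]

/-! ### Gaussian transforms of solutions of the heat equation, two variables -/

/-- The parameters `s` for which `s r / (r + s)` is defined and lies in `U`. -/
def timeDomain (r : ℂ) (U : Set ℂ) : Set ℂ := {s | r + s ≠ 0 ∧ s * r / (r + s) ∈ U}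

lemma isOpen_timeDomain (r : ℂ) {U : Set ℂ} (hU : IsOpen U) : IsOpen (timeDomain r U) := by
  have h1 : IsOpen {s : ℂ | r + s ≠ 0} := isOpen_ne_fun (by fun_prop) continuous_const
  have h2 : ContinuousOn (fun s : ℂ => s * r / (r + s)) {s : ℂ | r + s ≠ 0} :=
    ContinuousOn.div (by fun_prop) (by fun_prop) fun s hs => hs
  exact h2.isOpen_inter_preimage h1 hU

lemma zero_mem_timeDomain {r : ℂ} (hr : r ≠ 0) {U : Set ℂ} (hU : 0 ∈ U) : 0 ∈ timeDomain r U := by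
  refine ⟨by simpa using hr, by simpa using hU⟩

/-- The time and the place at which `gaussTransform₂` evaluates. -/
noncomputable def gaussPath₂ (r : ℂ) (c : ℂ × ℂ) (x : ℂ × (ℂ × ℂ)) : ℂ × (ℂ × ℂ) :=
  (x.1 * r / (r + x.1),
    ((r * x.2.1 + x.1 * c.1) / (r + x.1), (r * x.2.2 + x.1 * c.2) / (r + x.1)))

/-- The transform `r/(r+s) exp(-(z-z₀)(z'-z₀')/(r+s)) E(s r/(r+s), q)` with
`q = ((r z + s z₀)/(r+s), (r z' + s z₀')/(r+s))`. -/
noncomputable def gaussTransform₂ (r : ℂ) (c : ℂ × ℂ) (E : ℂ × (ℂ × ℂ) → ℂ) (x : ℂ × (ℂ × ℂ)) : ℂ :=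
  r / (r + x.1) * gauss₂ (r + x.1) c x.2 * E (gaussPath₂ r c x)

section Transform₂

variable {r : ℂ} {c : ℂ × ℂ} {U : Set ℂ} {E K : ℂ × (ℂ × ℂ) → ℂ} {M : ℕ}

lemma differentiableAt_gaussFactor₂ {x : ℂ × (ℂ × ℂ)} (hx : r + x.1 ≠ 0) :
    DifferentiableAt ℂ (fun x : ℂ × (ℂ × ℂ) => r / (r + x.1) * gauss₂ (r + x.1) c x.2) x := by
  unfold gauss₂
  fun_prop (disch := exact hx)

lemma differentiableAt_gaussPath₂ {x : ℂ × (ℂ × ℂ)} (hx : r + x.1 ≠ 0) :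
    DifferentiableAt ℂ (gaussPath₂ r c) x := by
  unfold gaussPath₂
  fun_prop (disch := exact hx)

lemma gaussPath₂_mem {x : ℂ × (ℂ × ℂ)} (hx : x ∈ timeDomain r U ×ˢ (Set.univ : Set (ℂ × ℂ))) :
    gaussPath₂ r c x ∈ U ×ˢ (Set.univ : Set (ℂ × ℂ)) := ⟨hx.1.2, trivial⟩

lemma differentiableOn_gaussTransform₂ (hU : IsOpen U)
    (hE : DifferentiableOn ℂ E (U ×ˢ Set.univ)) :
    DifferentiableOn ℂ (gaussTransform₂ r c E) (timeDomain r U ×ˢ Set.univ) := fun x hx =>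
  ((differentiableAt_gaussFactor₂ hx.1.1).mul
    ((hE.differentiableAt ((isOpen_prod_univ hU).mem_nhds (gaussPath₂_mem hx))).comp x
      (differentiableAt_gaussPath₂ hx.1.1))).differentiableWithinAt

lemma hasDerivAt_gauss₂_snd (ρ : ℂ) (c : ℂ × ℂ) (z z' : ℂ) :
    HasDerivAt (fun w => gauss₂ ρ c (z, w)) (gauss₂ ρ c (z, z') * (-(z - c.1) / ρ)) z' := by
  unfold gauss₂
  refine HasDerivAt.cexp ?_
  have := ((((hasDerivAt_id z').sub_const c.2).const_mul (z - c.1)).neg).div_const ρ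
  simpa using this

lemma hasDerivAt_gauss₂_fst (ρ : ℂ) (c : ℂ × ℂ) (z z' : ℂ) :
    HasDerivAt (fun w => gauss₂ ρ c (w, z')) (gauss₂ ρ c (z, z') * (-(z' - c.2) / ρ)) z := by
  unfold gauss₂
  refine HasDerivAt.cexp ?_
  have := ((((hasDerivAt_id z).sub_const c.1).mul_const (z' - c.2)).neg).div_const ρ
  simpa using this

lemma hasDerivAt_const_div_const_add (b : ℂ) {s : ℂ} (hs : r + s ≠ 0) :
    HasDerivAt (fun σ => b / (r + σ)) (-b / (r + s) ^ 2) s := by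
  have := (hasDerivAt_const s b).div ((hasDerivAt_id s).const_add r) hs
  refine this.congr_deriv ?_
  simp

lemma hasDerivAt_mobius (b d : ℂ) {s : ℂ} (hs : r + s ≠ 0) :
    HasDerivAt (fun σ => (b + σ * d) / (r + σ)) ((r * d - b) / (r + s) ^ 2) s := by
  have := (((hasDerivAt_id s).mul_const d).const_add b).div ((hasDerivAt_id s).const_add r) hs
  refine this.congr_deriv ?_
  simp only [id]
  ring

lemma hasDerivAt_gaussFactor₂ (p : ℂ × ℂ) {s : ℂ} (hs : r + s ≠ 0) :
    HasDerivAt (fun σ => r / (r + σ) * gauss₂ (r + σ) c p)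
      (r / (r + s) * gauss₂ (r + s) c p *
        ((p.1 - c.1) * (p.2 - c.2) / (r + s) ^ 2 - 1 / (r + s))) s := by
  have h1 := hasDerivAt_const_div_const_add (r := r) r hs
  have h2 := (hasDerivAt_const_div_const_add (r := r) (-((p.1 - c.1) * (p.2 - c.2))) hs).cexp
  refine (h1.mul h2).congr_deriv ?_
  simp only [gauss₂]
  field_simp
  ring

/-- Product rule, arranged for comparison with `∂/∂s`: the zeroth-order term is the logarithmic
derivative of the prefactor, and the first-order coefficients are the velocities of the contracted
point. -/
lemma mixedDeriv_gaussTransform₂ (hU : IsOpen U) (hE : DifferentiableOn ℂ E (U ×ˢ Set.univ))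
    {s : ℂ} (hs : s ∈ timeDomain r U) (p : ℂ × ℂ) :
    mixedDeriv (fun q => gaussTransform₂ r c E (s, q)) p =
      r / (r + s) * gauss₂ (r + s) c p *
        (((p.1 - c.1) * (p.2 - c.2) / (r + s) ^ 2 - 1 / (r + s)) * E (gaussPath₂ r c (s, p)) -
          r * (p.1 - c.1) / (r + s) ^ 2 * fderiv ℂ E (gaussPath₂ r c (s, p)) (0, (1, 0)) -
          r * (p.2 - c.2) / (r + s) ^ 2 * fderiv ℂ E (gaussPath₂ r c (s, p)) (0, (0, 1)) +
          (r / (r + s)) ^ 2 *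
            mixedDeriv (fun q => E (s * r / (r + s), q)) (gaussPath₂ r c (s, p)).2) := by
  have hrs : r + s ≠ 0 := hs.1
  have hΩ := isOpen_prod_univ hU
  set E₂ : ℂ × (ℂ × ℂ) → ℂ := fun x => fderiv ℂ E x (0, (0, 1)) with hE₂
  have hE₂d : DifferentiableOn ℂ E₂ (U ×ˢ Set.univ) := differentiableOn_fderiv_apply hΩ hE _
  have hat : ∀ {F : ℂ × (ℂ × ℂ) → ℂ}, DifferentiableOn ℂ F (U ×ˢ Set.univ) → ∀ q,
      HasFDerivAt F (fderiv ℂ F (gaussPath₂ r c (s, q))) (gaussPath₂ r c (s, q)) := fun hF q =>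
    (hF.differentiableAt (hΩ.mem_nhds (gaussPath₂_mem (mem_prod_univ hs q)))).hasFDerivAt
  have hlin : ∀ d z : ℂ, HasDerivAt (fun w => (r * w + s * d) / (r + s)) (r / (r + s)) z := by
    intro d z
    have := (((hasDerivAt_id z).const_mul r).add_const (s * d)).div_const (r + s)
    simpa using this
  have hsnd : ∀ {F : ℂ × (ℂ × ℂ) → ℂ}, DifferentiableOn ℂ F (U ×ˢ Set.univ) → ∀ z z',
      HasDerivAt (fun w => F (gaussPath₂ r c (s, (z, w))))
        (r / (r + s) * fderiv ℂ F (gaussPath₂ r c (s, (z, z'))) (0, (0, 1))) z' := by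
    intro F hF z z'
    have h1 : HasDerivAt (fun w => gaussPath₂ r c (s, (z, w))) (0, (0, r / (r + s))) z' :=
      (hasDerivAt_const z' (s * r / (r + s))).prodMk
        ((hasDerivAt_const z' ((r * z + s * c.1) / (r + s))).prodMk (hlin c.2 z'))
    refine ((hat hF (z, z')).comp_hasDerivAt z' h1).congr_deriv ?_
    have : ((0, (0, r / (r + s))) : ℂ × (ℂ × ℂ)) = (r / (r + s)) • (0, (0, 1)) := by simp
    rw [this, map_smul, smul_eq_mul]
  have hfst : ∀ {F : ℂ × (ℂ × ℂ) → ℂ}, DifferentiableOn ℂ F (U ×ˢ Set.univ) → ∀ z z',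
      HasDerivAt (fun w => F (gaussPath₂ r c (s, (w, z'))))
        (r / (r + s) * fderiv ℂ F (gaussPath₂ r c (s, (z, z'))) (0, (1, 0))) z := by
    intro F hF z z'
    have h1 : HasDerivAt (fun w => gaussPath₂ r c (s, (w, z'))) (0, (r / (r + s), 0)) z :=
      (hasDerivAt_const z (s * r / (r + s))).prodMk
        ((hlin c.1 z).prodMk (hasDerivAt_const z ((r * z' + s * c.2) / (r + s))))
    refine ((hat hF (z, z')).comp_hasDerivAt z h1).congr_deriv ?_
    have : ((0, (r / (r + s), 0)) : ℂ × (ℂ × ℂ)) = (r / (r + s)) • (0, (1, 0)) := by simp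
    rw [this, map_smul, smul_eq_mul]
  have hinner : ∀ z, deriv (fun w => gaussTransform₂ r c E (s, (z, w))) p.2 =
      r / (r + s) * gauss₂ (r + s) c (z, p.2) *
        (-(z - c.1) / (r + s) * E (gaussPath₂ r c (s, (z, p.2))) +
          r / (r + s) * E₂ (gaussPath₂ r c (s, (z, p.2)))) := by
    intro z
    refine (HasDerivAt.deriv (((hasDerivAt_gauss₂_snd (r + s) c z p.2).const_mul
      (r / (r + s))).mul (hsnd hE z p.2))).trans ?_
    simp only [hE₂]
    ring
  have hD : mixedDeriv (fun q => E (s * r / (r + s), q)) (gaussPath₂ r c (s, p)).2 =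
      fderiv ℂ E₂ (gaussPath₂ r c (s, p)) (0, (1, 0)) :=
    mixedDeriv_slice hU hE hs.2 _
  rw [hD]
  simp only [mixedDeriv, hinner]
  have h1 : HasDerivAt (fun z => -(z - c.1) / (r + s)) (-1 / (r + s)) p.1 :=
    (((hasDerivAt_id p.1).sub_const c.1).neg).div_const (r + s)
  have h2 := ((hasDerivAt_gauss₂_fst (r + s) c p.1 p.2).const_mul (r / (r + s))).mul
    ((h1.mul (hfst hE p.1 p.2)).add ((hfst hE₂d p.1 p.2).const_mul (r / (r + s))))
  refine h2.deriv.trans ?_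
  simp only [Prod.mk.eta, Pi.add_apply, Pi.mul_apply]
  field_simp
  ring

/-- If `∂E/∂t = ∂²E/∂z∂z' - t ^ M K` then the Gaussian transform of `E` satisfies an equation of the
same kind. -/
theorem deriv_gaussTransform₂ (hU : IsOpen U) (hE : DifferentiableOn ℂ E (U ×ˢ Set.univ))
    (heat : ∀ t ∈ U, ∀ q, deriv (fun σ => E (σ, q)) t =
      mixedDeriv (fun q => E (t, q)) q - t ^ M * K (t, q))
    {s : ℂ} (hs : s ∈ timeDomain r U) (p : ℂ × ℂ) :
    deriv (fun σ => gaussTransform₂ r c E (σ, p)) s =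
      mixedDeriv (fun q => gaussTransform₂ r c E (s, q)) p -
        s ^ M * ((r / (r + s)) ^ (M + 2) * gaussTransform₂ r c K (s, p)) := by
  have hrs : r + s ≠ 0 := hs.1
  have hΩ := isOpen_prod_univ hU
  have hEat := hE.differentiableAt (hΩ.mem_nhds (gaussPath₂_mem (c := c) (mem_prod_univ hs p)))
  -- The time `sr/(r+s)` moves with speed `(r/(r+s))²`, the factor that `D` acquires from the
  -- contraction.
  have hpath : HasDerivAt (fun σ => gaussPath₂ r c (σ, p)) (r * r / (r + s) ^ 2,
      ((r * c.1 - r * p.1) / (r + s) ^ 2, (r * c.2 - r * p.2) / (r + s) ^ 2)) s := by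
    have h1 : HasDerivAt (fun σ => σ * r / (r + σ)) (r * r / (r + s) ^ 2) s := by
      simpa using hasDerivAt_mobius (r := r) 0 r hrs
    exact h1.prodMk ((hasDerivAt_mobius (r * p.1) c.1 hrs).prodMk
      (hasDerivAt_mobius (r * p.2) c.2 hrs))
  have hcomp := hEat.hasFDerivAt.comp_hasDerivAt s hpath
  have hvec : ((r * r / (r + s) ^ 2, ((r * c.1 - r * p.1) / (r + s) ^ 2,
      (r * c.2 - r * p.2) / (r + s) ^ 2)) : ℂ × (ℂ × ℂ)) =
      (r * r / (r + s) ^ 2) • (1, 0) + ((r * c.1 - r * p.1) / (r + s) ^ 2) • (0, (1, 0)) +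
        ((r * c.2 - r * p.2) / (r + s) ^ 2) • (0, (0, 1)) := by
    ext <;> simp
  have h0 : fderiv ℂ E (gaussPath₂ r c (s, p)) (1, 0) =
      mixedDeriv (fun q => E (s * r / (r + s), q)) (gaussPath₂ r c (s, p)).2 -
        (s * r / (r + s)) ^ M * K (gaussPath₂ r c (s, p)) := by
    rw [← deriv_time_eq_fderiv hEat]
    exact heat _ hs.2 _
  rw [hvec, map_add, map_add, map_smul, map_smul, map_smul, h0] at hcomp
  have h1 := (hasDerivAt_gaussFactor₂ (c := c) p hrs).mul hcomp
  refine h1.deriv.trans ?_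
  rw [mixedDeriv_gaussTransform₂ hU hE hs p]
  simp only [gaussTransform₂, smul_eq_mul, Function.comp]
  -- Together with the speed of the time this accounts for the exponent `M + 2`.
  have hp : (s * r / (r + s)) ^ M = s ^ M * (r / (r + s)) ^ M := by
    rw [← mul_pow]
    congr 1
    ring
  rw [hp, pow_add]
  generalize E (gaussPath₂ r c (s, p)) = e₀
  generalize K (gaussPath₂ r c (s, p)) = k₀
  generalize (r / (r + s)) ^ M = ρ
  generalize mixedDeriv (fun q => E (s * r / (r + s), q)) (gaussPath₂ r c (s, p)).2 = d₀
  generalize fderiv ℂ E (gaussPath₂ r c (s, p)) (0, (1, 0)) = e₁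
  generalize fderiv ℂ E (gaussPath₂ r c (s, p)) (0, (0, 1)) = e₂
  generalize r + s = R
  ring

end Transform₂

/-! ### The two-variable identities -/

section Two

variable {r : ℂ} {c : ℂ × ℂ} {f : ℂ × ℂ → ℂ}

lemma rightSide₂_eq (hr : r ≠ 0) {s : ℂ} (hrs : r + s ≠ 0) (p : ℂ × ℂ) :
    rightSide₂ r s c f p =
      gaussTransform₂ r c (fun x => opExp (x.1 • mixedDeriv) f x.2) (s, p) := by
  simp only [rightSide₂, gaussTransform₂, gaussPath₂]
  congr 1
  exact tsum_congr fun k => opExpTerm_contract₂ hr hrs c f p k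

lemma rightSide₂_zero (hr : r ≠ 0) : rightSide₂ r 0 c f = fun q => gauss₂ r c q * f q := by
  funext p
  simp only [rightSide₂, add_zero, zero_mul, zero_div, div_self hr, one_mul]
  rw [homogeneous_mixedDeriv.opExp_zero]
  simp only [contract₂, add_zero, zero_mul, mul_div_cancel_left₀ _ hr]

lemma gaussTransform₂_zero (hr : r ≠ 0) {E : ℂ × (ℂ × ℂ) → ℂ} (p : ℂ × ℂ) :
    gaussTransform₂ r c E (0, p) = gauss₂ r c p * E (0, p) := by
  simp [gaussTransform₂, gaussPath₂, div_self hr, mul_div_cancel_left₀ _ hr]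

variable {α β : ℝ}

/-- Purely local in `s`: only the transform and the heat equation for `E` enter, so the parameter
may lie beyond the disc on which the left-hand series is controlled. -/
lemma rightSide₂_solution (hr : r ≠ 0) (hα : 0 ≤ α) (hβ : 0 ≤ β) (hf : GaussType₂ α β f) {s : ℂ}
    (hs : s ∈ timeDomain r (convergenceDomain (Real.sqrt (α * β)))) :
    OpExpSummable ((s * (r + s) / r) • mixedDeriv) (contract₂ r s c f) ∧
    Differentiable ℂ (rightSide₂ r s c f) ∧
    ∀ p : ℂ × ℂ, HasDerivAt (fun σ => rightSide₂ r σ c f p)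
      (mixedDeriv (rightSide₂ r s c f) p) s := by
  obtain ⟨hE, hheat⟩ := hf.heat hα hβ
  have hU := isOpen_convergenceDomain (Real.sqrt (α * β))
  have hS := isOpen_timeDomain r hU
  have hd := differentiableOn_gaussTransform₂ (r := r) (c := c) hU hE
  have heq : rightSide₂ r s c f =
      fun p => gaussTransform₂ r c (fun x => opExp (x.1 • mixedDeriv) f x.2) (s, p) :=
    funext fun p => rightSide₂_eq hr hs.1 p
  refine ⟨fun p => ?_, ?_, fun p => ?_⟩
  · rw [show opExpTerm ((s * (r + s) / r) • mixedDeriv) (contract₂ r s c f) p = _ from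
      funext fun k => opExpTerm_contract₂ hr hs.1 c f p k]
    exact (hheat _ hs.2 _).1
  · rw [heq]
    exact differentiable_slice hS hd hs
  · have hev : (fun σ => rightSide₂ r σ c f p) =ᶠ[𝓝 s] fun σ =>
        gaussTransform₂ r c (fun x => opExp (x.1 • mixedDeriv) f x.2) (σ, p) := by
      filter_upwards [hS.mem_nhds hs] with σ hσ using rightSide₂_eq hr hσ.1 p
    -- `K = 0` is the case of an exact solution.
    have h1 := deriv_gaussTransform₂ (c := c) (K := 0) (M := 0) hU hE
      (fun t ht q => by simpa using (hheat t ht q).2) hs p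
    simp only [gaussTransform₂, Pi.zero_apply, mul_zero, sub_zero] at h1
    rw [heq]
    refine HasDerivAt.congr_of_eventuallyEq ?_ hev
    have h2 : DifferentiableAt ℂ (fun σ =>
        gaussTransform₂ r c (fun x => opExp (x.1 • mixedDeriv) f x.2) (σ, p)) s :=
      (hd.differentiableAt ((isOpen_prod_univ hS).mem_nhds (mem_prod_univ hs p))).comp s
        (f := fun σ => (σ, p)) (by fun_prop)
    exact h2.hasDerivAt.congr_deriv h1

/-- Multiplied by `|r|`, the condition on `s` reads `|sr| κ < |r| - |s|`, and `|r| - |s| ≤ |r + s|`.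
-/
lemma ball_subset_timeDomain (hr : r ≠ 0) {κ : ℝ} (hκ : 0 ≤ κ) :
    Metric.ball 0 (κ + 1 / ‖r‖)⁻¹ ⊆ timeDomain r (convergenceDomain κ) := by
  intro s hs
  have hr0 : 0 < ‖r‖ := norm_pos_iff.2 hr
  rw [mem_ball_zero_iff, ← one_div, lt_div_iff₀ (by positivity)] at hs
  have h1 : ‖s‖ * κ * ‖r‖ + ‖s‖ < ‖r‖ := by
    have h := mul_lt_mul_of_pos_right hs hr0
    have : ‖s‖ * (κ + 1 / ‖r‖) * ‖r‖ = ‖s‖ * κ * ‖r‖ + ‖s‖ := by field_simp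
    linarith
  have h2 : ‖r‖ - ‖s‖ ≤ ‖r + s‖ := by simpa using norm_sub_norm_le r (-s)
  have h3 : 0 ≤ ‖s‖ * κ * ‖r‖ := by positivity
  have h4 : 0 < ‖r + s‖ := by linarith
  refine ⟨norm_pos_iff.1 h4, ?_⟩
  change ‖s * r / (r + s)‖ * κ < 1
  rw [norm_div, norm_mul, div_mul_eq_mul_div, div_lt_one h4]
  linarith

/-- The exponential series of the left-hand side converges to the right-hand side. -/
theorem hasSum_gauss_mul₂ (hr : r ≠ 0) (hα : 0 ≤ α) (hβ : 0 ≤ β) (hf : GaussType₂ α β f) {s : ℂ}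
    (hs : ‖s‖ * (Real.sqrt (α * β) + 1 / ‖r‖) < 1) (p : ℂ × ℂ) :
    HasSum (opExpTerm (s • mixedDeriv) (fun q => gauss₂ r c q * f q) p)
      (rightSide₂ r s c f p) := by
  obtain ⟨hE, hheat⟩ := hf.heat hα hβ
  have hU := isOpen_convergenceDomain (Real.sqrt (α * β))
  have hsub := ball_subset_timeDomain hr (Real.sqrt_nonneg (α * β))
  have hr0 : 0 < ‖r‖ := norm_pos_iff.2 hr
  have hs' : s ∈ Metric.ball 0 (Real.sqrt (α * β) + 1 / ‖r‖)⁻¹ := by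
    rw [mem_ball_zero_iff, ← one_div, lt_div_iff₀ (by positivity)]
    exact hs
  have hd := differentiableOn_gaussTransform₂ (r := r) (c := c) hU hE
  -- The transform is a holomorphic solution on the disc whose value at `s = 0` is the Gaussian
  -- times `f`.
  have h := hasSum_opExpTerm_of_heat (hd.mono (Set.prod_mono hsub subset_rfl))
    (fun s hs p => by
      have h1 := deriv_gaussTransform₂ (c := c) (K := 0) (M := 0) hU hE
        (fun t ht q => by simpa using (hheat t ht q).2) (hsub hs) p
      simpa [gaussTransform₂] using h1) hs' p
  rw [rightSide₂_eq hr (hsub hs').1]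
  simp only [gaussTransform₂_zero hr, homogeneous_mixedDeriv.opExp_zero] at h
  exact h

end Two

/-! ### Truncated exponential series -/

lemma isBigO_taylor_sub {g : ℂ → ℂ} (hg : AnalyticAt ℂ g 0) (N : ℕ) :
    (fun s : ℂ => (∑ k ∈ Finset.range N, (k.factorial : ℂ)⁻¹ * (s ^ k * iteratedDeriv k g 0)) -
      g s) =O[𝓝 0] fun s : ℂ => s ^ N := by
  have h := hg.hasFPowerSeriesAt.isBigO_sub_partialSum_pow N
  rw [← isBigO_neg_left]
  refine (h.congr (fun s => ?_) (fun s => rfl)).trans (isBigO_of_le _ fun s => by simp)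
  simp only [zero_add, FormalMultilinearSeries.partialSum, neg_sub]
  congr 1
  refine Finset.sum_congr rfl fun k _ => ?_
  rw [FormalMultilinearSeries.ofScalars_apply_eq, smul_eq_mul]
  ring

lemma mixedDeriv_add {f g : ℂ × ℂ → ℂ} (hf : Differentiable ℂ f) (hg : Differentiable ℂ g) :
    mixedDeriv (fun p => f p + g p) = fun p => mixedDeriv f p + mixedDeriv g p := by
  have hf' := differentiable_fderiv_apply hf (0, 1)
  have hg' := differentiable_fderiv_apply hg (0, 1)
  rw [mixedDeriv_eq_fderiv (f := fun p => f p + g p) (hf.add hg), mixedDeriv_eq_fderiv hf, mixedDeriv_eq_fderiv hg]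
  funext p
  have h1 : (fun q => fderiv ℂ (fun p => f p + g p) q (0, 1)) =
      fun q => fderiv ℂ f q (0, 1) + fderiv ℂ g q (0, 1) := by
    funext q
    rw [fderiv_fun_add (hf q) (hg q)]
    rfl
  simp only [h1]
  rw [fderiv_fun_add (hf' p) (hg' p)]
  rfl

/-- The partial sum of the first `N` terms of the exponential series of `t ∂²/∂z∂z'`. -/
noncomputable def truncExp₂ (N : ℕ) (f : ℂ × ℂ → ℂ) (x : ℂ × (ℂ × ℂ)) : ℂ :=
  ∑ k ∈ Finset.range N, opExpTerm (x.1 • mixedDeriv) f x.2 k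

section Trunc₂

variable {f : ℂ × ℂ → ℂ}

lemma differentiable_opExpTerm₂ (hf : Differentiable ℂ f) (k : ℕ) :
    Differentiable ℂ (fun x : ℂ × (ℂ × ℂ) => opExpTerm (x.1 • mixedDeriv) f x.2 k) := by
  simp only [homogeneous_mixedDeriv.opExpTerm_smul]
  have := differentiable_mixedDeriv_iterate hf k
  fun_prop

lemma differentiable_truncExp₂ (hf : Differentiable ℂ f) (N : ℕ) :
    Differentiable ℂ (truncExp₂ N f) :=
  Differentiable.fun_sum fun k _ => differentiable_opExpTerm₂ hf k

lemma truncExp₂_zero (M : ℕ) (q : ℂ × ℂ) : truncExp₂ (M + 1) f (0, q) = f q := by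
  simp only [truncExp₂, homogeneous_mixedDeriv.opExpTerm_smul, Finset.sum_range_succ']
  simp

/-- `∂/∂t` lowers the index of each term and loses the lowest one, while `D` keeps all `M + 1`
terms; the difference is the single term `t^M D^(M+1) f / M!`. -/
lemma deriv_truncExp₂ (hf : Differentiable ℂ f) (M : ℕ) (t : ℂ) (q : ℂ × ℂ) :
    deriv (fun σ => truncExp₂ (M + 1) f (σ, q)) t =
      mixedDeriv (fun q => truncExp₂ (M + 1) f (t, q)) q -
        t ^ M * ((M.factorial : ℂ)⁻¹ * (mixedDeriv^[M + 1] f) q) := by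
  induction M with
  | zero => simp [truncExp₂, opExpTerm]
  | succ M ih =>
    have hs : ∀ x, truncExp₂ (M + 1 + 1) f x = truncExp₂ (M + 1) f x +
        opExpTerm (x.1 • mixedDeriv) f x.2 (M + 1) := fun x => Finset.sum_range_succ _ _
    simp only [hs]
    have hd := differentiable_truncExp₂ hf (M + 1)
    have ht := differentiable_opExpTerm₂ hf (M + 1)
    have hsl : ∀ {F : ℂ × (ℂ × ℂ) → ℂ}, Differentiable ℂ F → Differentiable ℂ fun q => F (t, q) :=
      fun hF => hF.comp (by fun_prop)
    have h4 : DifferentiableAt ℂ (fun σ => truncExp₂ (M + 1) f (σ, q)) t :=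
      DifferentiableAt.comp t (f := fun σ => (σ, q)) (hd _) (by fun_prop)
    have h5 : DifferentiableAt ℂ (fun σ : ℂ => opExpTerm (σ • mixedDeriv) f q (M + 1)) t :=
      DifferentiableAt.comp t (f := fun σ => (σ, q)) (ht _) (by fun_prop)
    rw [mixedDeriv_add (hsl hd) (hsl ht), deriv_fun_add h4 h5, ih]
    simp only [homogeneous_mixedDeriv.opExpTerm_smul]
    have h1 : mixedDeriv (fun q => ((M + 1).factorial : ℂ)⁻¹ *
        (t ^ (M + 1) * (mixedDeriv^[M + 1] f) q)) q =
        ((M + 1).factorial : ℂ)⁻¹ * (t ^ (M + 1) * (mixedDeriv^[M + 1 + 1] f) q) := by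
      rw [Function.iterate_succ_apply' _ (M + 1), ← mul_assoc]
      have := congrFun (homogeneous_mixedDeriv (((M + 1).factorial : ℂ)⁻¹ * t ^ (M + 1))
        (mixedDeriv^[M + 1] f)) q
      refine Eq.trans ?_ this
      congr 1
      funext q
      simp only [Pi.smul_apply, smul_eq_mul]
      ring
    rw [h1, deriv_const_mul_field, deriv_mul_const_field, deriv_pow_field, Nat.factorial_succ]
    push_cast
    have h2 : ((M : ℂ) + 1) ≠ 0 := Nat.cast_add_one_ne_zero M
    have h3 : (M.factorial : ℂ) ≠ 0 := Nat.cast_ne_zero.2 (Nat.factorial_ne_zero M)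
    field_simp
    ring

/-- Without growth conditions the truncated series, a polynomial in `t`, replaces `E`. Its transform
has an error of order `s^M`, so its Taylor coefficients up to order `M` are the left-hand terms, and
the Taylor remainder is `O(s^(M+1))`. -/
theorem isBigO_trunc₂ {r : ℂ} (c : ℂ × ℂ) (hr : r ≠ 0) (hf : Differentiable ℂ f) (p : ℂ × ℂ)
    (N : ℕ) :
    (fun s : ℂ =>
      (∑ k ∈ Finset.range N, opExpTerm (s • mixedDeriv) (fun q => gauss₂ r c q * f q) p k) -
        r / (r + s) * gauss₂ (r + s) c p *
          ∑ k ∈ Finset.range N,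
            opExpTerm ((s * (r + s) / r) • mixedDeriv) (contract₂ r s c f) p k)
      =O[𝓝 0] fun s : ℂ => s ^ N := by
  rcases N with - | M
  · simp only [Finset.range_zero, Finset.sum_empty, mul_zero, sub_zero]
    exact isBigO_zero _ _
  set K : ℂ × (ℂ × ℂ) → ℂ := fun x => (M.factorial : ℂ)⁻¹ * (mixedDeriv^[M + 1] f) x.2 with hK
  have hKd : Differentiable ℂ K := by
    have := differentiable_mixedDeriv_iterate hf (M + 1)
    rw [hK]
    fun_prop
  have hE := (differentiable_truncExp₂ hf (M + 1)).differentiableOn (s := Set.univ ×ˢ Set.univ)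
  have hS := isOpen_timeDomain r isOpen_univ
  have h0 : (0 : ℂ) ∈ timeDomain r Set.univ := zero_mem_timeDomain hr trivial
  set u := gaussTransform₂ r c (truncExp₂ (M + 1) f) with hu
  have hud : DifferentiableOn ℂ u (timeDomain r Set.univ ×ˢ Set.univ) :=
    differentiableOn_gaussTransform₂ isOpen_univ hE
  have hHd : DifferentiableOn ℂ (fun x => (r / (r + x.1)) ^ (M + 2) * gaussTransform₂ r c K x)
      (timeDomain r Set.univ ×ˢ Set.univ) := by
    have h1 : DifferentiableOn ℂ (fun x : ℂ × (ℂ × ℂ) => r / (r + x.1))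
        (timeDomain r Set.univ ×ˢ Set.univ) := fun x hx => by
      have h2 : r + x.1 ≠ 0 := hx.1.1
      exact DifferentiableAt.differentiableWithinAt (by fun_prop (disch := exact h2))
    exact (h1.pow _).mul (differentiableOn_gaussTransform₂ isOpen_univ hKd.differentiableOn)
  have hder : ∀ k ≤ M, iteratedDeriv k (fun σ => u (σ, p)) 0 =
      (mixedDeriv^[k] (fun q => gauss₂ r c q * f q)) p := by
    intro k hk
    rw [iteratedDeriv_eq_mixedDeriv_iterate hS h0 hk hud hHd
      (fun s hs p => deriv_gaussTransform₂ isOpen_univ hE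
        (fun t _ q => deriv_truncExp₂ hf M t q) hs p)]
    refine congrArg (fun g => (mixedDeriv^[k] g) p) (funext fun q => ?_)
    rw [hu, gaussTransform₂_zero hr, truncExp₂_zero]
  have han : AnalyticAt ℂ (fun σ => u (σ, p)) 0 := by
    refine DifferentiableOn.analyticAt (s := timeDomain r Set.univ) (fun s hs => ?_)
      (hS.mem_nhds h0)
    exact (DifferentiableAt.comp s (f := fun σ => (σ, p)) (hud.differentiableAt
      ((isOpen_prod_univ hS).mem_nhds (mem_prod_univ hs p)))
      (by fun_prop)).differentiableWithinAt
  refine (isBigO_taylor_sub han (M + 1)).congr' ?_ EventuallyEq.rfl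
  filter_upwards [hS.mem_nhds h0] with s hs
  congr 1
  · refine Finset.sum_congr rfl fun k hk => ?_
    rw [homogeneous_mixedDeriv.opExpTerm_smul, hder k (Nat.lt_succ_iff.1 (Finset.mem_range.1 hk))]
  · simp only [hu, gaussTransform₂, gaussPath₂, truncExp₂]
    congr 1
    exact Finset.sum_congr rfl fun k _ => (opExpTerm_contract₂ hr hs.1 c f p k).symm

end Trunc₂

/-! ### Functions of one variable as functions of the mean of two variables -/

/-- The mean `(z + z') / 2`. -/
noncomputable def avg (p : ℂ × ℂ) : ℂ := (p.1 + p.2) / 2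

lemma differentiable_avg : Differentiable ℂ avg := by
  unfold avg
  fun_prop

lemma avg_diag (x : ℂ) : avg (x, x) = x := by
  simp [avg]

/-- Both `∂/∂z` and `∂/∂z'` act as half of `d/dx`, for an arbitrary `g`. This is what transfers the
heat equation to one variable. -/
lemma mixedDeriv_comp_avg (g : ℂ → ℂ) :
    mixedDeriv (fun p => g (avg p)) = (1 / 4 : ℂ) • fun p => secondDeriv g (avg p) := by
  have h1 : ∀ (g : ℂ → ℂ) (z w : ℂ), deriv (fun z' => g ((w + z') / 2)) z =
      1 / 2 * deriv g ((w + z) / 2) := fun g z w => by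
    have h := deriv_comp_affine g (1 / 2) (w / 2) z
    rw [show 1 / 2 * z + w / 2 = (w + z) / 2 by ring] at h
    rw [← h]
    congr 1
    funext z'
    congr 1
    ring
  funext p
  simp only [mixedDeriv, avg, h1, Pi.smul_apply, smul_eq_mul, secondDeriv, deriv_const_mul_field]
  have h2 := h1 (deriv g) p.1 p.2
  simp only [add_comm p.2] at h2
  rw [h2]
  ring

lemma mixedDeriv_iterate_comp_avg (g : ℂ → ℂ) (k : ℕ) :
    mixedDeriv^[k] (fun p => g (avg p)) =
      (1 / 4 : ℂ) ^ k • fun p => (secondDeriv^[k] g) (avg p) := by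
  induction k with
  | zero => simp
  | succ k ih =>
    rw [Function.iterate_succ_apply', ih, homogeneous_mixedDeriv, mixedDeriv_comp_avg,
      Function.iterate_succ_apply', smul_smul, pow_succ]

lemma opExpTerm_comp_avg (t : ℂ) (g : ℂ → ℂ) (p : ℂ × ℂ) (k : ℕ) :
    opExpTerm (t • mixedDeriv) (fun p => g (avg p)) p k =
      opExpTerm ((t / 4) • secondDeriv) g (avg p) k := by
  rw [homogeneous_mixedDeriv.opExpTerm_smul, homogeneous_secondDeriv.opExpTerm_smul,
    mixedDeriv_iterate_comp_avg]
  simp only [Pi.smul_apply, smul_eq_mul, div_pow, one_pow]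
  ring

lemma opExp_comp_avg (t : ℂ) (g : ℂ → ℂ) (p : ℂ × ℂ) :
    opExp (t • mixedDeriv) (fun p => g (avg p)) p = opExp ((t / 4) • secondDeriv) g (avg p) :=
  tsum_congr fun k => opExpTerm_comp_avg t g p k

/-- Convexity: `|(z + z')/2|² ≤ (|z|² + |z'|²)/2`. The lifted convergence threshold `√(a·a)` is `a`,
so nothing is lost. -/
lemma GaussType₁.comp_avg {a : ℝ} {g : ℂ → ℂ} (hg : GaussType₁ a g) (ha : 0 ≤ a) :
    GaussType₂ a a (fun p => g (avg p)) := by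
  obtain ⟨hd, C, hC⟩ := hg
  have hC0 : 0 ≤ C := by
    have := (norm_nonneg _).trans (hC 0)
    exact nonneg_of_mul_nonneg_left this (Real.exp_pos _)
  refine ⟨hd.comp differentiable_avg, C, fun p => (hC _).trans ?_⟩
  have h1 : ‖avg p‖ ≤ (‖p.1‖ + ‖p.2‖) / 2 := by
    rw [avg, norm_div]
    simp only [Complex.norm_ofNat]
    have := norm_add_le p.1 p.2
    gcongr
  have h2 : ‖avg p‖ ^ 2 ≤ (‖p.1‖ ^ 2 + ‖p.2‖ ^ 2) / 2 := by
    refine (pow_le_pow_left₀ (norm_nonneg _) h1 2).trans ?_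
    nlinarith [sq_nonneg (‖p.1‖ - ‖p.2‖)]
  refine mul_le_mul_of_nonneg_left (Real.exp_le_exp.2 ?_) hC0
  have := mul_le_mul_of_nonneg_left h2 ha
  linarith

section Heat₁

variable {S : Set ℂ} {u H : ℂ × ℂ → ℂ}

lemma differentiableOn_lift (hu : DifferentiableOn ℂ u (S ×ˢ Set.univ)) :
    DifferentiableOn ℂ (fun x : ℂ × (ℂ × ℂ) => u (x.1, avg x.2)) (S ×ˢ Set.univ) := by
  have := differentiable_avg
  exact hu.comp (f := fun x : ℂ × (ℂ × ℂ) => (x.1, avg x.2)) (by fun_prop)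
    fun x hx => ⟨hx.1, trivial⟩

/-- Restriction to the diagonal undoes the lift. -/
lemma differentiableOn_of_lift
    (hu : DifferentiableOn ℂ (fun x : ℂ × (ℂ × ℂ) => u (x.1, avg x.2)) (S ×ˢ Set.univ)) :
    DifferentiableOn ℂ u (S ×ˢ Set.univ) := by
  have h := hu.comp (s := S ×ˢ Set.univ) (f := fun x : ℂ × ℂ => (x.1, (x.2, x.2))) (by fun_prop)
    fun x hx => ⟨hx.1, trivial⟩
  refine h.congr fun x _ => ?_
  simp [avg_diag]

lemma mem_prod_univ₁ {s : ℂ} (hs : s ∈ S) (x : ℂ) : (s, x) ∈ S ×ˢ (Set.univ : Set ℂ) :=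
  ⟨hs, trivial⟩

lemma differentiable_slice₁ (hS : IsOpen S) (hu : DifferentiableOn ℂ u (S ×ˢ Set.univ)) {s : ℂ}
    (hs : s ∈ S) : Differentiable ℂ (fun x => u (s, x)) := fun x =>
  (hu.differentiableAt ((hS.prod isOpen_univ).mem_nhds (mem_prod_univ₁ hs x))).comp x
    (by fun_prop)

lemma differentiableAt_time₁ (hS : IsOpen S) (hu : DifferentiableOn ℂ u (S ×ˢ Set.univ)) {s : ℂ}
    (hs : s ∈ S) (x : ℂ) : DifferentiableAt ℂ (fun σ => u (σ, x)) s :=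
  (hu.differentiableAt ((hS.prod isOpen_univ).mem_nhds (mem_prod_univ₁ hs x))).comp s
    (f := fun σ => (σ, x)) (by fun_prop)

lemma heat_lift {M : ℕ} (heat : ∀ s ∈ S, ∀ x, deriv (fun σ => u (σ, x)) s =
      1 / 4 * secondDeriv (fun y => u (s, y)) x - s ^ M * H (s, x)) :
    ∀ s ∈ S, ∀ p : ℂ × ℂ, deriv (fun σ => u (σ, avg p)) s =
      mixedDeriv (fun q => u (s, avg q)) p - s ^ M * H (s, avg p) := fun s hs p => by
  rw [heat s hs, mixedDeriv_comp_avg (fun x => u (s, x))]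
  rfl

theorem iteratedDeriv_eq_secondDeriv_iterate (hS : IsOpen S) (h0 : 0 ∈ S) {k M : ℕ} (hkM : k ≤ M)
    (hu : DifferentiableOn ℂ u (S ×ˢ Set.univ)) (hH : DifferentiableOn ℂ H (S ×ˢ Set.univ))
    (heat : ∀ s ∈ S, ∀ x, deriv (fun σ => u (σ, x)) s =
      1 / 4 * secondDeriv (fun y => u (s, y)) x - s ^ M * H (s, x)) (x : ℂ) :
    iteratedDeriv k (fun σ => u (σ, x)) 0 =
      (1 / 4) ^ k * (secondDeriv^[k] (fun y => u (0, y))) x := by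
  have h := iteratedDeriv_eq_mixedDeriv_iterate hS h0 hkM (differentiableOn_lift hu)
    (differentiableOn_lift hH) (heat_lift heat) (x, x)
  rw [mixedDeriv_iterate_comp_avg (fun y => u (0, y))] at h
  simpa [avg_diag] using h

theorem hasSum_opExpTerm_of_heat₁ {ρ : ℝ}
    (hu : DifferentiableOn ℂ u (Metric.ball 0 ρ ×ˢ Set.univ))
    (heat : ∀ s ∈ Metric.ball 0 ρ, ∀ x, deriv (fun σ => u (σ, x)) s =
      1 / 4 * secondDeriv (fun y => u (s, y)) x) {s : ℂ} (hs : s ∈ Metric.ball 0 ρ) (x : ℂ) :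
    HasSum (opExpTerm ((s / 4) • secondDeriv) (fun y => u (0, y)) x) (u (s, x)) := by
  have h := hasSum_opExpTerm_of_heat (differentiableOn_lift hu)
    (fun s hs p => by
      simpa using heat_lift (M := 0) (H := 0) (fun s hs x => by simpa using heat s hs x) s hs p)
    hs (x, x)
  rw [show opExpTerm (s • mixedDeriv) (fun q : ℂ × ℂ => u (0, avg q)) (x, x) = _ from
    funext fun k => opExpTerm_comp_avg s (fun y => u (0, y)) (x, x) k] at h
  simpa only [avg_diag] using h

end Heat₁

theorem GaussType₁.heat {a : ℝ} {f : ℂ → ℂ} (hf : GaussType₁ a f) (ha : 0 ≤ a) :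
    DifferentiableOn ℂ (fun x : ℂ × ℂ => opExp ((x.1 / 4) • secondDeriv) f x.2)
      (convergenceDomain a ×ˢ Set.univ) ∧
    ∀ s ∈ convergenceDomain a, ∀ x, Summable (opExpTerm ((s / 4) • secondDeriv) f x) ∧
      deriv (fun σ : ℂ => opExp ((σ / 4) • secondDeriv) f x) s =
        1 / 4 * secondDeriv (fun y => opExp ((s / 4) • secondDeriv) f y) x := by
  obtain ⟨h1, h2⟩ := (hf.comp_avg ha).heat ha ha
  rw [Real.sqrt_mul_self ha] at h1 h2
  simp only [opExp_comp_avg] at h1 h2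
  refine ⟨differentiableOn_of_lift h1, fun s hs x => ?_⟩
  obtain ⟨h3, h4⟩ := h2 s hs (x, x)
  rw [show opExpTerm (s • mixedDeriv) (fun p => f (avg p)) (x, x) = _ from
    funext fun k => opExpTerm_comp_avg s f (x, x) k] at h3
  rw [mixedDeriv_comp_avg (fun y => opExp ((s / 4) • secondDeriv) f y)] at h4
  simp only [avg_diag, Pi.smul_apply, smul_eq_mul] at h3 h4
  exact ⟨h3, h4⟩

/-! ### Gaussian transforms of solutions of the heat equation, one variable -/

/-- The parameters in `timeDomain r U` for which the principal square root of `r / (r + s)` is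
holomorphic. -/
def timeDomain₁ (r : ℂ) (U : Set ℂ) : Set ℂ := {s | s ∈ timeDomain r U ∧ r / (r + s) ∈ slitPlane}

lemma isOpen_timeDomain₁ (r : ℂ) {U : Set ℂ} (hU : IsOpen U) : IsOpen (timeDomain₁ r U) := by
  have h2 : ContinuousOn (fun s : ℂ => r / (r + s)) (timeDomain r U) :=
    ContinuousOn.div (by fun_prop) (by fun_prop) fun s hs => hs.1
  exact h2.isOpen_inter_preimage (isOpen_timeDomain r hU) isOpen_slitPlane

lemma zero_mem_timeDomain₁ {r : ℂ} (hr : r ≠ 0) {U : Set ℂ} (hU : 0 ∈ U) :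
    0 ∈ timeDomain₁ r U :=
  ⟨zero_mem_timeDomain hr hU, by simp [div_self hr]⟩

/-- The time and the place at which `gaussTransform₁` evaluates. -/
noncomputable def gaussPath₁ (r c : ℂ) (x : ℂ × ℂ) : ℂ × ℂ :=
  (x.1 * r / (r + x.1), (r * x.2 + x.1 * c) / (r + x.1))

/-- The transform `√(r/(r+s)) exp(-(x-x₀)²/(r+s)) E(s r/(r+s), (r x + s x₀)/(r+s))`. -/
noncomputable def gaussTransform₁ (r c : ℂ) (E : ℂ × ℂ → ℂ) (x : ℂ × ℂ) : ℂ :=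
  (r / (r + x.1)) ^ (1 / 2 : ℂ) * gauss₁ (r + x.1) c x.2 * E (gaussPath₁ r c x)

section Transform₁

variable {r c : ℂ} {U : Set ℂ} {E K : ℂ × ℂ → ℂ} {M : ℕ}

lemma differentiableAt_gaussPath₁ {x : ℂ × ℂ} (hx : r + x.1 ≠ 0) :
    DifferentiableAt ℂ (gaussPath₁ r c) x := by
  unfold gaussPath₁
  fun_prop (disch := exact hx)

lemma gaussPath₁_mem {x : ℂ × ℂ} (hx : x ∈ timeDomain₁ r U ×ˢ (Set.univ : Set ℂ)) :
    gaussPath₁ r c x ∈ U ×ˢ (Set.univ : Set ℂ) := ⟨hx.1.1.2, trivial⟩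

lemma differentiableOn_gaussTransform₁ (hU : IsOpen U)
    (hE : DifferentiableOn ℂ E (U ×ˢ Set.univ)) :
    DifferentiableOn ℂ (gaussTransform₁ r c E) (timeDomain₁ r U ×ˢ Set.univ) := fun x hx => by
  have hrs : r + x.1 ≠ 0 := hx.1.1.1
  have h1 : DifferentiableAt ℂ (fun x : ℂ × ℂ => r / (r + x.1)) x := by
    fun_prop (disch := exact hrs)
  have h2 : DifferentiableAt ℂ (fun x : ℂ × ℂ => gauss₁ (r + x.1) c x.2) x := by
    unfold gauss₁
    fun_prop (disch := exact hrs)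
  exact (((h1.cpow_const hx.1.2).mul h2).mul
    ((hE.differentiableAt ((hU.prod isOpen_univ).mem_nhds (gaussPath₁_mem hx))).comp x
      (differentiableAt_gaussPath₁ hrs))).differentiableWithinAt

lemma hasDerivAt_gauss₁ (ρ c x : ℂ) :
    HasDerivAt (gauss₁ ρ c) (gauss₁ ρ c x * (-2 * (x - c) / ρ)) x := by
  unfold gauss₁
  refine HasDerivAt.cexp ?_
  have := ((((hasDerivAt_id x).sub_const c).pow 2).neg).div_const ρ
  refine this.congr_deriv ?_
  simp

/-- The square root halves the logarithmic derivative `-1/(r+s)` of `r/(r+s)`. The slit plane is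
where the principal branch is holomorphic. -/
lemma hasDerivAt_gaussFactor₁ (x : ℂ) {s : ℂ} (hs : r + s ≠ 0) (hsl : r / (r + s) ∈ slitPlane) :
    HasDerivAt (fun σ => (r / (r + σ)) ^ (1 / 2 : ℂ) * gauss₁ (r + σ) c x)
      ((r / (r + s)) ^ (1 / 2 : ℂ) * gauss₁ (r + s) c x *
        ((x - c) ^ 2 / (r + s) ^ 2 - 1 / 2 / (r + s))) s := by
  have h0 : r / (r + s) ≠ 0 := slitPlane_ne_zero hsl
  have hr : r ≠ 0 := fun h => h0 (by simp [h])
  have h1 := (hasDerivAt_const_div_const_add (r := r) r hs).cpow_const (c := (1 / 2 : ℂ)) hsl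
  have h2 := (hasDerivAt_const_div_const_add (r := r) (-(x - c) ^ 2) hs).cexp
  refine (h1.mul h2).congr_deriv ?_
  rw [cpow_sub _ _ h0, cpow_one]
  simp only [gauss₁]
  field_simp
  ring

lemma secondDeriv_gaussTransform₁ (hU : IsOpen U) (hE : DifferentiableOn ℂ E (U ×ˢ Set.univ))
    {s : ℂ} (hs : s ∈ timeDomain₁ r U) (x : ℂ) :
    secondDeriv (fun y => gaussTransform₁ r c E (s, y)) x =
      (r / (r + s)) ^ (1 / 2 : ℂ) * gauss₁ (r + s) c x *
        ((4 * (x - c) ^ 2 / (r + s) ^ 2 - 2 / (r + s)) * E (gaussPath₁ r c (s, x)) -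
          4 * r * (x - c) / (r + s) ^ 2 *
            deriv (fun y => E (s * r / (r + s), y)) (gaussPath₁ r c (s, x)).2 +
          (r / (r + s)) ^ 2 *
            secondDeriv (fun y => E (s * r / (r + s), y)) (gaussPath₁ r c (s, x)).2) := by
  have hrs : r + s ≠ 0 := hs.1.1
  set e : ℂ → ℂ := fun y => E (s * r / (r + s), y) with he
  have hed : Differentiable ℂ e := differentiable_slice₁ hU hE hs.1.2
  have hed' : Differentiable ℂ (deriv e) :=
    differentiableOn_univ.1 (hed.differentiableOn.deriv isOpen_univ)
  have hq : ∀ y, HasDerivAt (fun y => (r * y + s * c) / (r + s)) (r / (r + s)) y := by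
    intro y
    have := (((hasDerivAt_id y).const_mul r).add_const (s * c)).div_const (r + s)
    simpa using this
  set A : ℂ := (r / (r + s)) ^ (1 / 2 : ℂ) with hA
  have h1 : deriv (fun y => gaussTransform₁ r c E (s, y)) = fun y => A * gauss₁ (r + s) c y *
      (-2 * (y - c) / (r + s) * e ((r * y + s * c) / (r + s)) +
        r / (r + s) * deriv e ((r * y + s * c) / (r + s))) := by
    funext y
    refine (HasDerivAt.deriv (((hasDerivAt_gauss₁ (r + s) c y).const_mul A).mul
      ((hed _).hasDerivAt.comp y (hq y)))).trans ?_
    simp only [Function.comp]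
    ring
  have h2 : HasDerivAt (fun y => -2 * (y - c) / (r + s)) (-2 / (r + s)) x := by
    have := (((hasDerivAt_id x).sub_const c).const_mul (-2)).div_const (r + s)
    simpa using this
  have h3 := ((hasDerivAt_gauss₁ (r + s) c x).const_mul A).mul
    ((h2.mul ((hed _).hasDerivAt.comp x (hq x))).add
      (((hed' _).hasDerivAt.comp x (hq x)).const_mul (r / (r + s))))
  simp only [secondDeriv, h1]
  refine h3.deriv.trans ?_
  have h4 : E (gaussPath₁ r c (s, x)) = e ((r * x + s * c) / (r + s)) := rfl
  have h5 : (gaussPath₁ r c (s, x)).2 = (r * x + s * c) / (r + s) := rfl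
  rw [h4, h5]
  simp only [Function.comp, Pi.add_apply, Pi.mul_apply]
  generalize r + s = R
  ring

/-- The same cancellation as in two variables. It is not obtained by lifting, since `exp(-zz'/r)` is
not a function of the mean. -/
theorem deriv_gaussTransform₁ (hU : IsOpen U) (hE : DifferentiableOn ℂ E (U ×ˢ Set.univ))
    (heat : ∀ t ∈ U, ∀ y, deriv (fun σ => E (σ, y)) t =
      1 / 4 * secondDeriv (fun y => E (t, y)) y - t ^ M * K (t, y))
    {s : ℂ} (hs : s ∈ timeDomain₁ r U) (x : ℂ) :
    deriv (fun σ => gaussTransform₁ r c E (σ, x)) s =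
      1 / 4 * secondDeriv (fun y => gaussTransform₁ r c E (s, y)) x -
        s ^ M * ((r / (r + s)) ^ (M + 2) * gaussTransform₁ r c K (s, x)) := by
  have hrs : r + s ≠ 0 := hs.1.1
  have hEat := hE.differentiableAt ((hU.prod isOpen_univ).mem_nhds
    (gaussPath₁_mem (c := c) (mem_prod_univ₁ hs x)))
  have hpath : HasDerivAt (fun σ => gaussPath₁ r c (σ, x)) (r * r / (r + s) ^ 2,
      (r * c - r * x) / (r + s) ^ 2) s := by
    have h1 : HasDerivAt (fun σ => σ * r / (r + σ)) (r * r / (r + s) ^ 2) s := by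
      simpa using hasDerivAt_mobius (r := r) 0 r hrs
    exact h1.prodMk (hasDerivAt_mobius (r * x) c hrs)
  have hcomp := hEat.hasFDerivAt.comp_hasDerivAt s hpath
  have hvec : ((r * r / (r + s) ^ 2, (r * c - r * x) / (r + s) ^ 2) : ℂ × ℂ) =
      (r * r / (r + s) ^ 2) • (1, 0) + ((r * c - r * x) / (r + s) ^ 2) • (0, 1) := by
    ext <;> simp
  have h0 : fderiv ℂ E (gaussPath₁ r c (s, x)) (1, 0) =
      1 / 4 * secondDeriv (fun y => E (s * r / (r + s), y)) (gaussPath₁ r c (s, x)).2 -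
        (s * r / (r + s)) ^ M * K (gaussPath₁ r c (s, x)) := by
    rw [← deriv_fst_eq_fderiv hEat]
    exact heat _ hs.1.2 _
  rw [hvec, map_add, map_smul, map_smul, h0, ← deriv_snd_eq_fderiv hEat] at hcomp
  have h1 := (hasDerivAt_gaussFactor₁ (c := c) x hrs hs.2).mul hcomp
  refine h1.deriv.trans ?_
  rw [secondDeriv_gaussTransform₁ hU hE hs x]
  simp only [gaussTransform₁, smul_eq_mul, Function.comp]
  have hp : (s * r / (r + s)) ^ M = s ^ M * (r / (r + s)) ^ M := by
    rw [← mul_pow]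
    congr 1
    ring
  have h2 : (gaussPath₁ r c (s, x)).1 = s * r / (r + s) := rfl
  rw [hp, pow_add, h2]
  generalize E (gaussPath₁ r c (s, x)) = e₀
  generalize K (gaussPath₁ r c (s, x)) = k₀
  generalize (r / (r + s)) ^ M = ρ
  generalize secondDeriv (fun y => E (s * r / (r + s), y)) (gaussPath₁ r c (s, x)).2 = d₀
  generalize deriv (fun y => E (s * r / (r + s), y)) (gaussPath₁ r c (s, x)).2 = e₁
  generalize (r / (r + s)) ^ (1 / 2 : ℂ) = A
  generalize r + s = R
  ring

end Transform₁

/-! ### The one-variable identities -/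

section One

variable {r c : ℂ} {f : ℂ → ℂ}

lemma rightSide₁_eq (hr : r ≠ 0) {s : ℂ} (hrs : r + s ≠ 0) (x : ℂ) :
    rightSide₁ r s c f x =
      gaussTransform₁ r c (fun x => opExp ((x.1 / 4) • secondDeriv) f x.2) (s, x) := by
  simp only [rightSide₁, gaussTransform₁, gaussPath₁]
  congr 1
  exact tsum_congr fun k => opExpTerm_contract₁ hr hrs c f x k

lemma rightSide₁_zero (hr : r ≠ 0) : rightSide₁ r 0 c f = fun q => gauss₁ r c q * f q := by
  funext p
  simp only [rightSide₁, add_zero, zero_mul, zero_div, div_self hr, one_mul, one_cpow]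
  rw [homogeneous_secondDeriv.opExp_zero]
  simp only [contract₁, add_zero, zero_mul, mul_div_cancel_left₀ _ hr]

lemma gaussTransform₁_zero (hr : r ≠ 0) {E : ℂ × ℂ → ℂ} (x : ℂ) :
    gaussTransform₁ r c E (0, x) = gauss₁ r c x * E (0, x) := by
  simp [gaussTransform₁, gaussPath₁, div_self hr, mul_div_cancel_left₀ _ hr]

lemma rightSide₁_solution {a : ℝ} (hr : r ≠ 0) (ha : 0 ≤ a) (hf : GaussType₁ a f) {s : ℂ}
    (hs : s ∈ timeDomain₁ r (convergenceDomain a)) :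
    OpExpSummable ((s * (r + s) / (4 * r)) • secondDeriv) (contract₁ r s c f) ∧
    Differentiable ℂ (rightSide₁ r s c f) ∧
    ∀ x : ℂ, HasDerivAt (fun σ => rightSide₁ r σ c f x)
      (1 / 4 * secondDeriv (rightSide₁ r s c f) x) s := by
  obtain ⟨hE, hheat⟩ := hf.heat ha
  have hU := isOpen_convergenceDomain a
  have hS := isOpen_timeDomain₁ r hU
  have hd := differentiableOn_gaussTransform₁ (r := r) (c := c) hU hE
  have heq : rightSide₁ r s c f =
      fun x => gaussTransform₁ r c (fun x => opExp ((x.1 / 4) • secondDeriv) f x.2) (s, x) :=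
    funext fun x => rightSide₁_eq hr hs.1.1 x
  refine ⟨fun x => ?_, ?_, fun x => ?_⟩
  · rw [show opExpTerm ((s * (r + s) / (4 * r)) • secondDeriv) (contract₁ r s c f) x = _ from
      funext fun k => opExpTerm_contract₁ hr hs.1.1 c f x k]
    exact (hheat _ hs.1.2 _).1
  · rw [heq]
    exact differentiable_slice₁ hS hd hs
  · have hev : (fun σ => rightSide₁ r σ c f x) =ᶠ[𝓝 s] fun σ =>
        gaussTransform₁ r c (fun x => opExp ((x.1 / 4) • secondDeriv) f x.2) (σ, x) := by
      filter_upwards [hS.mem_nhds hs] with σ hσ using rightSide₁_eq hr hσ.1.1 x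
    have h1 := deriv_gaussTransform₁ (c := c) (K := 0) (M := 0) hU hE
      (fun t ht y => by simpa using (hheat t ht y).2) hs x
    simp only [gaussTransform₁, Pi.zero_apply, mul_zero, sub_zero] at h1
    rw [heq]
    refine HasDerivAt.congr_of_eventuallyEq ?_ hev
    exact (differentiableAt_time₁ hS hd hs x).hasDerivAt.congr_deriv h1

/-- `1 + s/r` has positive real part, hence so has its inverse. -/
lemma div_add_mem_slitPlane {s : ℂ} (hs : ‖s‖ < ‖r‖) : r / (r + s) ∈ slitPlane := by
  have hr : r ≠ 0 := norm_pos_iff.1 ((norm_nonneg s).trans_lt hs)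
  have h1 : ‖s / r‖ < 1 := by
    rw [norm_div]
    exact (div_lt_one (norm_pos_iff.2 hr)).2 hs
  have h2 : 0 < (1 + s / r).re := by
    have := (abs_lt.1 ((abs_re_le_norm (s / r)).trans_lt h1)).1
    rw [add_re, one_re]
    linarith
  have h3 : r / (r + s) = (1 + s / r)⁻¹ := by
    rw [show 1 + s / r = (r + s) / r by field_simp, inv_div]
  refine Or.inl ?_
  rw [h3, inv_re]
  have h4 : 1 + s / r ≠ 0 := fun h => by simp [h] at h2
  exact div_pos h2 (normSq_pos.2 h4)

lemma ball_subset_timeDomain₁ (hr : r ≠ 0) {κ : ℝ} (hκ : 0 ≤ κ) :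
    Metric.ball 0 (κ + 1 / ‖r‖)⁻¹ ⊆ timeDomain₁ r (convergenceDomain κ) := by
  intro s hs
  refine ⟨ball_subset_timeDomain hr hκ hs, div_add_mem_slitPlane ?_⟩
  have hr0 : 0 < ‖r‖ := norm_pos_iff.2 hr
  rw [mem_ball_zero_iff] at hs
  refine hs.trans_le ?_
  rw [inv_le_comm₀ (by positivity) hr0, ← one_div]
  linarith

theorem hasSum_gauss_mul₁ {a : ℝ} (hr : r ≠ 0) (ha : 0 ≤ a) (hf : GaussType₁ a f) {s : ℂ}
    (hs : ‖s‖ * (a + 1 / ‖r‖) < 1) (x : ℂ) :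
    HasSum (opExpTerm ((s / 4) • secondDeriv) (fun y => gauss₁ r c y * f y) x)
      (rightSide₁ r s c f x) := by
  obtain ⟨hE, hheat⟩ := hf.heat ha
  have hU := isOpen_convergenceDomain a
  have hsub := ball_subset_timeDomain₁ hr ha
  have hr0 : 0 < ‖r‖ := norm_pos_iff.2 hr
  have hs' : s ∈ Metric.ball 0 (a + 1 / ‖r‖)⁻¹ := by
    rw [mem_ball_zero_iff, ← one_div, lt_div_iff₀ (by positivity)]
    exact hs
  have hd := differentiableOn_gaussTransform₁ (r := r) (c := c) hU hE
  have h := hasSum_opExpTerm_of_heat₁ (hd.mono (Set.prod_mono hsub subset_rfl))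
    (fun s hs x => by
      have h1 := deriv_gaussTransform₁ (c := c) (K := 0) (M := 0) hU hE
        (fun t ht y => by simpa using (hheat t ht y).2) (hsub hs) x
      simpa [gaussTransform₁] using h1) hs' x
  rw [rightSide₁_eq hr (hsub hs').1.1]
  simp only [gaussTransform₁_zero hr, zero_div, homogeneous_secondDeriv.opExp_zero] at h
  exact h

/-- The partial sum of the first `N` terms of the exponential series of `(t/4) ∂²/∂x²`. -/
noncomputable def truncExp₁ (N : ℕ) (f : ℂ → ℂ) (x : ℂ × ℂ) : ℂ :=
  ∑ k ∈ Finset.range N, opExpTerm ((x.1 / 4) • secondDeriv) f x.2 k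

lemma truncExp₂_comp_avg (N : ℕ) (f : ℂ → ℂ) (x : ℂ × (ℂ × ℂ)) :
    truncExp₂ N (fun p => f (avg p)) x = truncExp₁ N f (x.1, avg x.2) :=
  Finset.sum_congr rfl fun _ _ => opExpTerm_comp_avg _ _ _ _

lemma differentiable_truncExp₁ (hf : Differentiable ℂ f) (N : ℕ) :
    Differentiable ℂ (truncExp₁ N f) := by
  have h := differentiable_truncExp₂ (hf.comp differentiable_avg) N
  have h1 : truncExp₂ N (f ∘ avg) = fun x => truncExp₁ N f (x.1, avg x.2) :=
    funext fun x => truncExp₂_comp_avg N f x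
  rw [h1] at h
  have h2 := differentiableOn_of_lift (S := Set.univ) h.differentiableOn
  rwa [Set.univ_prod_univ, differentiableOn_univ] at h2

lemma deriv_truncExp₁ (hf : Differentiable ℂ f) (M : ℕ) (t x : ℂ) :
    deriv (fun σ => truncExp₁ (M + 1) f (σ, x)) t =
      1 / 4 * secondDeriv (fun y => truncExp₁ (M + 1) f (t, y)) x -
        t ^ M * ((M.factorial : ℂ)⁻¹ * ((1 / 4) ^ (M + 1) * (secondDeriv^[M + 1] f) x)) := by
  have h := deriv_truncExp₂ (f := fun p => f (avg p)) (hf.comp differentiable_avg) M t (x, x)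
  simp only [truncExp₂_comp_avg, mixedDeriv_iterate_comp_avg] at h
  rw [mixedDeriv_comp_avg (fun y => truncExp₁ (M + 1) f (t, y))] at h
  simpa only [avg_diag, Pi.smul_apply, smul_eq_mul] using h

lemma truncExp₁_zero (M : ℕ) (x : ℂ) : truncExp₁ (M + 1) f (0, x) = f x := by
  simp only [truncExp₁, homogeneous_secondDeriv.opExpTerm_smul, Finset.sum_range_succ']
  simp

lemma differentiable_secondDeriv_iterate (hf : Differentiable ℂ f) (k : ℕ) :
    Differentiable ℂ (secondDeriv^[k] f) := by
  induction k with
  | zero => exact hf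
  | succ k ih =>
    rw [Function.iterate_succ_apply']
    have h1 := differentiableOn_univ.1 (ih.differentiableOn.deriv isOpen_univ)
    exact differentiableOn_univ.1 (h1.differentiableOn.deriv isOpen_univ)

theorem isBigO_trunc₁ (c : ℂ) (hr : r ≠ 0) (hf : Differentiable ℂ f) (x : ℂ) (N : ℕ) :
    (fun s : ℂ =>
      (∑ k ∈ Finset.range N, opExpTerm ((s / 4) • secondDeriv) (fun y => gauss₁ r c y * f y) x k) -
        (r / (r + s)) ^ (1 / 2 : ℂ) * gauss₁ (r + s) c x *
          ∑ k ∈ Finset.range N,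
            opExpTerm ((s * (r + s) / (4 * r)) • secondDeriv) (contract₁ r s c f) x k)
      =O[𝓝 0] fun s : ℂ => s ^ N := by
  rcases N with - | M
  · simp only [Finset.range_zero, Finset.sum_empty, mul_zero, sub_zero]
    exact isBigO_zero _ _
  set K : ℂ × ℂ → ℂ := fun x =>
    (M.factorial : ℂ)⁻¹ * ((1 / 4) ^ (M + 1) * (secondDeriv^[M + 1] f) x.2) with hK
  have hKd : Differentiable ℂ K := by
    have := differentiable_secondDeriv_iterate hf (M + 1)
    rw [hK]
    fun_prop
  have hE := (differentiable_truncExp₁ hf (M + 1)).differentiableOn (s := Set.univ ×ˢ Set.univ)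
  have hS := isOpen_timeDomain₁ r isOpen_univ
  have h0 : (0 : ℂ) ∈ timeDomain₁ r Set.univ := zero_mem_timeDomain₁ hr trivial
  set u := gaussTransform₁ r c (truncExp₁ (M + 1) f) with hu
  have hud : DifferentiableOn ℂ u (timeDomain₁ r Set.univ ×ˢ Set.univ) :=
    differentiableOn_gaussTransform₁ isOpen_univ hE
  have hHd : DifferentiableOn ℂ (fun x => (r / (r + x.1)) ^ (M + 2) * gaussTransform₁ r c K x)
      (timeDomain₁ r Set.univ ×ˢ Set.univ) := by
    have h1 : DifferentiableOn ℂ (fun x : ℂ × ℂ => r / (r + x.1))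
        (timeDomain₁ r Set.univ ×ˢ Set.univ) := fun x hx => by
      have h2 : r + x.1 ≠ 0 := hx.1.1.1
      exact DifferentiableAt.differentiableWithinAt (by fun_prop (disch := exact h2))
    exact (h1.pow _).mul (differentiableOn_gaussTransform₁ isOpen_univ hKd.differentiableOn)
  have hder : ∀ k ≤ M, iteratedDeriv k (fun σ => u (σ, x)) 0 =
      (1 / 4) ^ k * (secondDeriv^[k] (fun y => gauss₁ r c y * f y)) x := by
    intro k hk
    rw [iteratedDeriv_eq_secondDeriv_iterate hS h0 hk hud hHd
      (fun s hs p => deriv_gaussTransform₁ isOpen_univ hE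
        (fun t _ q => deriv_truncExp₁ hf M t q) hs p)]
    refine congrArg (fun g => (1 / 4 : ℂ) ^ k * (secondDeriv^[k] g) x) (funext fun q => ?_)
    rw [hu, gaussTransform₁_zero hr, truncExp₁_zero]
  have han : AnalyticAt ℂ (fun σ => u (σ, x)) 0 :=
    DifferentiableOn.analyticAt (s := timeDomain₁ r Set.univ)
      (fun s hs => (differentiableAt_time₁ hS hud hs x).differentiableWithinAt) (hS.mem_nhds h0)
  refine (isBigO_taylor_sub han (M + 1)).congr' ?_ EventuallyEq.rfl
  filter_upwards [hS.mem_nhds h0] with s hs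
  congr 1
  · refine Finset.sum_congr rfl fun k hk => ?_
    rw [homogeneous_secondDeriv.opExpTerm_smul,
      hder k (Nat.lt_succ_iff.1 (Finset.mem_range.1 hk)), div_pow, div_pow]
    ring
  · simp only [hu, gaussTransform₁, gaussPath₁, truncExp₁]
    congr 1
    exact Finset.sum_congr rfl fun k _ => (opExpTerm_contract₁ hr hs.1.1 c f x k).symm

end One

/-! ### Convolution with Gaussians -/

lemma conv_apply {G : Type} [AddGroup G] [MeasureSpace G] (g h : G → ℂ) (x : G) :
    conv g h x = ∫ t, g t * h (x - t) := rfl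

lemma convAt_iff {G : Type} [AddGroup G] [MeasureSpace G] (g h : G → ℂ) (x : G) :
    ConvAt g h x ↔ Integrable (fun t => g t * h (x - t)) := Iff.rfl

section Affine

variable {V : Type*} [NormedAddCommGroup V] [NormedSpace ℝ V] [FiniteDimensional ℝ V]
  [MeasureSpace V] [BorelSpace V] [(volume : Measure V).IsAddHaarMeasure]

lemma integrable_comp_affine_iff (G : V → ℂ) {l : ℝ} (hl : l ≠ 0) (d : V) :
    Integrable (fun t => G (l • t - d)) ↔ Integrable G := by
  rw [integrable_comp_smul_iff volume (fun t => G (t - d)) hl]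
  exact (measurePreserving_sub_right volume d).integrable_comp_emb
    (MeasurableEquiv.subRight d).measurableEmbedding

lemma integral_comp_affine (G : V → ℂ) (l : ℝ) (d : V) :
    ∫ t, G (l • t - d) = |(l ^ Module.finrank ℝ V)⁻¹| • ∫ t, G t := by
  rw [Measure.integral_comp_smul volume (fun t => G (t - d)), integral_sub_right_eq_self]

end Affine

/-! ### The plane -/

lemma kernel₂_eq (s : ℝ) (w : ℂ) :
    kernel₂ s w = ((1 / (Real.pi * s) * Real.exp (-‖w‖ ^ 2 / s) : ℝ) : ℂ) := by
  rw [kernel₂, mul_conj, normSq_eq_norm_sq]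
  push_cast
  rfl

/-- The negative sign turns the argument `z - t` of a convolution into `z + √s w`, as in the heat
integral. -/
lemma kernel₂_smul {s : ℝ} (hs : 0 < s) (w : ℂ) :
    kernel₂ s ((-Real.sqrt s) • w) = (s : ℂ)⁻¹ * gaussWeight w := by
  rw [kernel₂_eq, gaussWeight, norm_smul, mul_pow, norm_neg, Real.norm_of_nonneg
    (Real.sqrt_nonneg s), Real.sq_sqrt hs.le, ← ofReal_inv, ← ofReal_mul]
  congr 1
  rw [show -(s * ‖w‖ ^ 2) / s = -‖w‖ ^ 2 by field_simp]
  field_simp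

lemma integral_kernel₂_mul {s : ℝ} (hs : 0 < s) (h : ℂ → ℂ) :
    ∫ t, kernel₂ s t * h t = ∫ w, gaussWeight w * h ((-Real.sqrt s) • w) := by
  have h1 := Measure.integral_comp_smul volume (fun t => kernel₂ s t * h t) (-Real.sqrt s)
  have hsc : (s : ℂ) ≠ 0 := ofReal_ne_zero.2 hs.ne'
  simp only [kernel₂_smul hs, Complex.finrank_real_complex, neg_sq, Real.sq_sqrt hs.le, mul_assoc,
    integral_const_mul] at h1
  rw [abs_of_pos (inv_pos.2 hs), real_smul, ofReal_inv] at h1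
  exact (mul_left_cancel₀ (inv_ne_zero hsc) h1).symm

lemma integrable_kernel₂_mul_iff {s : ℝ} (hs : 0 < s) (h : ℂ → ℂ) :
    Integrable (fun t => kernel₂ s t * h t) ↔
      Integrable (fun w => gaussWeight w * h ((-Real.sqrt s) • w)) := by
  have hsc : (s : ℂ)⁻¹ ≠ 0 := inv_ne_zero (ofReal_ne_zero.2 hs.ne')
  rw [← integrable_comp_smul_iff volume (fun t => kernel₂ s t * h t)
    (neg_ne_zero.2 (Real.sqrt_pos.2 hs).ne'), ← integrable_const_mul_iff (isUnit_iff_ne_zero.2 hsc)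
    (fun w => gaussWeight w * h ((-Real.sqrt s) • w))]
  simp only [kernel₂_smul hs, mul_assoc]

lemma integrable_kernel₂ {s : ℝ} (hs : 0 < s) : Integrable (kernel₂ s) := by
  have h : Integrable (fun w => gaussWeight w * (1 : ℂ)) :=
    integrable_gaussWeight_mul (κ := 0) (C := 1) one_pos continuous_const (by simp)
  have h1 := (integrable_kernel₂_mul_iff hs (fun _ => 1)).2 h
  simpa using h1

lemma integral_kernel₂ {s : ℝ} (hs : 0 < s) : ∫ t, kernel₂ s t = 1 := by
  have h := integral_kernel₂_mul hs (fun _ => 1)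
  simpa [integral_gaussWeight] using h

/-- The exponential of `s ∂²/∂z∂z*` is the convolution with a Gaussian. -/
theorem opExp_eq_conv₂ {s α β : ℝ} {g : ℂ × ℂ → ℂ} (hs : 0 < s) (hα : 0 ≤ α) (hβ : 0 ≤ β)
    (h : s * ((α + β) / 2) < 1) (hg : GaussType₂ α β g) :
    OpExpSummable ((s : ℂ) • mixedDeriv) g ∧
    ∀ z : ℂ, ConvAt (kernel₂ s) (fun w => g (w, conj w)) z ∧
      opExp ((s : ℂ) • mixedDeriv) g (z, conj z) =
        conv (kernel₂ s) (fun w => g (w, conj w)) z := by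
  have hq : 0 < Real.sqrt s := Real.sqrt_pos.2 hs
  have hsq := Real.sq_sqrt hs.le
  -- With `a = 1/√s` and `b = √s`, at time `s` both shifts have size `√s`, so conjugate arguments
  -- remain conjugate; the admissibility condition becomes `s(α + β)/2 < 1`.
  have hab : 1 / Real.sqrt s * Real.sqrt s = 1 := by field_simp
  have hsa : s * (1 / Real.sqrt s) = Real.sqrt s := by
    rw [mul_one_div, div_eq_iff hq.ne', ← sq, hsq]
  have hm0 : (α * (s * (1 / Real.sqrt s)) ^ 2 + β * Real.sqrt s ^ 2) / 2 < 1 := by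
    rw [hsa, hsq]
    linarith
  obtain ⟨T, hT, hm⟩ := exists_time_gt hm0
  have hmem : (s : ℂ) ∈ Metric.ball 0 T := by
    rw [mem_ball_zero_iff, Complex.norm_real, Real.norm_of_nonneg hs.le]
    exact hT
  have hsum := hasSum_heatIntegral hg hα hβ hab hm hmem
  have hpt : ∀ z w : ℂ, g (z + s * (((1 / Real.sqrt s : ℝ) : ℂ) * w),
      conj z + (Real.sqrt s : ℝ) * conj w) =
      g (z - (-Real.sqrt s) • w, conj (z - (-Real.sqrt s) • w)) := by
    intro z w
    have h1 : (s : ℂ) * ((1 / Real.sqrt s : ℝ) : ℂ) = (Real.sqrt s : ℝ) := by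
      rw [← ofReal_mul, hsa]
    rw [← mul_assoc, h1]
    simp
  refine ⟨fun p => (hsum p).summable, fun z => ⟨?_, ?_⟩⟩
  · rw [convAt_iff, integrable_kernel₂_mul_iff hs (fun t => g (z - t, conj (z - t)))]
    obtain ⟨κ, hκ, hb⟩ := hg.exists_bound hα hβ hm0
    obtain ⟨C, hC, hb⟩ := hb ‖((z, conj z) : ℂ × ℂ)‖
    have hi := integrable_gaussWeight_mul hκ
      (continuous_comp_shift hg.1.continuous ((s : ℂ), (z, conj z)))
      (hb ((s : ℂ), (z, conj z)) (by
        rw [Complex.norm_real, Real.norm_of_nonneg hs.le]) le_rfl)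
    simpa only [hpt] using hi
  · rw [conv_apply, integral_kernel₂_mul hs (fun t => g (z - t, conj (z - t)))]
    refine ((hsum (z, conj z)).tsum_eq).trans ?_
    simp only [heatIntegral, hpt]

/-- Completing the square in `t`. The factor `((r+s)/r)²` is the Jacobian of the dilation inside the
last kernel. -/
lemma gauss_integrand₂ {r s : ℝ} (hr : 0 < r) (hs : 0 < s) (z₀ z t : ℂ) :
    kernel₂ s t * gauss₂ r (z₀, conj z₀) (z - t, conj (z - t)) =
      r / (r + s) * gauss₂ (r + s) (z₀, conj z₀) (z, conj z) * ((r + s) / r) ^ 2 *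
        kernel₂ (s * (r + s) / r) (((r + s) / r) • t - (s / r) • (z - z₀)) := by
  have hr' : (r : ℂ) ≠ 0 := ofReal_ne_zero.2 hr.ne'
  have hs' : (s : ℂ) ≠ 0 := ofReal_ne_zero.2 hs.ne'
  have hrs : (r : ℂ) + s ≠ 0 := by
    rw [← ofReal_add]
    exact ofReal_ne_zero.2 (add_pos hr hs).ne'
  have hpi : (Real.pi : ℂ) ≠ 0 := ofReal_ne_zero.2 Real.pi_ne_zero
  simp only [kernel₂, gauss₂, map_sub, real_smul, map_mul, conj_ofReal]
  push_cast
  have e1 : ∀ a b c d A B : ℂ, a = c * d → A = B → a * A = c * d * B := by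
    rintro a b c d A B rfl rfl
    rfl
  -- The identity of exponents is polynomial in a variable and its conjugate separately, so the
  -- conjugates may be treated as independent.
  generalize conj t = t'
  generalize conj z = z'
  generalize conj z₀ = z₀'
  have h1 : exp (-(t * t') / s) * exp (-((z - t - z₀) * (z' - t' - z₀')) / r) =
      exp (-((z - z₀) * (z' - z₀')) / (r + s)) *
        exp (-((((r : ℂ) + s) / r * t - s / r * (z - z₀)) *
          (((r : ℂ) + s) / r * t' - s / r * (z' - z₀'))) / (s * (r + s) / r)) := by
    rw [← exp_add, ← exp_add]
    congr 1
    field_simp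
    ring
  have h2 : (1 : ℂ) / (Real.pi * s) =
      r / (r + s) * (((r : ℂ) + s) / r) ^ 2 * (1 / (Real.pi * (s * (r + s) / r))) := by
    field_simp
  calc _ = (1 : ℂ) / (Real.pi * s) *
        (exp (-(t * t') / s) * exp (-((z - t - z₀) * (z' - t' - z₀')) / r)) := by ring
    _ = _ := by
      rw [h1, h2]
      ring

lemma contract_affine {r s : ℂ} (hr : r ≠ 0) (hrs : r + s ≠ 0) (z z₀ t : ℂ) :
    (r * (z - ((r + s) / r * t - s / r * (z - z₀))) + s * z₀) / (r + s) = z - t := by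
  field_simp
  ring

/-- After an invertible affine substitution the integrands agree up to a nonzero constant. Hence `f`
can be arbitrary and integrability is equivalent; otherwise both integrals have the default value
`0`. -/
theorem conv_gauss₂ {r s : ℝ} (hr : 0 < r) (hs : 0 < s) (z₀ : ℂ) (f : ℂ → ℂ) (z : ℂ) :
    (ConvAt (kernel₂ s) (fun w => gauss₂ r (z₀, conj z₀) (w, conj w) * f w) z ↔
      ConvAt (kernel₂ (s * (r + s) / r)) (fun w => f ((r * w + s * z₀) / (r + s))) z) ∧
    conv (kernel₂ s) (fun w => gauss₂ r (z₀, conj z₀) (w, conj w) * f w) z =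
      r / (r + s) * gauss₂ (r + s) (z₀, conj z₀) (z, conj z) *
        conv (kernel₂ (s * (r + s) / r)) (fun w => f ((r * w + s * z₀) / (r + s))) z := by
  have hr' : (r : ℂ) ≠ 0 := ofReal_ne_zero.2 hr.ne'
  have hrs0 : 0 < r + s := add_pos hr hs
  have hrs : (r : ℂ) + s ≠ 0 := by
    rw [← ofReal_add]
    exact ofReal_ne_zero.2 hrs0.ne'
  have hl : (r + s) / r ≠ 0 := (div_pos hrs0 hr).ne'
  set G : ℂ → ℂ := fun u =>
    kernel₂ (s * (r + s) / r) u * f ((r * (z - u) + s * z₀) / (r + s)) with hG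
  set A : ℂ := r / (r + s) * gauss₂ (r + s) (z₀, conj z₀) (z, conj z) with hA
  have hpt : (fun t => kernel₂ s t * (gauss₂ r (z₀, conj z₀) (z - t, conj (z - t)) * f (z - t))) =
      fun t => A * (((r : ℂ) + s) / r) ^ 2 * G (((r + s) / r) • t - (s / r) • (z - z₀)) := by
    funext t
    rw [← mul_assoc, gauss_integrand₂ hr hs z₀ z t]
    have h1 := contract_affine hr' hrs z z₀ t
    simp only [hG]
    rw [show ((r + s) / r) • t - (s / r) • (z - z₀) =
      ((r : ℂ) + s) / r * t - s / r * (z - z₀) by simp [real_smul], h1]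
    ring
  have hA0 : A * (((r : ℂ) + s) / r) ^ 2 ≠ 0 := by
    have : gauss₂ (r + s) (z₀, conj z₀) (z, conj z) ≠ 0 := exp_ne_zero _
    positivity
  constructor
  · rw [convAt_iff, convAt_iff, hpt, integrable_const_mul_iff (isUnit_iff_ne_zero.2 hA0),
      integrable_comp_affine_iff G hl]
  · rw [conv_apply, conv_apply, hpt, integral_const_mul, integral_comp_affine,
      Complex.finrank_real_complex, abs_of_pos (by positivity), real_smul]
    push_cast
    rw [← mul_assoc]
    congr 1
    field_simp

/-- The preceding identity for constant `f`, where the remaining convolution integrates a normalized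
Gaussian. -/
theorem conv_kernel₂ {r s : ℝ} (hr : 0 < r) (hs : 0 < s) :
    (∀ z : ℂ, ConvAt (kernel₂ s) (kernel₂ r) z) ∧
      conv (kernel₂ s) (kernel₂ r) = kernel₂ (r + s) := by
  have hσ : 0 < s * (r + s) / r := by positivity
  have hk : kernel₂ r = fun w => gauss₂ r (0, conj 0) (w, conj w) * (1 / (Real.pi * r)) := by
    funext w
    simp only [kernel₂, gauss₂, map_zero, sub_zero]
    ring
  constructor
  · intro z
    rw [hk, (conv_gauss₂ hr hs 0 (fun _ => 1 / (Real.pi * r)) z).1, convAt_iff]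
    exact (integrable_kernel₂ hσ).mul_const _
  · funext z
    rw [hk, (conv_gauss₂ hr hs 0 (fun _ => 1 / (Real.pi * r)) z).2, conv_apply,
      integral_mul_const, integral_kernel₂ hσ]
    have hr' : (r : ℂ) ≠ 0 := ofReal_ne_zero.2 hr.ne'
    simp only [kernel₂, gauss₂, map_zero, sub_zero]
    push_cast
    field_simp

/-! ### The line -/

lemma integrable_kernel₁ {s : ℝ} (hs : 0 < s) : Integrable (kernel₁ s) := by
  have h := ((integrable_exp_neg_mul_sq (one_div_pos.2 hs)).const_mul
    (1 / Real.sqrt (Real.pi * s))).ofReal (𝕜 := ℂ)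
  refine h.congr (Eventually.of_forall fun x => ?_)
  simp only [kernel₁]
  rw [show -(1 / s) * x ^ 2 = -x ^ 2 / s by ring]
  rfl

lemma integral_kernel₁ {s : ℝ} (hs : 0 < s) : ∫ t, kernel₁ s t = 1 := by
  have h := integral_gaussian (1 / s)
  rw [show Real.pi / (1 / s) = Real.pi * s by field_simp] at h
  unfold kernel₁
  rw [integral_complex_ofReal, integral_const_mul]
  have h1 : ∫ x : ℝ, Real.exp (-x ^ 2 / s) = Real.sqrt (Real.pi * s) := by
    rw [← h]
    congr 1
    funext x
    congr 1
    ring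
  rw [h1, one_div_mul_cancel]
  · simp
  · have := Real.pi_pos
    positivity

lemma kernel₁_ne_zero {s : ℝ} (hs : 0 < s) (x : ℝ) : kernel₁ s x ≠ 0 := by
  rw [kernel₁]
  have := Real.pi_pos
  exact ofReal_ne_zero.2 (by positivity)

lemma kernel₂_eq_mul {s : ℝ} (hs : 0 < s) (w : ℂ) :
    kernel₂ s w = kernel₁ s w.re * kernel₁ s w.im := by
  rw [kernel₂_eq, kernel₁, kernel₁, ← ofReal_mul, Complex.sq_norm, normSq_apply]
  congr 1
  have h1 : Real.exp (-(w.re * w.re + w.im * w.im) / s) =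
      Real.exp (-w.re ^ 2 / s) * Real.exp (-w.im ^ 2 / s) := by
    rw [← Real.exp_add]
    congr 1
    ring
  have hp : 0 < Real.pi * s := mul_pos Real.pi_pos hs
  have h2 : 1 / (Real.pi * s) = 1 / Real.sqrt (Real.pi * s) * (1 / Real.sqrt (Real.pi * s)) := by
    rw [div_mul_div_comm, one_mul, Real.mul_self_sqrt hp.le]
  rw [h1, h2]
  ring

/-- The exponential of `(s/4) ∂²/∂x²` is the convolution with a Gaussian. -/
theorem opExp_eq_conv₁ {s a : ℝ} {g : ℂ → ℂ} (hs : 0 < s) (ha : 0 ≤ a) (h : s * a < 1)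
    (hg : GaussType₁ a g) :
    OpExpSummable ((s / 4 : ℂ) • secondDeriv) g ∧
    ∀ x : ℝ, ConvAt (kernel₁ s) (fun y : ℝ => g y) x ∧
      opExp ((s / 4 : ℂ) • secondDeriv) g x = conv (kernel₁ s) (fun y : ℝ => g y) x := by
  have hmem : (s : ℂ) ∈ convergenceDomain a := by
    change ‖(s : ℂ)‖ * a < 1
    rwa [Complex.norm_real, Real.norm_of_nonneg hs.le]
  refine ⟨fun x => ((hg.heat ha).2 s hmem x).1, fun x => ?_⟩
  obtain ⟨-, h2⟩ := opExp_eq_conv₂ hs ha ha (by linarith) (hg.comp_avg ha)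
  obtain ⟨h3, h4⟩ := h2 (x : ℂ)
  -- The mean of a number and its conjugate is its real part, so the plane integral splits and the
  -- imaginary direction contributes `∫ kernel₁ s = 1`.
  have hfun : (fun t : ℂ => kernel₂ s t * g (avg ((x : ℂ) - t, conj ((x : ℂ) - t)))) =
      fun t => (fun q : ℝ × ℝ => (kernel₁ s q.1 * g ((x - q.1 : ℝ) : ℂ)) * kernel₁ s q.2)
        (measurableEquivRealProd t) := by
    funext t
    have : avg ((x : ℂ) - t, conj ((x : ℂ) - t)) = ((x - t.re : ℝ) : ℂ) := by
      rw [avg, add_conj]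
      simp
    rw [this, kernel₂_eq_mul hs, measurableEquivRealProd_apply]
    ring
  rw [convAt_iff, hfun] at h3
  rw [conv_apply, hfun] at h4
  replace h4 := h4.trans (volume_preserving_equiv_real_prod.integral_comp
    measurableEquivRealProd.measurableEmbedding
    (fun q : ℝ × ℝ => (kernel₁ s q.1 * g ((x - q.1 : ℝ) : ℂ)) * kernel₁ s q.2))
  have h5 := (volume_preserving_equiv_real_prod.integrable_comp_emb
    measurableEquivRealProd.measurableEmbedding
    (g := fun q : ℝ × ℝ => (kernel₁ s q.1 * g ((x - q.1 : ℝ) : ℂ)) * kernel₁ s q.2)).1 h3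
  rw [Measure.volume_eq_prod] at h4 h5
  rw [integral_prod_mul (fun y : ℝ => kernel₁ s y * g ((x - y : ℝ) : ℂ)) (kernel₁ s),
    integral_kernel₁ hs, mul_one, opExp_comp_avg, conj_ofReal, avg_diag] at h4
  refine ⟨?_, h4⟩
  -- Fubini gives integrability on almost every line; on one such line the constant `kernel₁ s y` is
  -- nonzero and can be divided out.
  obtain ⟨y, hy⟩ := h5.prod_left_ae.exists
  exact (integrable_mul_const_iff (isUnit_iff_ne_zero.2 (kernel₁_ne_zero hs y)) _).1 hy

lemma gauss_integrand₁ {r s : ℝ} (hr : 0 < r) (hs : 0 < s) (x₀ x t : ℝ) :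
    kernel₁ s t * gauss₁ r x₀ ((x - t : ℝ) : ℂ) =
      Real.sqrt (r / (r + s)) * gauss₁ (r + s) x₀ x * (((r + s) / r : ℝ) : ℂ) *
        kernel₁ (s * (r + s) / r) (((r + s) / r) • t - (s / r) • (x - x₀)) := by
  have hrs : 0 < r + s := add_pos hr hs
  have hg : ∀ ρ y : ℝ, gauss₁ ρ x₀ y = ((Real.exp (-(y - x₀) ^ 2 / ρ) : ℝ) : ℂ) := by
    intro ρ y
    rw [gauss₁]
    push_cast
    rfl
  have hg' := hg (r + s) x
  rw [ofReal_add] at hg'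
  rw [hg, hg', kernel₁, kernel₁]
  norm_cast
  have h1 : Real.exp (-t ^ 2 / s) * Real.exp (-(x - t - x₀) ^ 2 / r) =
      Real.exp (-(x - x₀) ^ 2 / (r + s)) *
        Real.exp (-(((r + s) / r) • t - (s / r) • (x - x₀)) ^ 2 / (s * (r + s) / r)) := by
    rw [← Real.exp_add, ← Real.exp_add]
    congr 1
    simp only [smul_eq_mul]
    field_simp
    ring
  have h2 : 1 / Real.sqrt (Real.pi * s) =
      Real.sqrt (r / (r + s)) * ((r + s) / r) * (1 / Real.sqrt (Real.pi * (s * (r + s) / r))) := by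
    have e1 : Real.pi * (s * (r + s) / r) = Real.pi * s * ((r + s) / r) := by ring
    have hps : 0 < Real.pi * s := mul_pos Real.pi_pos hs
    have hq : 0 < (r + s) / r := div_pos hrs hr
    rw [e1, Real.sqrt_mul hps.le, ← inv_div (r + s) r, Real.sqrt_inv]
    have hsq := Real.mul_self_sqrt hq.le
    have h3 := Real.sqrt_pos.2 hq
    have h4 := Real.sqrt_pos.2 hps
    generalize Real.sqrt ((r + s) / r) = b at *
    rw [← hsq]
    field_simp
  calc _ = 1 / Real.sqrt (Real.pi * s) *
        (Real.exp (-t ^ 2 / s) * Real.exp (-(x - t - x₀) ^ 2 / r)) := by ring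
    _ = _ := by
      rw [h1, h2]
      ring

theorem conv_gauss₁ {r s : ℝ} (hr : 0 < r) (hs : 0 < s) (x₀ : ℝ) (f : ℝ → ℂ) (x : ℝ) :
    (ConvAt (kernel₁ s) (fun y => gauss₁ r x₀ y * f y) x ↔
      ConvAt (kernel₁ (s * (r + s) / r)) (fun y => f ((r * y + s * x₀) / (r + s))) x) ∧
    conv (kernel₁ s) (fun y => gauss₁ r x₀ y * f y) x =
      Real.sqrt (r / (r + s)) * gauss₁ (r + s) x₀ x *
        conv (kernel₁ (s * (r + s) / r)) (fun y => f ((r * y + s * x₀) / (r + s))) x := by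
  have hrs : 0 < r + s := add_pos hr hs
  have hl : 0 < (r + s) / r := div_pos hrs hr
  set G : ℝ → ℂ := fun u =>
    kernel₁ (s * (r + s) / r) u * f ((r * (x - u) + s * x₀) / (r + s)) with hG
  set A : ℂ := Real.sqrt (r / (r + s)) * gauss₁ (r + s) x₀ x with hA
  have hpt : (fun t : ℝ => kernel₁ s t * (gauss₁ r x₀ ((x - t : ℝ) : ℂ) * f (x - t))) =
      fun t => A * (((r + s) / r : ℝ) : ℂ) * G (((r + s) / r) • t - (s / r) • (x - x₀)) := by
    funext t
    rw [← mul_assoc, gauss_integrand₁ hr hs x₀ x t]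
    have h1 : (r * (x - (((r + s) / r) • t - (s / r) • (x - x₀))) + s * x₀) / (r + s) = x - t := by
      simp only [smul_eq_mul]
      field_simp
      ring
    simp only [hG]
    rw [h1]
    ring
  have hA0 : A * (((r + s) / r : ℝ) : ℂ) ≠ 0 := by
    have h1 : gauss₁ (r + s) x₀ x ≠ 0 := exp_ne_zero _
    have h2 : ((Real.sqrt (r / (r + s)) : ℝ) : ℂ) ≠ 0 :=
      ofReal_ne_zero.2 (Real.sqrt_pos.2 (div_pos hr hrs)).ne'
    exact mul_ne_zero (mul_ne_zero h2 h1) (ofReal_ne_zero.2 hl.ne')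
  constructor
  · rw [convAt_iff, convAt_iff, hpt, integrable_const_mul_iff (isUnit_iff_ne_zero.2 hA0),
      integrable_comp_affine_iff G hl.ne']
  · rw [conv_apply, conv_apply, hpt, integral_const_mul, integral_comp_affine,
      Module.finrank_self, pow_one, abs_of_pos (inv_pos.2 hl), real_smul, ofReal_inv, mul_assoc A,
      mul_inv_cancel_left₀ (ofReal_ne_zero.2 hl.ne')]

theorem conv_kernel₁ {r s : ℝ} (hr : 0 < r) (hs : 0 < s) :
    (∀ x : ℝ, ConvAt (kernel₁ s) (kernel₁ r) x) ∧
      conv (kernel₁ s) (kernel₁ r) = kernel₁ (r + s) := by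
  have hrs : 0 < r + s := add_pos hr hs
  have hσ : 0 < s * (r + s) / r := by positivity
  have hk : kernel₁ r = fun y : ℝ =>
      gauss₁ r (0 : ℝ) y * ((1 / Real.sqrt (Real.pi * r) : ℝ) : ℂ) := by
    funext y
    simp only [kernel₁, gauss₁]
    push_cast
    rw [sub_zero]
    ring
  constructor
  · intro x
    rw [hk, (conv_gauss₁ hr hs 0 (fun _ => ((1 / Real.sqrt (Real.pi * r) : ℝ) : ℂ)) x).1,
      convAt_iff]
    exact (integrable_kernel₁ hσ).mul_const _
  · funext x
    rw [hk, (conv_gauss₁ hr hs 0 (fun _ => ((1 / Real.sqrt (Real.pi * r) : ℝ) : ℂ)) x).2,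
      conv_apply, integral_mul_const, integral_kernel₁ hσ, one_mul]
    have h1 : 1 / Real.sqrt (Real.pi * (r + s)) =
        Real.sqrt (r / (r + s)) * (1 / Real.sqrt (Real.pi * r)) := by
      rw [Real.sqrt_mul Real.pi_pos.le, Real.sqrt_mul Real.pi_pos.le, Real.sqrt_div hr.le]
      have h2 := Real.sqrt_pos.2 hr
      field_simp
    simp only [kernel₁, gauss₁, h1]
    push_cast
    rw [sub_zero]
    ring

/-! ### Forms of the identities without displacement, and the dilation -/

lemma mem_timeDomain_of_norm_lt {r s : ℂ} {κ : ℝ} (h : ‖s * r‖ * κ < ‖r + s‖) (hκ : 0 ≤ κ) :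
    s ∈ timeDomain r (convergenceDomain κ) := by
  have h0 : 0 < ‖r + s‖ := (mul_nonneg (norm_nonneg _) hκ).trans_lt h
  refine ⟨norm_pos_iff.1 h0, ?_⟩
  change ‖s * r / (r + s)‖ * κ < 1
  rwa [norm_div, div_mul_eq_mul_div, div_lt_one h0]

lemma mem_timeDomain₁_of_norm_mul_lt {r s : ℂ} {κ : ℝ} (hr : r ≠ 0) (hκ : 0 ≤ κ)
    (h : ‖s‖ * (κ + 1 / ‖r‖) < 1) : s ∈ timeDomain₁ r (convergenceDomain κ) := by
  have hr0 : 0 < ‖r‖ := norm_pos_iff.2 hr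
  refine ball_subset_timeDomain₁ hr hκ ?_
  rwa [mem_ball_zero_iff, ← one_div, lt_div_iff₀ (by positivity)]

lemma gauss₂_zero (r : ℂ) : gauss₂ r 0 = fun q => exp (-(q.1 * q.2) / r) := by
  funext q
  simp [gauss₂]

lemma contract₂_zero (r s : ℂ) (f : ℂ × ℂ → ℂ) :
    contract₂ r s 0 f = fun q => f (r * q.1 / (r + s), r * q.2 / (r + s)) := by
  funext q
  simp [contract₂]

lemma gauss₁_zero (r : ℂ) : gauss₁ r 0 = fun y => exp (-y ^ 2 / r) := by
  funext y
  simp [gauss₁]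

lemma contract₁_zero (r s : ℂ) (f : ℂ → ℂ) :
    contract₁ r s 0 f = fun y => f (r * y / (r + s)) := by
  funext y
  simp [contract₁]

lemma dilation_eq {r s : ℂ} (hrs : r + s ≠ 0) (c x : ℂ) :
    c + r / (r + s) * (x - c) = (r * x + s * c) / (r + s) := by
  field_simp
  ring

/-- Only `exp γ` enters the sum of the series, so every choice of the logarithm gives the same
dilation. -/
lemma opExp_euler₂ {r s γ : ℂ} (hrs : r + s ≠ 0) (hγ : exp γ = r / (r + s)) (c : ℂ × ℂ)
    {f : ℂ × ℂ → ℂ} (hf : Differentiable ℂ f) : opExp (γ • euler₂ c) f = contract₂ r s c f := by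
  funext p
  rw [opExp, (hasSum_opExpTerm_euler₂ c p γ hf).tsum_eq, hγ, contract₂]
  congr 1
  exact Prod.ext (dilation_eq hrs c.1 p.1) (dilation_eq hrs c.2 p.2)

lemma opExp_euler₁ {r s γ : ℂ} (hrs : r + s ≠ 0) (hγ : exp γ = r / (r + s)) (c : ℂ)
    {f : ℂ → ℂ} (hf : Differentiable ℂ f) : opExp (γ • euler₁ c) f = contract₁ r s c f := by
  funext x
  rw [opExp, (hasSum_opExpTerm_euler₁ c x γ hf).tsum_eq, hγ, contract₁, dilation_eq hrs]

/-! ### The exponential applied to a pure Gaussian -/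

lemma opExp_mixedDeriv_const (t b : ℂ) : opExp (t • mixedDeriv) (fun _ => b) = fun _ => b := by
  have h : mixedDeriv (fun _ => b) = 0 := by
    funext p
    simp [mixedDeriv]
  have h0 : mixedDeriv 0 = 0 := by
    funext p
    simp [mixedDeriv]
  have hk : ∀ k : ℕ, k ≠ 0 → mixedDeriv^[k] (fun _ => b) = 0 := by
    intro k hk
    obtain ⟨k, rfl⟩ := Nat.exists_eq_succ_of_ne_zero hk
    rw [Function.iterate_succ_apply, h]
    exact Function.iterate_fixed h0 k
  funext p
  rw [opExp, tsum_eq_single 0]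
  · simp [opExpTerm]
  · intro k hk0
    rw [homogeneous_mixedDeriv.opExpTerm_smul, hk k hk0]
    simp

lemma gaussType₂_const (b : ℂ) : GaussType₂ 0 0 (fun _ => b) :=
  ⟨differentiable_const b, ‖b‖, fun p => by simp⟩

/-- Constants have type `α = β = 0`, for which the condition on `s` is just `|s| < |r|`. -/
lemma hasSum_gauss_mul_const {r s : ℂ} (h : ‖s‖ < ‖r‖) (b : ℂ) (p : ℂ × ℂ) :
    HasSum (opExpTerm (s • mixedDeriv) (fun q => exp (-(q.1 * q.2) / r) * b) p)
      (r / (r + s) * exp (-(p.1 * p.2) / (r + s)) * b) := by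
  have hr0 : 0 < ‖r‖ := (norm_nonneg s).trans_lt h
  have hs : ‖s‖ * (Real.sqrt (0 * 0) + 1 / ‖r‖) < 1 := by
    rw [mul_zero, Real.sqrt_zero, zero_add, mul_one_div]
    exact (div_lt_one hr0).2 h
  have h1 := hasSum_gauss_mul₂ (c := 0) (norm_pos_iff.1 hr0) le_rfl le_rfl
    (gaussType₂_const b) hs p
  rw [rightSide₂, contract₂_zero, opExp_mixedDeriv_const, gauss₂_zero, gauss₂_zero] at h1
  exact h1

end GaussOp

open GaussOp in
theorem mainTheorem7 :
    -- (1) the operator identity and its application to functions, two variables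
    (∀ (r s : ℂ) (α β : ℝ), r ≠ 0 → 0 ≤ α → 0 ≤ β →
      ‖s‖ * (Real.sqrt (α * β) + 1 / ‖r‖) < 1 →
      r + s ≠ 0 ∧
      ∀ f : ℂ × ℂ → ℂ, GaussType₂ α β f →
        -- application to `f(z, z')`
        OpExpSummable (s • mixedDeriv) (fun q => exp (-(q.1 * q.2) / r) * f q) ∧
        OpExpSummable ((s * (r + s) / r) • mixedDeriv)
          (fun q => f (r * q.1 / (r + s), r * q.2 / (r + s))) ∧
        (∀ z z' : ℂ,
          opExp (s • mixedDeriv) (fun q => exp (-(q.1 * q.2) / r) * f q) (z, z') =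
            r / (r + s) * exp (-(z * z') / (r + s)) *
              opExp ((s * (r + s) / r) • mixedDeriv)
                (fun q => f (r * q.1 / (r + s), r * q.2 / (r + s))) (z, z')) ∧
        -- application to `f(z, z')` with displacements `c = (z₀, z₀')`
        (∀ c : ℂ × ℂ,
          OpExpSummable (s • mixedDeriv) (fun q => gauss₂ r c q * f q) ∧
          OpExpSummable ((s * (r + s) / r) • mixedDeriv) (contract₂ r s c f) ∧
          opExp (s • mixedDeriv) (fun q => gauss₂ r c q * f q) = rightSide₂ r s c f) ∧
        -- the operator identities; `c = 0` is the one without displacements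
        (∀ (c : ℂ × ℂ) (γ : ℂ), exp γ = r / (r + s) →
          OpExpSummable (γ • euler₂ c) f ∧
          opExp (γ • euler₂ c) f = contract₂ r s c f ∧
          (opExp (s • mixedDeriv) ∘ mulBy (gauss₂ r c)) f =
            ((r / (r + s)) • (mulBy (gauss₂ (r + s) c) ∘
              opExp ((s * (r + s) / r) • mixedDeriv) ∘ opExp (γ • euler₂ c))) f)) ∧
    -- (2) arbitrary entire functions: equality of the expansions in powers of `s`
    (∀ (r : ℂ) (c : ℂ × ℂ) (f : ℂ × ℂ → ℂ), r ≠ 0 → Differentiable ℂ f →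
      ∀ (p : ℂ × ℂ) (N : ℕ),
        (fun s : ℂ =>
          (∑ k ∈ Finset.range N,
            opExpTerm (s • mixedDeriv) (fun q => gauss₂ r c q * f q) p k) -
          r / (r + s) * gauss₂ (r + s) c p *
            ∑ k ∈ Finset.range N,
              opExpTerm ((s * (r + s) / r) • mixedDeriv) (contract₂ r s c f) p k)
        =O[𝓝 0] fun s : ℂ => s ^ N) ∧
    -- (3) parameters for which only the right-hand side converges: it is the solution of
    -- `∂u/∂s = ∂²u/∂z∂z'` with the initial value `exp(-(z-z₀)(z'-z₀')/r) f(z,z')`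
    (∀ (r : ℂ) (c : ℂ × ℂ) (α β : ℝ) (f : ℂ × ℂ → ℂ), r ≠ 0 → 0 ≤ α → 0 ≤ β →
      GaussType₂ α β f →
      rightSide₂ r 0 c f = (fun q => gauss₂ r c q * f q) ∧
      ∀ s : ℂ, ‖s * r‖ * Real.sqrt (α * β) < ‖r + s‖ →
        OpExpSummable ((s * (r + s) / r) • mixedDeriv) (contract₂ r s c f) ∧
        Differentiable ℂ (rightSide₂ r s c f) ∧
        ∀ p : ℂ × ℂ, HasDerivAt (fun σ => rightSide₂ r σ c f p)
          (mixedDeriv (rightSide₂ r s c f) p) s) ∧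
    -- (4) `exp(s ∂²/∂z∂z*)` is the convolution with a normalized Gaussian
    (∀ (s α β : ℝ) (g : ℂ × ℂ → ℂ), 0 < s → 0 ≤ α → 0 ≤ β → s * ((α + β) / 2) < 1 →
      GaussType₂ α β g →
      OpExpSummable ((s : ℂ) • mixedDeriv) g ∧
      ∀ z : ℂ, ConvAt (kernel₂ s) (fun w => g (w, conj w)) z ∧
        opExp ((s : ℂ) • mixedDeriv) g (z, conj z) =
          conv (kernel₂ s) (fun w => g (w, conj w)) z) ∧
    -- (5) the identity for Gaussian convolutions in the plane, arbitrary functions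
    (∀ (r s : ℝ) (z₀ : ℂ) (f : ℂ → ℂ), 0 < r → 0 < s → ∀ z : ℂ,
      (ConvAt (kernel₂ s) (fun w => gauss₂ r (z₀, conj z₀) (w, conj w) * f w) z ↔
        ConvAt (kernel₂ (s * (r + s) / r)) (fun w => f ((r * w + s * z₀) / (r + s))) z) ∧
      conv (kernel₂ s) (fun w => gauss₂ r (z₀, conj z₀) (w, conj w) * f w) z =
        r / (r + s) * gauss₂ (r + s) (z₀, conj z₀) (z, conj z) *
          conv (kernel₂ (s * (r + s) / r)) (fun w => f ((r * w + s * z₀) / (r + s))) z) ∧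
    -- (6) two normalized Gaussians in two dimensions
    (∀ r s : ℂ, ‖s‖ < ‖r‖ →
      OpExpSummable (s • mixedDeriv) (fun q => exp (-(q.1 * q.2) / r) * (1 / (Real.pi * r))) ∧
      ∀ z z' : ℂ,
        opExp (s • mixedDeriv) (fun q => exp (-(q.1 * q.2) / r) * (1 / (Real.pi * r))) (z, z') =
          1 / (Real.pi * (r + s)) * exp (-(z * z') / (r + s))) ∧
    (∀ r s : ℝ, 0 < r → 0 < s →
      (∀ z : ℂ, ConvAt (kernel₂ s) (kernel₂ r) z) ∧
      conv (kernel₂ s) (kernel₂ r) = kernel₂ (r + s)) ∧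
    -- (1') the operator identity and its application to functions, one variable
    (∀ (r s : ℂ) (a : ℝ), r ≠ 0 → 0 ≤ a → ‖s‖ * (a + 1 / ‖r‖) < 1 →
      r + s ≠ 0 ∧
      ∀ f : ℂ → ℂ, GaussType₁ a f →
        OpExpSummable ((s / 4) • secondDeriv) (fun y => exp (-y ^ 2 / r) * f y) ∧
        OpExpSummable ((s * (r + s) / (4 * r)) • secondDeriv)
          (fun y => f (r * y / (r + s))) ∧
        (∀ x : ℂ,
          opExp ((s / 4) • secondDeriv) (fun y => exp (-y ^ 2 / r) * f y) x =
            (r / (r + s)) ^ (1 / 2 : ℂ) * exp (-x ^ 2 / (r + s)) *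
              opExp ((s * (r + s) / (4 * r)) • secondDeriv)
                (fun y => f (r * y / (r + s))) x) ∧
        (∀ c : ℂ,
          OpExpSummable ((s / 4) • secondDeriv) (fun y => gauss₁ r c y * f y) ∧
          OpExpSummable ((s * (r + s) / (4 * r)) • secondDeriv) (contract₁ r s c f) ∧
          opExp ((s / 4) • secondDeriv) (fun y => gauss₁ r c y * f y) = rightSide₁ r s c f) ∧
        (∀ c γ : ℂ, exp γ = r / (r + s) →
          OpExpSummable (γ • euler₁ c) f ∧
          opExp (γ • euler₁ c) f = contract₁ r s c f ∧
          (opExp ((s / 4) • secondDeriv) ∘ mulBy (gauss₁ r c)) f =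
            ((r / (r + s)) ^ (1 / 2 : ℂ) • (mulBy (gauss₁ (r + s) c) ∘
              opExp ((s * (r + s) / (4 * r)) • secondDeriv) ∘ opExp (γ • euler₁ c))) f)) ∧
    -- (2')
    (∀ (r c : ℂ) (f : ℂ → ℂ), r ≠ 0 → Differentiable ℂ f →
      ∀ (x : ℂ) (N : ℕ),
        (fun s : ℂ =>
          (∑ k ∈ Finset.range N,
            opExpTerm ((s / 4) • secondDeriv) (fun y => gauss₁ r c y * f y) x k) -
          (r / (r + s)) ^ (1 / 2 : ℂ) * gauss₁ (r + s) c x *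
            ∑ k ∈ Finset.range N,
              opExpTerm ((s * (r + s) / (4 * r)) • secondDeriv) (contract₁ r s c f) x k)
        =O[𝓝 0] fun s : ℂ => s ^ N) ∧
    -- (3')
    (∀ (r c : ℂ) (a : ℝ) (f : ℂ → ℂ), r ≠ 0 → 0 ≤ a → GaussType₁ a f →
      rightSide₁ r 0 c f = (fun y => gauss₁ r c y * f y) ∧
      ∀ s : ℂ, ‖s * r‖ * a < ‖r + s‖ → r / (r + s) ∈ slitPlane →
        OpExpSummable ((s * (r + s) / (4 * r)) • secondDeriv) (contract₁ r s c f) ∧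
        Differentiable ℂ (rightSide₁ r s c f) ∧
        ∀ x : ℂ, HasDerivAt (fun σ => rightSide₁ r σ c f x)
          (1 / 4 * secondDeriv (rightSide₁ r s c f) x) s) ∧
    -- (4')
    (∀ (s a : ℝ) (g : ℂ → ℂ), 0 < s → 0 ≤ a → s * a < 1 → GaussType₁ a g →
      OpExpSummable ((s / 4 : ℂ) • secondDeriv) g ∧
      ∀ x : ℝ, ConvAt (kernel₁ s) (fun y : ℝ => g y) x ∧
        opExp ((s / 4 : ℂ) • secondDeriv) g x = conv (kernel₁ s) (fun y : ℝ => g y) x) ∧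
    -- (5')
    (∀ (r s x₀ : ℝ) (f : ℝ → ℂ), 0 < r → 0 < s → ∀ x : ℝ,
      (ConvAt (kernel₁ s) (fun y => gauss₁ r x₀ y * f y) x ↔
        ConvAt (kernel₁ (s * (r + s) / r)) (fun y => f ((r * y + s * x₀) / (r + s))) x) ∧
      conv (kernel₁ s) (fun y => gauss₁ r x₀ y * f y) x =
        Real.sqrt (r / (r + s)) * gauss₁ (r + s) x₀ x *
          conv (kernel₁ (s * (r + s) / r)) (fun y => f ((r * y + s * x₀) / (r + s))) x) ∧
    -- (6')
    (∀ r s : ℝ, 0 < r → 0 < s →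
      (∀ x : ℝ, ConvAt (kernel₁ s) (kernel₁ r) x) ∧
      conv (kernel₁ s) (kernel₁ r) = kernel₁ (r + s)) := by
  refine ⟨?_, fun r c f hr hf p N => isBigO_trunc₂ c hr hf p N, ?_,
    fun s α β g hs hα hβ h hg => opExp_eq_conv₂ hs hα hβ h hg,
    fun r s z₀ f hr hs z => conv_gauss₂ hr hs z₀ f z, ?_,
    fun r s hr hs => conv_kernel₂ hr hs, ?_,
    fun r c f hr hf x N => isBigO_trunc₁ c hr hf x N, ?_,
    fun s a g hs ha h hg => opExp_eq_conv₁ hs ha h hg,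
    fun r s x₀ f hr hs x => conv_gauss₁ hr hs x₀ f x,
    fun r s hr hs => conv_kernel₁ hr hs⟩
  · intro r s α β hr hα hβ hs
    have hmem := (mem_timeDomain₁_of_norm_mul_lt hr (Real.sqrt_nonneg _) hs).1
    have hrs := hmem.1
    refine ⟨hrs, fun f hf => ?_⟩
    have key : ∀ c : ℂ × ℂ,
        OpExpSummable (s • mixedDeriv) (fun q => gauss₂ r c q * f q) ∧
        OpExpSummable ((s * (r + s) / r) • mixedDeriv) (contract₂ r s c f) ∧
        opExp (s • mixedDeriv) (fun q => gauss₂ r c q * f q) = rightSide₂ r s c f := fun c =>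
      ⟨fun p => (hasSum_gauss_mul₂ hr hα hβ hf hs p).summable,
        (rightSide₂_solution hr hα hβ hf hmem).1,
        funext fun p => (hasSum_gauss_mul₂ hr hα hβ hf hs p).tsum_eq⟩
    -- The undisplaced formulas are the case `c = 0`.
    obtain ⟨h1, h2, h3⟩ := key 0
    unfold rightSide₂ at h3
    rw [gauss₂_zero, contract₂_zero, gauss₂_zero] at h3
    rw [gauss₂_zero] at h1
    rw [contract₂_zero] at h2
    refine ⟨h1, h2, fun z z' => congrFun h3 (z, z'), key, fun c γ hγ => ?_⟩
    refine ⟨fun p => (hasSum_opExpTerm_euler₂ c p γ hf.1).summable,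
      opExp_euler₂ hrs hγ c hf.1, ?_⟩
    refine Eq.trans (key c).2.2 (funext fun p => ?_)
    simp only [Pi.smul_apply, Function.comp_apply, mulBy, smul_eq_mul, opExp_euler₂ hrs hγ c hf.1,
      rightSide₂, mul_assoc]
  · intro r c α β f hr hα hβ hf
    exact ⟨rightSide₂_zero hr, fun s hs => rightSide₂_solution hr hα hβ hf
      (mem_timeDomain_of_norm_lt hs (Real.sqrt_nonneg _))⟩
  · intro r s h
    have hr : r ≠ 0 := norm_pos_iff.1 ((norm_nonneg s).trans_lt h)
    refine ⟨fun p => (hasSum_gauss_mul_const h _ p).summable, fun z z' => ?_⟩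
    rw [opExp, (hasSum_gauss_mul_const h _ (z, z')).tsum_eq]
    have hrs : r + s ≠ 0 := fun h0 => h.ne (by rw [eq_neg_of_add_eq_zero_left h0, norm_neg])
    have hpi : (Real.pi : ℂ) ≠ 0 := ofReal_ne_zero.2 Real.pi_ne_zero
    field_simp
  · intro r s a hr ha hs
    have hmem := mem_timeDomain₁_of_norm_mul_lt hr ha hs
    have hrs := hmem.1.1
    refine ⟨hrs, fun f hf => ?_⟩
    have key : ∀ c : ℂ,
        OpExpSummable ((s / 4) • secondDeriv) (fun y => gauss₁ r c y * f y) ∧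
        OpExpSummable ((s * (r + s) / (4 * r)) • secondDeriv) (contract₁ r s c f) ∧
        opExp ((s / 4) • secondDeriv) (fun y => gauss₁ r c y * f y) = rightSide₁ r s c f :=
      fun c => ⟨fun x => (hasSum_gauss_mul₁ hr ha hf hs x).summable,
        (rightSide₁_solution hr ha hf hmem).1,
        funext fun x => (hasSum_gauss_mul₁ hr ha hf hs x).tsum_eq⟩
    obtain ⟨h1, h2, h3⟩ := key 0
    unfold rightSide₁ at h3
    rw [gauss₁_zero, contract₁_zero, gauss₁_zero] at h3
    rw [gauss₁_zero] at h1
    rw [contract₁_zero] at h2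
    refine ⟨h1, h2, fun x => congrFun h3 x, key, fun c γ hγ => ?_⟩
    refine ⟨fun x => (hasSum_opExpTerm_euler₁ c x γ hf.1).summable,
      opExp_euler₁ hrs hγ c hf.1, ?_⟩
    refine Eq.trans (key c).2.2 (funext fun x => ?_)
    simp only [Pi.smul_apply, Function.comp_apply, mulBy, smul_eq_mul, opExp_euler₁ hrs hγ c hf.1,
      rightSide₁, mul_assoc]
  · intro r c a f hr ha hf
    exact ⟨rightSide₁_zero hr, fun s hs hsl => rightSide₁_solution hr ha hf
      ⟨mem_timeDomain_of_norm_lt hs ha, hsl⟩⟩
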